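/- **Setting.** Let $L$ be a free abelian group of finite rank $r$ with a $\mathbb Z$-valued symmetric bilinear form $\langle\cdot,\cdot\rangle$, possibly indefinite, and let $\varepsilon_1,\dots,\varepsilon_r$ be a $\mathbb Z$-basis of $L$. Assume the form is non-degenerate, so that there are $\varepsilon_i'\in L\otimes\mathbb Q$ with $\langle\varepsilon'_i,\varepsilon_j\rangle=\delta_{i,j}$. Let $b:L\times L\to\mathbb Z/2\mathbb Z$ be any bilinear function with $b(\lambda,\mu)+b(\mu,\lambda)=\langle\lambda,\mu\rangle+\langle\lambda,\lambda\rangle\langle\mu,\mu\rangle+2\mathbb Z$, and put $\beta=(-1)^b$. *The lattice vertex operators.* Let $\mathfrak h=L\otimes_{\mathbb Z}\mathbb C$, let $S=S(\mathfrak h[t^{-1}]t^{-1})$ be the symmetric algebra, and let $V_L=S\otimes\mathbb C[L]$, with $\mathbb C[L]$ spanned by symbols $\mathbf v_\mu$, $\mu\in L$. For $u\in\mathfrak h$ and $m\in\mathbb Z$ let $u(m)$ be the Heisenberg operator on $V_L$: for $m<0$ it is multiplication by $u(m)=u\otimes t^m$; for $m>0$ it is the derivation of $S$ with $v(-n)\mapsto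 m\langle u,v\rangle\delta_{m,n}$; and $u(0)(p\otimes\mathbf v_\mu)=\langle u,\mu\rangle\,p\otimes\mathbf v_\mu$. Put $u(z)=\sum_{n}u(n)z^{-n-1}$ and $$Y(\mathbf v_\lambda,z)=\exp\Big(-\sum_{n<0}\tfrac{\lambda(n)}{n}z^{-n}\Big)\exp\Big(-\sum_{n>0}\tfrac{\lambda(n)}{n}z^{-n}\Big)\mathbf v_\lambda z^{\lambda(0)},$$ where $\mathbf v_\lambda(p\otimes\mathbf v_\mu)=\beta(\lambda,\mu)\,p\otimes\mathbf v_{\lambda+\mu}$ and $z^{\lambda(0)}(p\otimes\mathbf v_\mu)=z^{\langle\lambda,\mu\rangle}p\otimes\mathbf v_\mu$. The lattice vertex operators are the linear extension of $$Y\big(u_1(-k_1-1)\cdots u_s(-k_s-1)\otimes\mathbf v_\lambda,z\big)=\;:\tfrac{\partial^{k_1}u_1(z)}{k_1!}\cdots\tfrac{\partial^{k_s}u_s(z)}{k_s!}\,Y(\mathbf v_\lambda,z):\,,$$ with the nested normally ordered product $:\!A(z)B(z)\!:\;=A(z)_-B(z)+B(z)A(z)_+$, where for $A(z)=\sum_nA_nz^{-n-1}$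 one sets $A(z)_-=\sum_{n<0}A_nz^{-n-1}$ and $A(z)_+=\sum_{n\ge0}A_nz^{-n-1}$. Let $\theta$ be the Kummer involution of $V_L$: $\theta(p\otimes\mathbf v_\lambda)=(-1)^kp\otimes\mathbf v_{-\lambda}$ for $p\in S$ homogeneous of degree $k$ in the variables $u(-m)$. *The cone space.* Let $P$ (respectively $N$) be the set of all $\sum_i\alpha_i\varepsilon_i\in L\otimes\mathbb Q$ with all $\alpha_i\ge0$ (respectively all $\alpha_i<0$), and let $D=P\cup N$. For a subset $K$ of $L\otimes\mathbb Q$ write $K(L)=K\cap L$ and $V_{K(L)}=S\otimes\mathbb C[K(L)]\subset V_L$. Then $V_{D(L)}=V_{P(L)}\oplus V_{N(L)}$ if $r>0$ (if $r=0$, then $P=N=\{0\}$, and only the first of the four cases below is used). Define $\widetilde Y$ on $V_{D(L)}$ by bilinear extension of $$\widetilde Y(a,z)b=\begin{cases}Y(a,z)b,&a,b\in V_{P(L)},\\ Y(\theta a,z)b,&a\in V_{P(L)},\ b\in V_{N(L)},\\ Y(a,z)\theta b,&a\in V_{N(L)},\ b\in V_{P(L)},\\ \theta Y(a,z)b,&a,b\in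 V_{N(L)}.\end{cases}$$ All coefficients of $\widetilde Y(a,z)b$ lie in $V_{D(L)}$. Let $\mathbf v=1\otimes\mathbf v_0$ and $\omega=\frac12\sum_{i=1}^r\varepsilon_i'(-1)\varepsilon_i(-1)\otimes\mathbf v_0$, and call $p\otimes\mathbf v_\lambda$ even or odd according as $\langle\lambda,\lambda\rangle$ is even or odd. *Terminology.* A super vertex algebra $(V,Y,\mathbf v)$ is a complex super vector space with an even vector $\mathbf v$ and a parity-preserving bilinear map $V\times V\to V((z))$, $(a,b)\mapsto Y(a,z)b$, such that $Y(\mathbf v,z)=\mathrm{Id}$; $Y(a,z)\mathbf v\in a+zV[[z]]$; $[T,Y(a,z)]=\partial_zY(a,z)$, where $Ta$ is the coefficient of $z$ in $Y(a,z)\mathbf v$; and any two fields $Y(a,z),Y(b,w)$ are mutually local in the super sense: $(z-w)^n$ annihilates their super commutator for large $n$. It is conformal of central charge $c$, with conformal element $\omega$, if $\omega$ is even, the operators $L(n)$ defined by $Y(\omega,z)=\sum_nL(n)z^{-n-2}$ satisfy the Virasoro relations $[L(m),L(n)]=(m-n)L(m+n)+\frac{m^3-m}{12}\delta_{m+n,0}\,c$,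 $L(-1)=T$, and $V$ is the direct sum of the eigenspaces of $L(0)$ with eigenvalues in $\frac12\mathbb Z$. It is a super vertex operator algebra if moreover these eigenspaces are finite-dimensional, the eigenvalues are bounded from below, and vectors with eigenvalue in $\mathbb Z$ are even and vectors with eigenvalue in $\frac12+\mathbb Z$ are odd. **Theorem.** The four-tuple $(V_{D(L)},\widetilde Y,\mathbf v,\omega)$ is a conformal super vertex algebra, of central charge $r$. It is a super vertex operator algebra if $\langle x,x\rangle>0$ for every non-zero $x\in D$. -/

import Mathlib

open scoped TensorProduct

noncomputable section

namespace ConeVA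

/-! ## Super vertex algebras

The vertex operators of a complex vector space `V` are given by their modes:
`Y a n b` is the vector `a₍ₙ₎ b`, where `Y(a, z) = ∑ₙ a₍ₙ₎ z ^ (-n-1)`. -/

/-- `(V, Y, vac)` is a super vertex algebra, where `V` is the direct sum of its even part `par 0`
and its odd part `par 1`. -/
structure IsSuperVertexAlgebra {V : Type*} [AddCommGroup V] [Module ℂ V]
    (par : ZMod 2 → Submodule ℂ V) (Y : V → ℤ → V → V) (vac : V) : Prop where
  add_left : ∀ a a' n b, Y (a + a') n b = Y a n b + Y a' n b
  smul_left : ∀ (c : ℂ) a n b, Y (c • a) n b = c • Y a n b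
  add_right : ∀ a n b b', Y a n (b + b') = Y a n b + Y a n b'
  smul_right : ∀ (c : ℂ) a n b, Y a n (c • b) = c • Y a n b
  /-- `Y(a, z) b` lies in `V((z))`. -/
  field : ∀ a b, ∃ N : ℤ, ∀ n, N ≤ n → Y a n b = 0
  /-- `V` is a super vector space. -/
  super : DirectSum.IsInternal par
  parity : ∀ i j a b, a ∈ par i → b ∈ par j → ∀ n, Y a n b ∈ par (i + j)
  vac_even : vac ∈ par 0
  /-- `Y(vac, z) = Id`. -/
  vacuum : ∀ n b, Y vac n b = if n = -1 then b else 0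
  /-- `Y(a, z) vac` lies in `a + z V[[z]]`. -/
  creation : ∀ a, Y a (-1) vac = a ∧ ∀ n, 0 ≤ n → Y a n vac = 0
  /-- `[T, Y(a, z)] = ∂ Y(a, z)`, where `T` is the translation operator `T a = a₍₋₂₎ vac`. -/
  translation : ∀ a n b,
    Y (Y a n b) (-2) vac - Y a n (Y b (-2) vac) = -(n : ℂ) • Y a (n - 1) b
  /-- Locality: `(z - w) ^ N [Y(a, z), Y(b, w)] = 0` for large `N`, where the bracket is the super
  commutator. -/
  locality : ∀ i j a b, a ∈ par i → b ∈ par j → ∃ N : ℕ, ∀ (m n : ℤ) (c : V),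
    ∑ k ∈ Finset.range (N + 1), ((-1 : ℂ) ^ k * (N.choose k : ℂ)) •
      (Y a (m + N - k) (Y b (n + k) c)
        - (-1 : ℂ) ^ (i.val * j.val) • Y b (n + k) (Y a (m + N - k) c)) = 0

/-- The mode `a₍ₙ₎` of a super vertex algebra as a linear operator. -/
def IsSuperVertexAlgebra.mode {V : Type*} [AddCommGroup V] [Module ℂ V]
    {par : ZMod 2 → Submodule ℂ V} {Y : V → ℤ → V → V} {vac : V}
    (h : IsSuperVertexAlgebra par Y vac) (a : V) (n : ℤ) : Module.End ℂ V where
  toFun := Y a n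
  map_add' := h.add_right a n
  map_smul' c b := h.smul_right c a n b

/-- `(V, Y, vac, ω)` is a conformal super vertex algebra of central charge `c`. Here
`L(n) = ω₍ₙ₊₁₎`, so that `Y(ω, z) = ∑ₙ L(n) z ^ (-n-2)`. -/
structure IsConformalSuperVertexAlgebra {V : Type*} [AddCommGroup V] [Module ℂ V]
    (par : ZMod 2 → Submodule ℂ V) (Y : V → ℤ → V → V) (vac ω : V) (c : ℂ) : Prop where
  isSuperVertexAlgebra : IsSuperVertexAlgebra par Y vac
  conformal_even : ω ∈ par 0
  virasoro : ∀ (m n : ℤ) (v : V),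
    Y ω (m + 1) (Y ω (n + 1) v) - Y ω (n + 1) (Y ω (m + 1) v)
      = ((m : ℂ) - n) • Y ω (m + n + 1) v
        + (if m + n = 0 then ((m : ℂ) ^ 3 - m) / 12 * c else 0) • v
  /-- `L(-1)` is the translation operator. -/
  translation_eq : ∀ v, Y ω 0 v = Y v (-2) vac
  /-- `V` is the direct sum of the eigenspaces of `L(0)` for the eigenvalues `d / 2`, `d ∈ ℤ`. -/
  grading : DirectSum.IsInternal
    fun d : ℤ => (isSuperVertexAlgebra.mode ω 1).eigenspace ((d : ℂ) / 2)

/-- `(V, Y, vac, ω)` is a super vertex operator algebra of central charge `c`: the eigenspaces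
of `L(0)` are finite-dimensional, the eigenvalues are bounded from below, and vectors of integral
(respectively properly half-integral) degree are even (respectively odd). -/
structure IsSuperVertexOperatorAlgebra {V : Type*} [AddCommGroup V] [Module ℂ V]
    (par : ZMod 2 → Submodule ℂ V) (Y : V → ℤ → V → V) (vac ω : V) (c : ℂ) : Prop where
  conformal : IsConformalSuperVertexAlgebra par Y vac ω c
  finite_dim : ∀ d : ℤ, FiniteDimensional ℂ
    ((conformal.isSuperVertexAlgebra.mode ω 1).eigenspace ((d : ℂ) / 2))
  bounded_below : ∃ d₀ : ℤ, ∀ d < d₀,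
    (conformal.isSuperVertexAlgebra.mode ω 1).eigenspace ((d : ℂ) / 2) = ⊥
  spin_statistics : ∀ d : ℤ,
    (conformal.isSuperVertexAlgebra.mode ω 1).eigenspace ((d : ℂ) / 2) ≤ par (d : ZMod 2)

/-! ## Formal operations on modes -/

/-- The modes of `∂ ^ k A(z) / k!`, for `A(z) = ∑ₙ A n z ^ (-n-1)`. -/
def derivModes {V : Type*} [AddCommGroup V] [Module ℂ V] (A : ℤ → V → V) (k : ℕ) : ℤ → V → V :=
  fun n v => ((-1 : ℂ) ^ k * (Ring.choose n k : ℤ)) • A (n - k) v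

/-- The modes of the normally ordered product
`:A(z) B(z): = (∑_{m < 0} A m z ^ (-m-1)) B(z) + B(z) (∑_{m ≥ 0} A m z ^ (-m-1))`.
On each vector only finitely many terms are non-zero for the fields considered below. -/
def normalOrder {V : Type*} [AddCommGroup V] (A B : ℤ → V → V) : ℤ → V → V :=
  fun n v => ∑ᶠ k : ℕ, A (-k - 1) (B (n + k) v) + ∑ᶠ k : ℕ, B (n - k - 1) (A k v)

/-- The coefficient of `t ^ k` in `exp f`, for a power series `f` without constant term. -/
def expCoeff {A : Type*} [Ring A] [Algebra ℂ A] (f : PowerSeries A) (k : ℕ) : A :=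
  ∑ j ∈ Finset.range (k + 1), ((j.factorial : ℂ)⁻¹) • PowerSeries.coeff k (f ^ j)

/-! ## The lattice vertex operators -/

/-- The symmetric algebra of `t⁻¹ 𝔥[t⁻¹]`, where `𝔥 = ℂ ⊗ L` and `L` has a basis
`ε₁, …, εᵣ`; the variable `(i, k)` is `εᵢ(-k-1)`. -/
abbrev Fock (r : ℕ) : Type := MvPolynomial (Fin r × ℕ) ℂ

/-- The space `V_L = S(t⁻¹ 𝔥[t⁻¹]) ⊗ ℂ[L]`; the vector `p ⊗ v_μ` is `Finsupp.single μ p`. -/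
abbrev LatticeSpace (L : Type*) (r : ℕ) : Type _ := L →₀ Fock r

/-- The subspace `V_K = S(t⁻¹ 𝔥[t⁻¹]) ⊗ ℂ[K]` of `V_L` for a subset `K` of `L`. -/
abbrev subspaceOn {L : Type*} {r : ℕ} (K : Set L) : Submodule ℂ (LatticeSpace L r) :=
  Finsupp.supported (Fock r) ℂ K

section Lattice

variable {L : Type*} [AddCommGroup L] {r : ℕ}

/-- The action of `u(m)`, `u ∈ 𝔥`, `m ≠ 0`, on the symmetric algebra: for `m < 0` multiplication by
`u(m)`, for `m > 0` the derivation with `εⱼ(-l) ↦ m ⟨u, εⱼ⟩ δ_{m,l}`. (For `m = 0`, where `u(0)`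
depends on the lattice point, the value is `0`.) -/
def oscillator (B : LinearMap.BilinForm ℤ L) (ε : Module.Basis (Fin r) ℤ L) (u : ℂ ⊗[ℤ] L) :
    ℤ → Module.End ℂ (Fock r)
  | .negSucc k => LinearMap.mulLeft ℂ
      (∑ i, (ε.baseChange ℂ).repr u i • MvPolynomial.X (i, k))
  | .ofNat 0 => 0
  | .ofNat (m + 1) => (MvPolynomial.mkDerivation ℂ fun x : Fin r × ℕ =>
      if x.2 = m then
        MvPolynomial.C (((m : ℂ) + 1) * B.baseChange ℂ u (1 ⊗ₜ[ℤ] ε x.1)) else 0).toLinearMap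

/-- The action of `u(m)` on `V_L`; in particular `u(0) (p ⊗ v_μ) = ⟨u, μ⟩ p ⊗ v_μ`. -/
def heisenberg (B : LinearMap.BilinForm ℤ L) (ε : Module.Basis (Fin r) ℤ L) (u : ℂ ⊗[ℤ] L) (m : ℤ) :
    Module.End ℂ (LatticeSpace L r) :=
  Finsupp.lsum ℂ fun μ => Finsupp.lsingle μ ∘ₗ
    (if m = 0 then (B.baseChange ℂ u (1 ⊗ₜ[ℤ] μ)) • LinearMap.id else oscillator B ε u m)

/-- The coefficient of `z ^ k` in `exp (- ∑_{n < 0} λ(n) / n z ^ (-n))`. -/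
def expMinus (B : LinearMap.BilinForm ℤ L) (ε : Module.Basis (Fin r) ℤ L) (lam : L) (k : ℕ) :
    Module.End ℂ (Fock r) :=
  expCoeff (PowerSeries.mk fun n : ℕ =>
    ((n : ℂ)⁻¹) • oscillator B ε (1 ⊗ₜ[ℤ] lam) (-n)) k

/-- The coefficient of `z ^ (-k)` in `exp (- ∑_{n > 0} λ(n) / n z ^ (-n))`. -/
def expPlus (B : LinearMap.BilinForm ℤ L) (ε : Module.Basis (Fin r) ℤ L) (lam : L) (k : ℕ) :
    Module.End ℂ (Fock r) :=
  expCoeff (PowerSeries.mk fun n : ℕ =>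
    (-(n : ℂ)⁻¹) • oscillator B ε (1 ⊗ₜ[ℤ] lam) n) k

/-- The modes of
`Y(v_λ, z) = exp (- ∑_{n<0} λ(n)/n z^(-n)) exp (- ∑_{n>0} λ(n)/n z^(-n)) v_λ z^λ(0)`,
where `v_λ (p ⊗ v_μ) = β(λ, μ) p ⊗ v_(λ+μ)`, `β = (-1) ^ b`, and
`z^λ(0) (p ⊗ v_μ) = z^⟨λ,μ⟩ p ⊗ v_μ`. The coefficient of `z ^ (-n-1)` on `p ⊗ v_μ` is the sum over
`l` of the terms with `z ^ (-l)` from the second exponential and `z ^ (l-n-1-⟨λ,μ⟩)` from the first;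
it is a finite sum. -/
def vertexModes (B : LinearMap.BilinForm ℤ L) (b : L →+ L →+ ZMod 2)
    (ε : Module.Basis (Fin r) ℤ L) (lam : L) (n : ℤ) (w : LatticeSpace L r) : LatticeSpace L r :=
  w.sum fun μ q => Finsupp.single (lam + μ) ((-1 : ℂ) ^ (b lam μ).val •
    ∑ᶠ l : ℕ, if 0 ≤ (l : ℤ) - n - 1 - B lam μ then
      expMinus B ε lam ((l : ℤ) - n - 1 - B lam μ).toNat (expPlus B ε lam l q) else 0)

/-- The modes of `Y(ε_{i₁}(-k₁-1) ⋯ ε_{iₛ}(-kₛ-1) ⊗ v_λ, z)`, that is, of the iterated normally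
ordered product
`: ∂^{k₁} ε_{i₁}(z) / k₁! ⋯ ∂^{kₛ} ε_{iₛ}(z) / kₛ! Y(v_λ, z) :`
with `u(z) = ∑ₙ u(n) z ^ (-n-1)`. The result does not depend on the order of the list. -/
def monomialModes (B : LinearMap.BilinForm ℤ L) (b : L →+ L →+ ZMod 2)
    (ε : Module.Basis (Fin r) ℤ L) (lam : L) :
    List (Fin r × ℕ) → ℤ → LatticeSpace L r → LatticeSpace L r
  | [] => vertexModes B b ε lam
  | (i, k) :: xs => normalOrder
      (derivModes (fun n => heisenberg B ε (1 ⊗ₜ[ℤ] ε i) n) k) (monomialModes B b ε lam xs)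

/-- The vertex operators of `V_L`. -/
def latticeY (B : LinearMap.BilinForm ℤ L) (b : L →+ L →+ ZMod 2) (ε : Module.Basis (Fin r) ℤ L)
    (a : LatticeSpace L r) (n : ℤ) (w : LatticeSpace L r) : LatticeSpace L r :=
  a.sum fun lam p => ∑ s ∈ p.support, p.coeff s •
    monomialModes B b ε lam (Finsupp.toMultiset s).toList n w

/-- The Kummer involution `θ`: `θ (p ⊗ v_λ) = (-1) ^ k p ⊗ v_(-λ)` for `p` homogeneous of degree
`k` in the variables `εᵢ(-n)`. -/
def theta : LatticeSpace L r →ₗ[ℂ] LatticeSpace L r :=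
  Finsupp.lmapDomain (Fock r) ℂ (fun lam : L => -lam) ∘ₗ
    Finsupp.mapRange.linearMap
      (MvPolynomial.aeval fun x : Fin r × ℕ => -(MvPolynomial.X x : Fock r)).toLinearMap

/-! ## The cones -/

/-- The non-negative rational combinations of the basis vectors. -/
def coneP (ε : Module.Basis (Fin r) ℤ L) : Set (ℚ ⊗[ℤ] L) :=
  {x | ∃ α : Fin r → ℚ, (∀ i, 0 ≤ α i) ∧ x = ∑ i, α i • ((1 : ℚ) ⊗ₜ[ℤ] ε i)}

/-- The strictly negative rational combinations of the basis vectors. -/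
def coneN (ε : Module.Basis (Fin r) ℤ L) : Set (ℚ ⊗[ℤ] L) :=
  {x | ∃ α : Fin r → ℚ, (∀ i, α i < 0) ∧ x = ∑ i, α i • ((1 : ℚ) ⊗ₜ[ℤ] ε i)}

/-- The union of cones `D = P ∪ N`. -/
def coneD (ε : Module.Basis (Fin r) ℤ L) : Set (ℚ ⊗[ℤ] L) := coneP ε ∪ coneN ε

/-- `S ∩ L` for a subset `S` of `ℚ ⊗ L`. -/
def latticePoints (S : Set (ℚ ⊗[ℤ] L)) : Set L := {lam | (1 : ℚ) ⊗ₜ[ℤ] lam ∈ S}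

/-! ## The cone vertex operators -/

open Classical in
/-- The component of a vector in `V_{P(L)}`. -/
def compP (ε : Module.Basis (Fin r) ℤ L) (a : LatticeSpace L r) : LatticeSpace L r :=
  a.filter (· ∈ latticePoints (coneP ε))

open Classical in
/-- The component of a vector of `V_{D(L)}` in `V_{N(L)}`, along `V_{P(L)}`. (In rank zero, where
`P = N = {0}`, it is `0`.) -/
def compN (ε : Module.Basis (Fin r) ℤ L) (a : LatticeSpace L r) : LatticeSpace L r :=
  a.filter (· ∉ latticePoints (coneP ε))

/-- The bilinear extension of the four cases
`Y(a,z)b` on `P × P`, `Y(θa,z)b` on `P × N`, `Y(a,z)θb` on `N × P`, `θY(a,z)b` on `N × N`. -/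
def twistedY (B : LinearMap.BilinForm ℤ L) (b : L →+ L →+ ZMod 2) (ε : Module.Basis (Fin r) ℤ L)
    (x : LatticeSpace L r) (n : ℤ) (y : LatticeSpace L r) : LatticeSpace L r :=
  latticeY B b ε (compP ε x) n (compP ε y)
    + latticeY B b ε (theta (compP ε x)) n (compN ε y)
    + latticeY B b ε (compN ε x) n (theta (compP ε y))
    + theta (latticeY B b ε (compN ε x) n (compN ε y))

/-! ### The cone vertex operators preserve `V_{D(L)}` -/

theorem heisenberg_mem (B : LinearMap.BilinForm ℤ L) (ε : Module.Basis (Fin r) ℤ L)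
    (u : ℂ ⊗[ℤ] L) (m : ℤ) {K : Set L} {w : LatticeSpace L r} (hw : w ∈ subspaceOn K) :
    heisenberg B ε u m w ∈ subspaceOn (r := r) K := by
  rw [heisenberg, Finsupp.lsum_apply]
  refine Submodule.sum_mem _ fun μ hμ => ?_
  exact Finsupp.single_mem_supported ℂ _ (hw hμ)

theorem vertexModes_mem (B : LinearMap.BilinForm ℤ L) (b : L →+ L →+ ZMod 2)
    (ε : Module.Basis (Fin r) ℤ L) (lam : L) (n : ℤ) {K K' : Set L} {w : LatticeSpace L r}
    (hK : ∀ μ ∈ K, lam + μ ∈ K') (hw : w ∈ subspaceOn K) :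
    vertexModes B b ε lam n w ∈ subspaceOn (r := r) K' := by
  rw [vertexModes]
  refine Submodule.sum_mem _ fun μ hμ => ?_
  exact Finsupp.single_mem_supported ℂ _ (hK μ (hw hμ))

theorem monomialModes_mem (B : LinearMap.BilinForm ℤ L) (b : L →+ L →+ ZMod 2)
    (ε : Module.Basis (Fin r) ℤ L) (lam : L) {K K' : Set L} (hK : ∀ μ ∈ K, lam + μ ∈ K')
    (xs : List (Fin r × ℕ)) : ∀ (n : ℤ) {w : LatticeSpace L r}, w ∈ subspaceOn K →
    monomialModes B b ε lam xs n w ∈ subspaceOn (r := r) K' := by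
  induction xs with
  | nil => exact fun n w hw => vertexModes_mem B b ε lam n hK hw
  | cons x xs ih =>
    intro n w hw
    have hd : ∀ (m : ℤ) {K : Set L} {v : LatticeSpace L r}, v ∈ subspaceOn K →
        derivModes (fun n => heisenberg B ε (1 ⊗ₜ[ℤ] ε x.1) n) x.2 m v
          ∈ subspaceOn (r := r) K := fun m K v hv =>
      Submodule.smul_mem _ _ (heisenberg_mem B ε _ _ hv)
    refine Submodule.add_mem _ ?_ ?_
    · exact finsum_induction (· ∈ subspaceOn (r := r) K') (Submodule.zero_mem _)
        (fun _ _ => Submodule.add_mem _) fun k => hd _ (ih _ hw)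
    · exact finsum_induction (· ∈ subspaceOn (r := r) K') (Submodule.zero_mem _)
        (fun _ _ => Submodule.add_mem _) fun k => ih _ (hd _ hw)

theorem latticeY_mem (B : LinearMap.BilinForm ℤ L) (b : L →+ L →+ ZMod 2)
    (ε : Module.Basis (Fin r) ℤ L) {K K' K'' : Set L}
    (hK : ∀ lam ∈ K, ∀ μ ∈ K', lam + μ ∈ K'') (n : ℤ) {a w : LatticeSpace L r}
    (ha : a ∈ subspaceOn K) (hw : w ∈ subspaceOn K') :
    latticeY B b ε a n w ∈ subspaceOn (r := r) K'' := by
  rw [latticeY]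
  refine Submodule.sum_mem _ fun lam hlam => Submodule.sum_mem _ fun s _ => ?_
  exact Submodule.smul_mem _ _ (monomialModes_mem B b ε lam (hK lam (ha hlam)) _ n hw)

theorem theta_mem {K K' : Set L} (hK : ∀ lam ∈ K, -lam ∈ K') {a : LatticeSpace L r}
    (ha : a ∈ subspaceOn K) : theta a ∈ subspaceOn (r := r) K' := by
  classical
  intro μ hμ
  have h1 := Finsupp.mapDomain_support hμ
  obtain ⟨lam, hlam, rfl⟩ := Finset.mem_image.1 h1
  exact hK lam (ha (Finsupp.support_mapRange (hf := map_zero _) hlam))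

theorem compP_mem (ε : Module.Basis (Fin r) ℤ L) (a : LatticeSpace L r) :
    compP ε a ∈ subspaceOn (r := r) (latticePoints (coneP ε)) := by
  classical
  intro μ hμ
  have h : μ ∈ a.support ∧ μ ∈ latticePoints (coneP ε) := by
    simpa [compP, Finsupp.support_filter] using hμ
  exact h.2

theorem compN_mem (ε : Module.Basis (Fin r) ℤ L) {a : LatticeSpace L r}
    (ha : a ∈ subspaceOn (latticePoints (coneD ε))) :
    compN ε a ∈ subspaceOn (r := r) (latticePoints (coneN ε)) := by
  classical
  intro μ hμ
  have h : μ ∈ a.support ∧ μ ∉ latticePoints (coneP ε) := by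
    simpa [compN, Finsupp.support_filter] using hμ
  exact (ha h.1).resolve_left h.2

theorem add_mem_coneP {ε : Module.Basis (Fin r) ℤ L} {x y : L}
    (hx : x ∈ latticePoints (coneP ε)) (hy : y ∈ latticePoints (coneP ε)) :
    x + y ∈ latticePoints (coneP ε) := by
  obtain ⟨α, hα, h⟩ := hx
  obtain ⟨α', hα', h'⟩ := hy
  exact ⟨α + α', fun i => add_nonneg (hα i) (hα' i), by
    simp [TensorProduct.tmul_add, h, h', add_smul, Finset.sum_add_distrib]⟩

theorem add_mem_coneN {ε : Module.Basis (Fin r) ℤ L} {x y : L}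
    (hx : x ∈ latticePoints (coneN ε)) (hy : y ∈ latticePoints (coneN ε)) :
    x + y ∈ latticePoints (coneN ε) := by
  obtain ⟨α, hα, h⟩ := hx
  obtain ⟨α', hα', h'⟩ := hy
  exact ⟨α + α', fun i => add_neg (hα i) (hα' i), by
    simp [TensorProduct.tmul_add, h, h', add_smul, Finset.sum_add_distrib]⟩

theorem neg_add_mem_coneN {ε : Module.Basis (Fin r) ℤ L} {x y : L}
    (hx : x ∈ latticePoints (coneP ε)) (hy : y ∈ latticePoints (coneN ε)) :
    -x + y ∈ latticePoints (coneN ε) := by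
  obtain ⟨α, hα, h⟩ := hx
  obtain ⟨α', hα', h'⟩ := hy
  exact ⟨-α + α', fun i => add_neg_of_nonpos_of_neg (neg_nonpos.2 (hα i)) (hα' i), by
    simp [TensorProduct.tmul_add, TensorProduct.tmul_neg, h, h', add_smul,
      Finset.sum_add_distrib]⟩

theorem neg_mem_coneP {ε : Module.Basis (Fin r) ℤ L} {x : L}
    (hx : x ∈ latticePoints (coneN ε)) : -x ∈ latticePoints (coneP ε) := by
  obtain ⟨α, hα, h⟩ := hx
  exact ⟨-α, fun i => neg_nonneg.2 (hα i).le, by simp [TensorProduct.tmul_neg, h]⟩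

theorem twistedY_mem (B : LinearMap.BilinForm ℤ L) (b : L →+ L →+ ZMod 2)
    (ε : Module.Basis (Fin r) ℤ L) (n : ℤ) {x y : LatticeSpace L r}
    (hx : x ∈ subspaceOn (latticePoints (coneD ε)))
    (hy : y ∈ subspaceOn (latticePoints (coneD ε))) :
    twistedY B b ε x n y ∈ subspaceOn (r := r) (latticePoints (coneD ε)) := by
  have hN : ∀ {z : LatticeSpace L r}, z ∈ subspaceOn (latticePoints (coneN ε)) →
      z ∈ subspaceOn (r := r) (latticePoints (coneD ε)) :=
    fun hz => Finsupp.supported_mono (fun _ h => Or.inr h) hz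
  have hP : ∀ {z : LatticeSpace L r}, z ∈ subspaceOn (latticePoints (coneP ε)) →
      z ∈ subspaceOn (r := r) (latticePoints (coneD ε)) :=
    fun hz => Finsupp.supported_mono (fun _ h => Or.inl h) hz
  have hneg : ∀ lam ∈ latticePoints (coneP ε), -lam ∈ {z | -z ∈ latticePoints (coneP ε)} :=
    fun lam h => by simpa using h
  refine Submodule.add_mem _ (Submodule.add_mem _ (Submodule.add_mem _ (hP ?_) (hN ?_)) (hN ?_))
    (hP ?_)
  · exact latticeY_mem B b ε (fun _ h _ h' => add_mem_coneP h h') n (compP_mem ε x) (compP_mem ε y)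
  · refine latticeY_mem B b ε (fun l h m h' => ?_) n (theta_mem hneg (compP_mem ε x))
      (compN_mem ε hy)
    simpa using neg_add_mem_coneN h h'
  · refine latticeY_mem B b ε (fun l h m h' => ?_) n (compN_mem ε hx)
      (theta_mem hneg (compP_mem ε y))
    simpa [add_comm] using neg_add_mem_coneN h' h
  · exact theta_mem (fun _ h => neg_mem_coneP h) (latticeY_mem B b ε
      (fun _ h _ h' => add_mem_coneN h h') n (compN_mem ε hx) (compN_mem ε hy))

/-! ### The cone vertex algebra -/

/-- The space `V_{D(L)}`. -/
abbrev ConeSpace (ε : Module.Basis (Fin r) ℤ L) : Type _ :=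
  subspaceOn (r := r) (latticePoints (coneD ε))

/-- The vertex operators of `V_{D(L)}`. -/
def coneY (B : LinearMap.BilinForm ℤ L) (b : L →+ L →+ ZMod 2) (ε : Module.Basis (Fin r) ℤ L)
    (x : ConeSpace ε) (n : ℤ) (y : ConeSpace ε) : ConeSpace ε :=
  ⟨twistedY B b ε x n y, twistedY_mem B b ε n x.2 y.2⟩

/-- The parity: `p ⊗ v_λ` is even or odd according as `⟨λ, λ⟩` is. -/
def conePar (B : LinearMap.BilinForm ℤ L) (ε : Module.Basis (Fin r) ℤ L) (i : ZMod 2) :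
    Submodule ℂ (ConeSpace ε) :=
  (subspaceOn {lam | (B lam lam : ZMod 2) = i}).comap (Submodule.subtype _)

theorem zero_mem_coneD (ε : Module.Basis (Fin r) ℤ L) : (0 : L) ∈ latticePoints (coneD ε) :=
  Or.inl ⟨0, fun _ => le_rfl, by simp⟩

/-- The vacuum vector `v₀`. -/
def coneVac (ε : Module.Basis (Fin r) ℤ L) : ConeSpace ε :=
  ⟨Finsupp.single 0 1, Finsupp.single_mem_supported ℂ _ (zero_mem_coneD ε)⟩

/-- The vector `(1/2) ∑ᵢ ε'ᵢ(-1) εᵢ(-1) ⊗ v₀`, for vectors `ε'ᵢ` of `ℚ ⊗ L`. -/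
def coneOmega (B : LinearMap.BilinForm ℤ L) (ε : Module.Basis (Fin r) ℤ L)
    (ε' : Fin r → ℚ ⊗[ℤ] L) : ConeSpace ε :=
  ⟨(1 / 2 : ℂ) • ∑ i,
      heisenberg B ε (LinearMap.rTensor L (Algebra.linearMap ℚ ℂ |>.restrictScalars ℤ) (ε' i)) (-1)
        (heisenberg B ε (1 ⊗ₜ[ℤ] ε i) (-1) (Finsupp.single 0 1)),
    Submodule.smul_mem _ _ (Submodule.sum_mem _ fun _ _ => heisenberg_mem B ε _ _
      (heisenberg_mem B ε _ _ (Finsupp.single_mem_supported ℂ _ (zero_mem_coneD ε))))⟩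

end Lattice

end ConeVA

end

/-!
The vertex operators of the cone are obtained from those of `V_L` by folding the part `N` of the
cone into `P` with the Kummer involution `θ`. Hence the axioms for `V_{D(L)}` follow from those for
`V_L`, which are proved first.

A field on a space `V` is encoded by its modes (`FormalField`), and locality of two fields by the
vanishing of a power of `z - w`, acting on double sequences of operators (`zwMul`, `IsLocal`). The
vertex operators of `V_L` are iterated normally ordered products of derivatives of the Heisenberg
fields with the fields `Y(v_λ, z)`. By Dong's lemma (`IsLocal.nord`) their locality follows from
that of the constituents; translation covariance and equivariance under the Kummer involution pass
to normally ordered products directly (`FormalField.nord_covariant`,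
`FormalField.nord_intertwine`).

All identities for the fields `Y(v_λ, z)` come from one uniqueness principle, `eq_zero_of_vev`: a
family of operators on `V_L` whose span is stable under commutators with the Heisenberg operators
vanishes as soon as its vacuum expectation values, the coefficients of `v_ν` in the images of the
vectors `v_μ`, vanish. The commutators `[u(m), Y(v_λ, z)] = ⟨u, λ⟩ z ^ m Y(v_λ, z)`
(`heisenberg_vertexField`) make it applicable. It gives the mutual locality of `Y(v_λ, z)` and
`Y(v_μ, w)`, where the vacuum expectation values are the two expansions of `(z - w) ^ ⟨λ, μ⟩`
(`isLocal_vertexField`), translation covariance (`translationOp_vertexField`), equivariance under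
`θ` (`theta_vertexField`), the identification of `L(-1)` with the translation operator
(`virasoroOp_neg_one`) and the Virasoro relations (`virasoroOp_commutator`).

For the cone, write an element of `V_{D(L)}` as `x + y` with `x` in `V_{P(L)}` and `y` in
`V_{N(L)}`. As `θ` is an involutive automorphism of the vertex algebra `V_L`
(`theta_latticeMode`), each of the two maps `x + y ↦ x ± θ(y)` carries the vertex operators of the
cone to those of `V_L` (`coneFold`, `coneFold_coneY`). Together the two maps are injective
(`coneFold_injective`), so that every axiom of a super vertex algebra is inherited from `V_L`. Each
map separately need not be injective.

The operator `L(0)` is diagonal on the monomials of `V_{D(L)}`, with eigenvalue the degree of the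
monomial plus `⟨λ, λ⟩ / 2`. If the form is positive on the cone, the eigenspaces are
finite-dimensional because `⟨λ, λ⟩` takes bounded values at finitely many lattice points of the cone
only. This is not obvious for an indefinite form, as positivity is assumed only at the rational
points of the cone and not at its real points; `finite_coneP_le` proves it with Dickson's lemma.
-/

noncomputable section

namespace ConeVA

open Filter

/-! ### Formal distributions in two variables -/

section Distributions

variable {W W' : Type*} [AddCommGroup W] [Module ℂ W] [AddCommGroup W'] [Module ℂ W']

/-- Multiplication by `z - w` on formal distributions `∑ f m n z ^ (-m-1) w ^ (-n-1)`. -/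
def zwMul (W : Type*) [AddCommGroup W] [Module ℂ W] : Module.End ℂ (ℤ → ℤ → W) where
  toFun f m n := f (m + 1) n - f m (n + 1)
  map_add' f g := by ext; simp only [Pi.add_apply]; abel
  map_smul' c f := by ext; simp [smul_sub]

theorem zwMul_apply (f : ℤ → ℤ → W) (m n : ℤ) : zwMul W f m n = f (m + 1) n - f m (n + 1) := rfl

theorem zwMul_pow_succ_apply (N : ℕ) (f : ℤ → ℤ → W) (m n : ℤ) :
    (zwMul W ^ (N + 1)) f m n = (zwMul W ^ N) f (m + 1) n - (zwMul W ^ N) f m (n + 1) := by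
  rw [pow_succ', Module.End.mul_apply, zwMul_apply]

theorem zwMul_pow_map (φ : W →ₗ[ℂ] W') (N : ℕ) (f : ℤ → ℤ → W) :
    (zwMul W' ^ N) (fun m n => φ (f m n)) = fun m n => φ ((zwMul W ^ N) f m n) := by
  induction N with
  | zero => rfl
  | succ N ih =>
    ext m n
    simp only [zwMul_pow_succ_apply, ih, map_sub]

theorem zwMul_pow_swap (N : ℕ) (f : ℤ → ℤ → W) :
    (zwMul W ^ N) (fun m n => f n m) = fun m n => (-1 : ℂ) ^ N • (zwMul W ^ N) f n m := by
  induction N with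
  | zero => ext; simp
  | succ N ih =>
    ext m n
    rw [zwMul_pow_succ_apply, zwMul_pow_succ_apply, ih, pow_succ]
    module

theorem zwMul_pow_eq_zero_of_le {N M : ℕ} (h : N ≤ M) {f : ℤ → ℤ → W}
    (hf : (zwMul W ^ N) f = 0) : (zwMul W ^ M) f = 0 := by
  rw [← Nat.sub_add_cancel h, pow_add, Module.End.mul_apply, hf, map_zero]

/-- The binomial expansion of `(z - w) ^ N`. -/
theorem zwMul_pow_apply (N : ℕ) (f : ℤ → ℤ → W) (m n : ℤ) :
    (zwMul W ^ N) f m n = ∑ k ∈ Finset.range (N + 1),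
      ((-1 : ℂ) ^ k * (N.choose k : ℂ)) • f (m + N - k) (n + k) := by
  let S : Module.End ℂ (ℤ → ℤ → W) :=
    { toFun := fun f m n => f (m + 1) n, map_add' := fun _ _ => rfl, map_smul' := fun _ _ => rfl }
  let T : Module.End ℂ (ℤ → ℤ → W) :=
    { toFun := fun f m n => (-1 : ℂ) • f m (n + 1)
      map_add' := fun f g => by ext; simp
      map_smul' := fun c f => by ext; simp }
  have hS : ∀ (k : ℕ) (f : ℤ → ℤ → W) m n, (S ^ k) f m n = f (m + k) n := by
    intro k
    induction k with
    | zero => intro f m n; simp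
    | succ k ih =>
      intro f m n
      rw [pow_succ, Module.End.mul_apply, ih]
      change f (m + k + 1) n = _
      rw [Nat.cast_succ, add_assoc]
  have hT : ∀ (k : ℕ) (f : ℤ → ℤ → W) m n, (T ^ k) f m n = (-1 : ℂ) ^ k • f m (n + k) := by
    intro k
    induction k with
    | zero => intro f m n; simp
    | succ k ih =>
      intro f m n
      rw [pow_succ, Module.End.mul_apply, ih]
      change (-1 : ℂ) ^ k • (-1 : ℂ) • f m (n + k + 1) = _
      rw [Nat.cast_succ, add_assoc, smul_smul, pow_succ]
  have hST : zwMul W = T + S := by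
    ext f m n
    change f (m + 1) n - f m (n + 1) = (-1 : ℂ) • f m (n + 1) + f (m + 1) n
    rw [neg_one_smul]; abel
  have hcomm : Commute T S := by
    change T * S = S * T
    rfl
  rw [hST, hcomm.add_pow]
  simp only [LinearMap.sum_apply, Finset.sum_apply]
  refine Finset.sum_congr rfl fun k hk => ?_
  have hk' : k ≤ N := Nat.lt_succ_iff.1 (Finset.mem_range.1 hk)
  have : T ^ k * S ^ (N - k) * (N.choose k : Module.End ℂ (ℤ → ℤ → W))
      = (N.choose k : ℂ) • (T ^ k * S ^ (N - k)) := by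
    rw [← Nat.cast_comm, ← nsmul_eq_mul, Nat.cast_smul_eq_nsmul]
  rw [this, LinearMap.smul_apply, Pi.smul_apply, Pi.smul_apply, Module.End.mul_apply, hT, hS,
    smul_smul, mul_comm]
  congr 2
  push_cast [Nat.cast_sub hk']
  ring

/-- The formal derivative in `z` costs one more factor `z - w`. -/
theorem zwMul_pow_succ_deriv (N : ℕ) (f : ℤ → ℤ → W) :
    (zwMul W ^ (N + 1)) (fun (m n : ℤ) => -(m : ℂ) • f (m - 1) n) = fun (m n : ℤ) =>
      -(m : ℂ) • (zwMul W ^ (N + 1)) f (m - 1) n - ((N : ℂ) + 1) • (zwMul W ^ N) f m n := by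
  induction N with
  | zero =>
    ext m n
    simp only [zero_add, pow_one, pow_zero, zwMul_apply, Module.End.one_apply, sub_add_cancel,
      add_sub_cancel_right, Int.cast_add, Int.cast_one, CharP.cast_eq_zero]
    module
  | succ N ih =>
    ext m n
    rw [zwMul_pow_succ_apply, ih]
    simp only [zwMul_pow_succ_apply (N + 1), zwMul_pow_succ_apply N, sub_add_cancel,
      add_sub_cancel_right, Int.cast_add, Int.cast_one, Nat.cast_succ]
    module

end Distributions

/-! ### Fields, normally ordered products and locality -/

/-- A field on `V`, given by its modes: `A(z) v` lies in `V((z))` for every `v`. -/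
structure FormalField (V : Type*) [AddCommGroup V] [Module ℂ V] where
  mode : ℤ → Module.End ℂ V
  trunc : ∀ v, ∃ N : ℤ, ∀ n, N ≤ n → mode n v = 0

/-- The fields `A(z)` and `B(w)` are mutually local with sign `σ`: some power of `z - w`
annihilates `A(z) B(w) - σ B(w) A(z)`. -/
def IsLocal {V : Type*} [AddCommGroup V] [Module ℂ V] (σ : ℂ) (A B : ℤ → Module.End ℂ V) : Prop :=
  ∃ N : ℕ, (zwMul _ ^ N) (fun m n => A m * B n - σ • (B n * A m)) = 0

section Fields

variable {V : Type*} [AddCommGroup V] [Module ℂ V]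

theorem FormalField.eventually_zero (A : FormalField V) (v : V) (n : ℤ) :
    ∃ K : ℕ, ∀ k : ℕ, K ≤ k → A.mode (n + k) v = 0 := by
  obtain ⟨N, hN⟩ := A.trunc v
  exact ⟨(N - n).toNat, fun k hk => hN _ (by omega)⟩

theorem IsLocal.symm {σ : ℂ} (hσ : σ * σ = 1) {A B : ℤ → Module.End ℂ V} (h : IsLocal σ A B) :
    IsLocal σ B A := by
  obtain ⟨N, hN⟩ := h
  refine ⟨N, ?_⟩
  have h1 : (fun m n => B m * A n - σ • (A n * B m))
      = -σ • (fun m n => (fun m n => A m * B n - σ • (B n * A m)) n m) := by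
    ext1 m; ext1 n
    simp only [Pi.smul_apply, smul_sub, smul_smul, neg_mul, hσ, neg_smul, one_smul]
    abel
  rw [h1, map_smul, zwMul_pow_swap, hN]
  ext; simp

theorem IsLocal.add {σ : ℂ} {A A' B : ℤ → Module.End ℂ V} (h : IsLocal σ A B)
    (h' : IsLocal σ A' B) : IsLocal σ (A + A') B := by
  obtain ⟨N, hN⟩ := h
  obtain ⟨N', hN'⟩ := h'
  refine ⟨max N N', ?_⟩
  have h1 : (fun m n => (A + A') m * B n - σ • (B n * (A + A') m))
      = (fun m n => A m * B n - σ • (B n * A m)) + fun m n => A' m * B n - σ • (B n * A' m) := by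
    ext1 m; ext1 n
    simp only [Pi.add_apply, add_mul, mul_add, smul_add]
    abel
  rw [h1, map_add, zwMul_pow_eq_zero_of_le (le_max_left N N') hN,
    zwMul_pow_eq_zero_of_le (le_max_right N N') hN', add_zero]

theorem IsLocal.smul {σ : ℂ} {A B : ℤ → Module.End ℂ V} (h : IsLocal σ A B) (c : ℂ) :
    IsLocal σ (c • A) B := by
  obtain ⟨N, hN⟩ := h
  refine ⟨N, ?_⟩
  have h1 : (fun m n => (c • A) m * B n - σ • (B n * (c • A) m))
      = c • fun m n => A m * B n - σ • (B n * A m) := by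
    ext1 m; ext1 n
    simp [smul_sub, smul_comm c σ]
  rw [h1, map_smul, hN, smul_zero]

/-- Fields whose commutator is a multiple of the derivative of the delta function are local. -/
theorem IsLocal.of_central {A B : ℤ → Module.End ℂ V} {c : ℂ}
    (h : ∀ m n, A m * B n - B n * A m = (if m + n = 0 then (m : ℂ) * c else 0) • 1) :
    IsLocal 1 A B := by
  refine ⟨2, ?_⟩
  ext1 m; ext1 n
  simp only [one_smul, h, zwMul_pow_succ_apply, pow_zero, Module.End.one_apply, ← sub_smul]
  refine Eq.trans ?_ (zero_smul ℂ (1 : Module.End ℂ V))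
  congr 1
  by_cases h : m + n + 2 = 0
  · simp only [show m + 1 + 1 + n = 0 by omega, show m + 1 + (n + 1) = 0 by omega,
      show m + (n + 1 + 1) = 0 by omega, if_true]
    push_cast
    ring
  · simp only [show ¬ m + 1 + 1 + n = 0 by omega, show ¬ m + 1 + (n + 1) = 0 by omega,
      show ¬ m + (n + 1 + 1) = 0 by omega, if_false]
    ring

/-- A field that acts on another one by multiplication with `c z ^ m` is local with it. -/
theorem IsLocal.of_shift {A B : ℤ → Module.End ℂ V} {c : ℂ}
    (h : ∀ m n, A m * B n - B n * A m = c • B (m + n)) : IsLocal 1 A B := by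
  refine ⟨1, ?_⟩
  ext1 m; ext1 n
  simp only [one_smul, h, pow_one, zwMul_apply]
  rw [add_right_comm, add_assoc, sub_self]
  rfl

/-- Stability of a span under a commutator can be checked on generators. -/
theorem commutator_mem_span {ι : Type*} {X : ι → Module.End ℂ V} {H : Module.End ℂ V}
    (h : ∀ i, H * X i - X i * H ∈ Submodule.span ℂ (Set.range X)) {Z : Module.End ℂ V}
    (hZ : Z ∈ Submodule.span ℂ (Set.range X)) : H * Z - Z * H ∈ Submodule.span ℂ (Set.range X) := by
  induction hZ using Submodule.span_induction with
  | mem x hx => obtain ⟨i, rfl⟩ := hx; exact h i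
  | zero => rw [mul_zero, zero_mul, sub_zero]; exact Submodule.zero_mem _
  | add x y _ _ hx hy =>
    rw [mul_add, add_mul, add_sub_add_comm]
    exact Submodule.add_mem _ hx hy
  | smul c x _ hx =>
    rw [mul_smul_comm, smul_mul_assoc, ← smul_sub]
    exact Submodule.smul_mem _ c hx

theorem IsLocal.zero_left {σ : ℂ} {B : ℤ → Module.End ℂ V} : IsLocal σ 0 B :=
  ⟨0, by ext; simp⟩

/-- The field `∂ ^ k A(z) / k!`. -/
def FormalField.deriv (A : FormalField V) (k : ℕ) : FormalField V where
  mode n := ((-1 : ℂ) ^ k * (Ring.choose n k : ℤ)) • A.mode (n - k)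
  trunc v := by
    obtain ⟨N, hN⟩ := A.trunc v
    exact ⟨N + k, fun n hn => by rw [LinearMap.smul_apply, hN _ (by omega), smul_zero]⟩

theorem FormalField.deriv_zero_mode (A : FormalField V) (n : ℤ) :
    (A.deriv 0).mode n = A.mode n := by
  simp [FormalField.deriv]

theorem choose_succ_mul (n : ℤ) (k : ℕ) :
    ((k : ℤ) + 1) * Ring.choose n (k + 1) = n * Ring.choose (n - 1) k := by
  simpa using Ring.choose_smul_choose n (Nat.succ_le_succ k.zero_le)

theorem FormalField.deriv_succ_mode (A : FormalField V) (k : ℕ) (n : ℤ) :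
    (A.deriv (k + 1)).mode n = ((k : ℂ) + 1)⁻¹ • -(n : ℂ) • (A.deriv k).mode (n - 1) := by
  have hk : ((k : ℂ) + 1) ≠ 0 := by exact_mod_cast Nat.succ_ne_zero k
  have h : ((k : ℂ) + 1) * (Ring.choose n (k + 1) : ℤ) = n * (Ring.choose (n - 1) k : ℤ) := by
    exact_mod_cast choose_succ_mul n k
  simp only [FormalField.deriv, smul_smul, Nat.cast_succ]
  rw [show n - ((k : ℤ) + 1) = n - 1 - k by ring]
  congr 1
  field_simp
  linear_combination (-1 : ℂ) * (-1) ^ k * h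

theorem IsLocal.deriv {σ : ℂ} {A : FormalField V} {B : ℤ → Module.End ℂ V}
    (h : IsLocal σ A.mode B) (k : ℕ) : IsLocal σ (A.deriv k).mode B := by
  induction k with
  | zero => simpa only [← funext A.deriv_zero_mode] using h
  | succ k ih =>
    obtain ⟨N, hN⟩ := ih
    have h1 : IsLocal σ (fun n : ℤ => -(n : ℂ) • (A.deriv k).mode (n - 1)) B := by
      refine ⟨N + 1, ?_⟩
      have h2 := zwMul_pow_succ_deriv N
        fun m n => (A.deriv k).mode m * B n - σ • (B n * (A.deriv k).mode m)
      rw [zwMul_pow_eq_zero_of_le N.le_succ hN, hN] at h2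
      convert h2 using 2
      · ext1 m; ext1 n
        simp only [smul_mul_assoc, mul_smul_comm, smul_sub, smul_comm σ]
      · ext; simp
    have h2 : (A.deriv (k + 1)).mode
        = ((k : ℂ) + 1)⁻¹ • fun n : ℤ => -(n : ℂ) • (A.deriv k).mode (n - 1) :=
      funext fun n => A.deriv_succ_mode k n
    rw [h2]
    exact h1.smul _

/-- The partial sum with `K` terms in each half of the normally ordered product, for the
distributions `f = A(z) B(w)` and `g = B(w) A(z)`. -/
def nordSum {W : Type*} [AddCommGroup W] (K : ℕ) (f g : ℤ → ℤ → W) (n : ℤ) : W :=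
  ∑ k ∈ Finset.range K, f (-k - 1) (n + k) + ∑ k ∈ Finset.range K, g k (n - k - 1)

theorem finsum_nat_eq_sum_range {M : Type*} [AddCommMonoid M] {f : ℕ → M} {K : ℕ}
    (h : ∀ k, K ≤ k → f k = 0) : ∑ᶠ k, f k = ∑ k ∈ Finset.range K, f k := by
  refine finsum_eq_sum_of_support_subset _ fun k hk => ?_
  by_contra hk'
  exact hk (h k (by simpa using hk'))

theorem normalOrder_eventually_eq (A B : FormalField V) (n : ℤ) (v : V) :
    ∀ᶠ K : ℕ in atTop, normalOrder (fun n v => A.mode n v) (fun n v => B.mode n v) n v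
      = nordSum K (fun m n => A.mode m (B.mode n v)) (fun m n => B.mode n (A.mode m v)) n := by
  obtain ⟨K₁, h₁⟩ := B.eventually_zero v n
  obtain ⟨K₂, h₂⟩ := A.eventually_zero v 0
  filter_upwards [eventually_ge_atTop K₁, eventually_ge_atTop K₂] with K hK₁ hK₂
  rw [normalOrder, nordSum, finsum_nat_eq_sum_range (K := K), finsum_nat_eq_sum_range (K := K)]
  · intro k hk
    rw [← zero_add (k : ℤ), h₂ k (hK₂.trans hk), map_zero]
  · intro k hk
    rw [h₁ k (hK₁.trans hk), map_zero]

/-- The normally ordered product of two fields. -/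
def FormalField.nord (A B : FormalField V) : FormalField V where
  mode n :=
    { toFun := normalOrder (fun n v => A.mode n v) (fun n v => B.mode n v) n
      map_add' := fun v w => by
        obtain ⟨K, h, h₁, h₂⟩ := ((normalOrder_eventually_eq A B n (v + w)).and
          ((normalOrder_eventually_eq A B n v).and (normalOrder_eventually_eq A B n w))).exists
        rw [h, h₁, h₂]
        simp only [nordSum, map_add, Finset.sum_add_distrib]
        abel
      map_smul' := fun c v => by
        obtain ⟨K, h, h₁⟩ := ((normalOrder_eventually_eq A B n (c • v)).and
          (normalOrder_eventually_eq A B n v)).exists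
        rw [h, h₁]
        simp only [nordSum, map_smul, Finset.smul_sum, smul_add, RingHom.id_apply] }
  trunc v := by
    obtain ⟨N, hN⟩ := B.trunc v
    obtain ⟨K, hK⟩ := A.eventually_zero v 0
    choose M hM using fun k : ℕ => B.trunc (A.mode k v)
    obtain ⟨M', hM'⟩ : ∃ M' : ℤ, ∀ k ∈ Finset.range K, M k ≤ M' := by
      obtain ⟨M', h⟩ := ((Finset.range K).image M).bddAbove
      exact ⟨M', fun k hk => h (Finset.mem_coe.2 (Finset.mem_image_of_mem M hk))⟩
    refine ⟨max N (M' + K), fun n hn => ?_⟩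
    have hn₁ := (le_max_left _ _).trans hn
    have hn₂ := (le_max_right _ _).trans hn
    obtain ⟨K', h, -⟩ := ((normalOrder_eventually_eq A B n v).and
      (eventually_ge_atTop 0)).exists
    change normalOrder (fun n v => A.mode n v) (fun n v => B.mode n v) n v = 0
    rw [h, nordSum, Finset.sum_eq_zero, Finset.sum_eq_zero, add_zero]
    · intro k _
      by_cases hk : K ≤ k
      · rw [← zero_add (k : ℤ), hK k hk, map_zero]
      · exact hM k _ ((hM' k (by simpa using hk)).trans (by omega))
    · intro k _
      rw [hN _ (by omega), map_zero]

theorem FormalField.nord_apply (A B : FormalField V) (n : ℤ) (v : V) :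
    (A.nord B).mode n v = normalOrder (fun n v => A.mode n v) (fun n v => B.mode n v) n v := rfl

theorem FormalField.nord_eventually_eq (A B : FormalField V) (n : ℤ) (v : V) :
    ∀ᶠ K : ℕ in atTop, (A.nord B).mode n v
      = nordSum K (fun m n => A.mode m (B.mode n v)) (fun m n => B.mode n (A.mode m v)) n :=
  normalOrder_eventually_eq A B n v

/-- The normally ordered product of two covariant fields is covariant. -/
theorem FormalField.nord_covariant {A B : FormalField V} {T : Module.End ℂ V}
    (hA : ∀ n, T * A.mode n - A.mode n * T = -(n : ℂ) • A.mode (n - 1))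
    (hB : ∀ n, T * B.mode n - B.mode n * T = -(n : ℂ) • B.mode (n - 1)) (n : ℤ) :
    T * (A.nord B).mode n - (A.nord B).mode n * T = -(n : ℂ) • (A.nord B).mode (n - 1) := by
  have hA' : ∀ n v, T (A.mode n v) = A.mode n (T v) - (n : ℂ) • A.mode (n - 1) v := fun n v => by
    have := LinearMap.congr_fun (hA n) v
    simp only [LinearMap.sub_apply, Module.End.mul_apply, LinearMap.smul_apply] at this
    rw [sub_eq_iff_eq_add.1 this, neg_smul]; abel
  have hB' : ∀ n v, T (B.mode n v) = B.mode n (T v) - (n : ℂ) • B.mode (n - 1) v := fun n v => by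
    have := LinearMap.congr_fun (hB n) v
    simp only [LinearMap.sub_apply, Module.End.mul_apply, LinearMap.smul_apply] at this
    rw [sub_eq_iff_eq_add.1 this, neg_smul]; abel
  ext v
  simp only [LinearMap.sub_apply, Module.End.mul_apply, LinearMap.smul_apply]
  obtain ⟨K₁, h₁⟩ := B.eventually_zero v (n - 1)
  obtain ⟨K₂, h₂⟩ := A.eventually_zero v (-1)
  obtain ⟨K, e₁, e₂, e₃, hK₁, hK₂⟩ := ((A.nord_eventually_eq B n v).and
    ((A.nord_eventually_eq B n (T v)).and ((A.nord_eventually_eq B (n - 1) v).and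
      ((eventually_ge_atTop K₁).and (eventually_ge_atTop K₂))))).exists
  rw [e₁, e₂, e₃]
  -- Telescoping: the two halves change by boundary terms that vanish on `v`.
  have s₁ : ∑ k ∈ Finset.range K, (((k : ℂ) + 1) • A.mode (-k - 1 - 1) (B.mode (n + k) v)
      - (k : ℂ) • A.mode (-k - 1) (B.mode (n + k - 1) v)) = 0 := by
    have := Finset.sum_range_sub
      (fun k : ℕ => (k : ℂ) • A.mode (-k - 1) (B.mode (n + k - 1) v)) K
    rw [show n + (K : ℤ) - 1 = n - 1 + K by ring, h₁ K hK₁] at this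
    simp only [map_zero, smul_zero, CharP.cast_eq_zero, zero_smul, sub_zero] at this
    rw [← this]
    refine Finset.sum_congr rfl fun k _ => ?_
    push_cast
    rw [show -((k : ℤ) + 1) - 1 = -k - 1 - 1 by ring, show n + ((k : ℤ) + 1) - 1 = n + k by ring]
  have s₂ : ∑ k ∈ Finset.range K, (((k : ℂ) + 1) • B.mode (n - k - 1 - 1) (A.mode k v)
      - (k : ℂ) • B.mode (n - k - 1) (A.mode (k - 1) v)) = 0 := by
    have := Finset.sum_range_sub
      (fun k : ℕ => (k : ℂ) • B.mode (n - k - 1) (A.mode (k - 1) v)) K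
    rw [show (K : ℤ) - 1 = -1 + K by ring, h₂ K hK₂] at this
    simp only [map_zero, smul_zero, CharP.cast_eq_zero, zero_smul, sub_zero] at this
    rw [← this]
    refine Finset.sum_congr rfl fun k _ => ?_
    push_cast
    rw [show n - ((k : ℤ) + 1) - 1 = n - k - 1 - 1 by ring, show (k : ℤ) + 1 - 1 = k by ring]
  have s₃ := congrArg₂ (· + ·) s₁ s₂
  simp only [add_zero] at s₃
  rw [← sub_eq_zero, ← s₃]
  simp only [nordSum, map_add, map_sum, smul_add, Finset.smul_sum]
  simp only [← Finset.sum_add_distrib, ← Finset.sum_sub_distrib]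
  refine Finset.sum_congr rfl fun k _ => ?_
  simp only [hA', hB', map_sub, map_smul]
  rw [show n - 1 + (k : ℤ) = n + k - 1 by ring, show n - 1 - (k : ℤ) - 1 = n - k - 1 - 1 by ring]
  push_cast
  module

/-- A linear map that intertwines two pairs of fields up to scalars intertwines the normally
ordered products. -/
theorem FormalField.nord_intertwine {V' : Type*} [AddCommGroup V'] [Module ℂ V']
    {A B : FormalField V} {A' B' : FormalField V'} (φ : V →ₗ[ℂ] V') {a b : ℂ}
    (hA : ∀ n v, φ (A.mode n v) = a • A'.mode n (φ v))
    (hB : ∀ n v, φ (B.mode n v) = b • B'.mode n (φ v)) (n : ℤ) (v : V) :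
    φ ((A.nord B).mode n v) = (a * b) • (A'.nord B').mode n (φ v) := by
  obtain ⟨K, e₁, e₂⟩ :=
    ((A.nord_eventually_eq B n v).and (A'.nord_eventually_eq B' n (φ v))).exists
  rw [e₁, e₂]
  simp only [nordSum, map_add, map_sum, smul_add, Finset.smul_sum, hA, hB, map_smul, smul_smul,
    mul_comm b a]

/-- The derivatives of a covariant field are covariant. -/
theorem FormalField.deriv_covariant {A : FormalField V} {T : Module.End ℂ V}
    (hA : ∀ n, T * A.mode n - A.mode n * T = -(n : ℂ) • A.mode (n - 1)) (k : ℕ) (n : ℤ) :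
    T * (A.deriv k).mode n - (A.deriv k).mode n * T = -(n : ℂ) • (A.deriv k).mode (n - 1) := by
  induction k generalizing n with
  | zero => simpa only [FormalField.deriv_zero_mode] using hA n
  | succ k ih =>
    rw [FormalField.deriv_succ_mode, FormalField.deriv_succ_mode, mul_smul_comm, mul_smul_comm,
      smul_mul_assoc, smul_mul_assoc, ← smul_sub, ← smul_sub, ih]
    module

/-- If `[H, A(z)] = a z ^ k A(z)` and `[H, B(z)] = c z ^ k B(z)`, then `[H, -]` acts on the
distribution `(z - w) ^ N (A(z) B(w) - σ B(w) A(z))` as multiplication by `a z ^ k + c w ^ k`. -/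
theorem commutator_zwMul_pow {A B : ℤ → Module.End ℂ V} {H : Module.End ℂ V} {a c : ℂ} {k : ℤ}
    (hA : ∀ n, H * A n - A n * H = a • A (k + n)) (hB : ∀ n, H * B n - B n * H = c • B (k + n))
    (σ : ℂ) (N : ℕ) (m n : ℤ) :
    let X := (zwMul _ ^ N) fun m n => A m * B n - σ • (B n * A m)
    H * X m n - X m n * H = a • X (k + m) n + c • X m (k + n) := by
  induction N generalizing m n with
  | zero =>
    have e : H * (A m * B n - σ • (B n * A m)) - (A m * B n - σ • (B n * A m)) * H
        = (H * A m - A m * H) * B n + A m * (H * B n - B n * H)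
          - σ • ((H * B n - B n * H) * A m + B n * (H * A m - A m * H)) := by
      simp only [mul_sub, sub_mul, mul_smul_comm, smul_mul_assoc, mul_assoc]
      module
    refine e.trans ?_
    rw [hA, hB]
    simp only [mul_smul_comm, smul_mul_assoc, pow_zero, Module.End.one_apply]
    module
  | succ N ih =>
    simp only [zwMul_pow_succ_apply] at ih ⊢
    rw [mul_sub, sub_mul, sub_sub_sub_comm, ih, ih, ← add_assoc, ← add_assoc]
    module

/-- The defect of the covariance of a field behaves under `[H, -]` like the field itself. -/
theorem commutator_covariance_defect {H A : ℤ → Module.End ℂ V} {T : Module.End ℂ V} {a : ℂ}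
    (hT : ∀ k, T * H k - H k * T = -(k : ℂ) • H (k - 1))
    (hA : ∀ k n, H k * A n - A n * H k = a • A (k + n)) (k n : ℤ) :
    let X := fun n : ℤ => T * A n - A n * T + (n : ℂ) • A (n - 1)
    H k * X n - X n * H k = a • X (k + n) := by
  intro X
  have e : H k * X n - X n * H k
      = -((T * H k - H k * T) * A n - A n * (T * H k - H k * T))
        + (T * (H k * A n - A n * H k) - (H k * A n - A n * H k) * T)
        + (n : ℂ) • (H k * A (n - 1) - A (n - 1) * H k) := by
    simp only [X, mul_sub, sub_mul, mul_add, add_mul, mul_smul_comm, smul_mul_assoc, mul_assoc]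
    module
  rw [e, hT, hA, hA]
  simp only [X, smul_mul_assoc, mul_smul_comm, ← smul_sub]
  rw [hA, show k - 1 + n = k + n - 1 by ring, ← add_sub_assoc]
  push_cast
  module

end Fields

/-! ### Dong's lemma -/

section Dong

variable {V : Type*} [AddCommGroup V] [Module ℂ V]

/-- Multiplication by `z - x` on formal distributions in `z`, `w`, `x`. -/
def zxMul (V : Type*) [AddCommGroup V] [Module ℂ V] : Module.End ℂ (ℤ → ℤ → ℤ → V) where
  toFun f m n p := f (m + 1) n p - f m n (p + 1)
  map_add' f g := by ext; simp only [Pi.add_apply]; abel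
  map_smul' c f := by ext; simp [smul_sub]

/-- Multiplication by `w - x` on formal distributions in `z`, `w`, `x`. -/
def wxMul (V : Type*) [AddCommGroup V] [Module ℂ V] : Module.End ℂ (ℤ → ℤ → ℤ → V) where
  toFun f m n p := f m (n + 1) p - f m n (p + 1)
  map_add' f g := by ext; simp only [Pi.add_apply]; abel
  map_smul' c f := by ext; simp [smul_sub]

theorem zxMul_apply (f : ℤ → ℤ → ℤ → V) (m n p : ℤ) :
    zxMul V f m n p = f (m + 1) n p - f m n (p + 1) := rfl

theorem wxMul_apply (f : ℤ → ℤ → ℤ → V) (m n p : ℤ) :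
    wxMul V f m n p = f m (n + 1) p - f m n (p + 1) := rfl

theorem zwMul_apply₃ (f : ℤ → ℤ → ℤ → V) (m n p : ℤ) :
    zwMul (ℤ → V) f m n p = f (m + 1) n p - f m (n + 1) p := rfl

theorem wxMul_eq_sub : wxMul V = zxMul V + -zwMul (ℤ → V) := by
  ext f m n p
  simp only [LinearMap.add_apply, LinearMap.neg_apply, Pi.add_apply, Pi.neg_apply, zwMul_apply₃,
    zxMul_apply, wxMul_apply]
  abel

theorem commute_zxMul_zwMul : Commute (zxMul V) (zwMul (ℤ → V)) := by
  ext f m n p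
  simp only [Module.End.mul_apply, zwMul_apply₃, zxMul_apply]
  abel

theorem commute_wxMul_zxMul : Commute (wxMul V) (zxMul V) := by
  rw [wxMul_eq_sub]
  exact (Commute.refl (zxMul V)).add_left (commute_zxMul_zwMul (V := V)).symm.neg_left

theorem zxMul_pow_apply (N : ℕ) (f : ℤ → ℤ → ℤ → V) (m n p : ℤ) :
    (zxMul V ^ N) f m n p = (zwMul V ^ N) (fun m p => f m n p) m p := by
  induction N generalizing m p with
  | zero => rfl
  | succ N ih => rw [zwMul_pow_succ_apply, pow_succ', Module.End.mul_apply, zxMul_apply, ih, ih]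

theorem wxMul_pow_apply (N : ℕ) (f : ℤ → ℤ → ℤ → V) (m n p : ℤ) :
    (wxMul V ^ N) f m n p = (zwMul V ^ N) (fun n p => f m n p) n p := by
  induction N generalizing n p with
  | zero => rfl
  | succ N ih => rw [zwMul_pow_succ_apply, pow_succ', Module.End.mul_apply, wxMul_apply, ih, ih]

/-- The distributions in `z`, `w`, `x` whose coefficients vanish for large `w`-index, uniformly in
the `z`-index. -/
def truncW (V : Type*) [AddCommGroup V] [Module ℂ V] : Submodule ℂ (ℤ → ℤ → ℤ → V) where
  carrier := {f | ∀ p, ∃ M : ℤ, ∀ n, M ≤ n → ∀ m, f m n p = 0}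
  zero_mem' p := ⟨0, fun _ _ _ => rfl⟩
  add_mem' {f g} hf hg p := by
    obtain ⟨M, hM⟩ := hf p
    obtain ⟨M', hM'⟩ := hg p
    refine ⟨max M M', fun n hn m => ?_⟩
    simp [hM n ((le_max_left _ _).trans hn), hM' n ((le_max_right _ _).trans hn)]
  smul_mem' c f hf p := by
    obtain ⟨M, hM⟩ := hf p
    exact ⟨M, fun n hn m => by simp [hM n hn]⟩

/-- The distributions in `z`, `w`, `x` whose coefficients vanish for large `z`-index, uniformly in
the `w`-index. -/
def truncZ (V : Type*) [AddCommGroup V] [Module ℂ V] : Submodule ℂ (ℤ → ℤ → ℤ → V) where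
  carrier := {f | ∀ p, ∃ M : ℤ, ∀ m, M ≤ m → ∀ n, f m n p = 0}
  zero_mem' p := ⟨0, fun _ _ _ => rfl⟩
  add_mem' {f g} hf hg p := by
    obtain ⟨M, hM⟩ := hf p
    obtain ⟨M', hM'⟩ := hg p
    refine ⟨max M M', fun n hn m => ?_⟩
    simp [hM n ((le_max_left _ _).trans hn), hM' n ((le_max_right _ _).trans hn)]
  smul_mem' c f hf p := by
    obtain ⟨M, hM⟩ := hf p
    exact ⟨M, fun n hn m => by simp [hM n hn]⟩

theorem mapsTo_truncW : ∀ f ∈ truncW V, zwMul (ℤ → V) f ∈ truncW V ∧ zxMul V f ∈ truncW V := by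
  intro f hf
  constructor <;> intro p
  · obtain ⟨M, hM⟩ := hf p
    exact ⟨M, fun n hn m => by rw [zwMul_apply₃, hM _ hn, hM _ (by omega), sub_zero]⟩
  · obtain ⟨M, hM⟩ := hf p
    obtain ⟨M', hM'⟩ := hf (p + 1)
    exact ⟨max M M', fun n hn m => by
      rw [zxMul_apply, hM _ ((le_max_left _ _).trans hn), hM' _ ((le_max_right _ _).trans hn),
        sub_zero]⟩

theorem mapsTo_truncZ : ∀ f ∈ truncZ V, zwMul (ℤ → V) f ∈ truncZ V ∧ zxMul V f ∈ truncZ V := by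
  intro f hf
  constructor <;> intro p
  · obtain ⟨M, hM⟩ := hf p
    exact ⟨M, fun m hm n => by rw [zwMul_apply₃, hM _ hm, hM _ (by omega), sub_zero]⟩
  · obtain ⟨M, hM⟩ := hf p
    obtain ⟨M', hM'⟩ := hf (p + 1)
    exact ⟨max M M', fun m hm n => by
      rw [zxMul_apply, hM _ (by have := (le_max_left _ _).trans hm; omega),
        hM' _ ((le_max_right _ _).trans hm), sub_zero]⟩

/-- The pairs `(f, g)` for which the residue defining the normally ordered product vanishes. -/
def nordKer (V : Type*) [AddCommGroup V] [Module ℂ V] :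
    Submodule ℂ ((ℤ → ℤ → ℤ → V) × (ℤ → ℤ → ℤ → V)) where
  carrier := {f | ∀ n p, ∀ᶠ K : ℕ in atTop,
    nordSum K (fun m n => f.1 m n p) (fun m n => f.2 m n p) n = 0}
  zero_mem' n p := Eventually.of_forall fun K => by simp [nordSum]
  add_mem' {f g} hf hg n p := by
    filter_upwards [hf n p, hg n p] with K h h'
    rw [← add_zero (0 : V)]
    nth_rw 1 [← h]
    rw [← h']
    simp only [nordSum, Prod.fst_add, Prod.snd_add, Pi.add_apply, Finset.sum_add_distrib]
    abel
  smul_mem' c f hf n p := by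
    filter_upwards [hf n p] with K h
    rw [← smul_zero c, ← h]
    simp only [nordSum, Prod.smul_fst, Prod.smul_snd, Pi.smul_apply, smul_add, Finset.smul_sum]

/-- `(z - w) (z - w)⁻¹ = 1` in both expansions, so that the residue is `f₀ - g₀`. -/
theorem mem_nordKer_zwMul {f g : ℤ → ℤ → ℤ → V} (hf : f ∈ truncW V) (hg : g ∈ truncZ V)
    (h : f 0 = g 0) : (zwMul (ℤ → V) f, zwMul (ℤ → V) g) ∈ nordKer V := by
  intro n p
  obtain ⟨M, hM⟩ := hf p
  obtain ⟨M', hM'⟩ := hg p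
  filter_upwards [eventually_ge_atTop (M - n).toNat, eventually_ge_atTop M'.toNat] with K h₁ h₂
  have s₁ := Finset.sum_range_sub' (fun k : ℕ => f (-k) (n + k) p) K
  have s₂ := Finset.sum_range_sub (fun k : ℕ => g k (n - k) p) K
  rw [hM (n + K) (by omega)] at s₁
  rw [hM' K (by omega)] at s₂
  have e : f 0 n p - g 0 n p = 0 := by rw [h, sub_self]
  simp only [Nat.cast_zero, neg_zero, add_zero, sub_zero, zero_sub] at s₁ s₂
  rw [sub_eq_add_neg, ← s₁, ← s₂] at e
  rw [← e, nordSum]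
  simp only [zwMul_apply₃]
  congr 1 <;> refine Finset.sum_congr rfl fun k _ => ?_
  · push_cast
    rw [show -((k : ℤ) + 1) = -k - 1 by ring, show -(k : ℤ) - 1 + 1 = -k by ring, ← add_assoc]
  · push_cast
    rw [← sub_sub, sub_add_cancel]

/-- Dong's lemma: if `A`, `B`, `C` are pairwise local and `A` is even, then `:A B:` and `C` are
local. As `w - x = (z - x) - (z - w)`, a large power of `w - x` is a combination of products of
`(z - x) ^ s` and `(z - w) ^ t`, where `s` or `t` is large. -/
theorem IsLocal.nord {σ : ℂ} {A B : FormalField V} {C : ℤ → Module.End ℂ V}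
    (hAB : IsLocal 1 A.mode B.mode) (hAC : IsLocal 1 A.mode C) (hBC : IsLocal σ B.mode C) :
    IsLocal σ (A.nord B).mode C := by
  obtain ⟨N₁, h₁⟩ := hAB
  obtain ⟨N₂, h₂⟩ := hAC
  obtain ⟨N₃, h₃⟩ := hBC
  refine ⟨N₃ + (N₂ + N₁), ?_⟩
  ext n p v
  let F : ℤ → ℤ → ℤ → V := fun m n p =>
    A.mode m (B.mode n (C p v)) - σ • C p (A.mode m (B.mode n v))
  let G : ℤ → ℤ → ℤ → V := fun m n p =>
    B.mode n (A.mode m (C p v)) - σ • C p (B.mode n (A.mode m v))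
  have hF : F ∈ truncW V := fun p => by
    obtain ⟨M, hM⟩ := B.trunc (C p v)
    obtain ⟨M', hM'⟩ := B.trunc v
    refine ⟨max M M', fun n hn m => ?_⟩
    simp [F, hM n ((le_max_left _ _).trans hn), hM' n ((le_max_right _ _).trans hn)]
  have hG : G ∈ truncZ V := fun p => by
    obtain ⟨M, hM⟩ := A.trunc (C p v)
    obtain ⟨M', hM'⟩ := A.trunc v
    refine ⟨max M M', fun m hm n => ?_⟩
    simp [G, hM m ((le_max_left _ _).trans hm), hM' m ((le_max_right _ _).trans hm)]
  -- `(z - w) ^ N₁` identifies `F` and `G`.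
  have hFG : (zwMul (ℤ → V) ^ N₁) F = (zwMul (ℤ → V) ^ N₁) G := by
    let φ : Module.End ℂ V →ₗ[ℂ] (ℤ → V) :=
      LinearMap.pi fun p => LinearMap.applyₗ (C p v) - σ • (C p ∘ₗ LinearMap.applyₗ v)
    have h := zwMul_pow_map φ N₁ fun m n => A.mode m * B.mode n - (1 : ℂ) • (B.mode n * A.mode m)
    rw [h₁] at h
    rw [← sub_eq_zero, ← map_sub]
    convert h using 2
    · ext m n p
      simp [φ, F, G, smul_sub]
      abel
    · ext; simp
  -- `(z - x) ^ N₂ (w - x) ^ N₃` annihilates `F` and `G`.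
  have hAC0 : ∀ u : V, ∀ m p,
      (zwMul V ^ N₂) (fun m p => A.mode m (C p u) - C p (A.mode m u)) m p = 0 := by
    intro u m p
    have h := zwMul_pow_map (LinearMap.applyₗ u) N₂
      fun m n => A.mode m * C n - (1 : ℂ) • (C n * A.mode m)
    rw [h₂] at h
    simpa using congrFun₂ h m p
  have hBC0 : ∀ u : V, ∀ n p,
      (zwMul V ^ N₃) (fun n p => B.mode n (C p u) - σ • C p (B.mode n u)) n p = 0 := by
    intro u m p
    have h := zwMul_pow_map (LinearMap.applyₗ u) N₃
      fun m n => B.mode m * C n - σ • (C n * B.mode m)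
    rw [h₃] at h
    simpa using congrFun₂ h m p
  have hF0 : (wxMul V ^ N₃ * zxMul V ^ N₂) F = 0 := by
    have e : F = (fun m n p => A.mode m (B.mode n (C p v) - σ • C p (B.mode n v)))
        + fun m n p => σ • (A.mode m (C p (B.mode n v)) - C p (A.mode m (B.mode n v))) := by
      ext m n p
      simp only [F, map_sub, map_smul, Pi.add_apply, smul_sub]
      abel
    have e₁ : (wxMul V ^ N₃) (fun m n p => A.mode m (B.mode n (C p v) - σ • C p (B.mode n v)))
        = 0 := by
      ext m n p
      rw [wxMul_pow_apply]
      exact (congrFun₂ (zwMul_pow_map (A.mode m) N₃ _) n p).trans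
        ((congrArg _ (hBC0 v n p)).trans (map_zero _))
    have e₂ : (zxMul V ^ N₂) (fun m n p =>
        σ • (A.mode m (C p (B.mode n v)) - C p (A.mode m (B.mode n v)))) = 0 := by
      ext m n p
      rw [zxMul_pow_apply]
      exact (congrFun₂ (zwMul_pow_map (σ • LinearMap.id) N₂ _) m p).trans
        ((congrArg _ (hAC0 (B.mode n v) m p)).trans (map_zero _))
    rw [e, map_add, Module.End.mul_apply _ _ (fun m n p =>
      σ • (A.mode m (C p (B.mode n v)) - C p (A.mode m (B.mode n v)))), e₂, map_zero,
      (commute_wxMul_zxMul.pow_pow _ _).eq, Module.End.mul_apply, e₁, map_zero, add_zero]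
  have hG0 : (wxMul V ^ N₃ * zxMul V ^ N₂) G = 0 := by
    have e : G = (fun m n p => B.mode n (C p (A.mode m v)) - σ • C p (B.mode n (A.mode m v)))
        + fun m n p => B.mode n (A.mode m (C p v) - C p (A.mode m v)) := by
      ext m n p
      simp only [G, map_sub, Pi.add_apply]
      abel
    have e₁ : (wxMul V ^ N₃) (fun m n p =>
        B.mode n (C p (A.mode m v)) - σ • C p (B.mode n (A.mode m v))) = 0 := by
      ext m n p
      rw [wxMul_pow_apply, hBC0]
      rfl
    have e₂ : (zxMul V ^ N₂) (fun m n p => B.mode n (A.mode m (C p v) - C p (A.mode m v)))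
        = 0 := by
      ext m n p
      rw [zxMul_pow_apply]
      exact (congrFun₂ (zwMul_pow_map (B.mode n) N₂ _) m p).trans
        ((congrArg _ (hAC0 v m p)).trans (map_zero _))
    rw [e, map_add, Module.End.mul_apply _ _ (fun m n p =>
      B.mode n (A.mode m (C p v) - C p (A.mode m v))), e₂, map_zero,
      (commute_wxMul_zxMul.pow_pow _ _).eq, Module.End.mul_apply, e₁, map_zero, add_zero]
  let E : Module.End ℂ (ℤ → ℤ → ℤ → V) →ₗ[ℂ] (ℤ → ℤ → ℤ → V) × (ℤ → ℤ → ℤ → V) :=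
    (LinearMap.applyₗ F).prod (LinearMap.applyₗ G)
  -- Either `z - x` occurs often enough to annihilate both distributions, or `z - w` occurs often
  -- enough to identify them with a factor `z - w` left over.
  have hEmem : ∀ s t : ℕ, N₂ ≤ s ∨ N₁ + 1 ≤ t →
      E (wxMul V ^ N₃ * (zxMul V ^ s * zwMul (ℤ → V) ^ t)) ∈ nordKer V := by
    have hcomm : Commute (wxMul V) (zwMul (ℤ → V)) := by
      rw [wxMul_eq_sub]
      exact (commute_zxMul_zwMul (V := V)).add_left (Commute.refl (zwMul (ℤ → V))).neg_left
    rintro s t (hs | ht)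
    · have e : wxMul V ^ N₃ * (zxMul V ^ s * zwMul (ℤ → V) ^ t)
          = zwMul (ℤ → V) ^ t * zxMul V ^ (s - N₂) * (wxMul V ^ N₃ * zxMul V ^ N₂) := by
        obtain ⟨j, rfl⟩ := Nat.exists_eq_add_of_le hs
        rw [Nat.add_sub_cancel_left, (commute_zxMul_zwMul.pow_pow _ _).eq, ← mul_assoc,
          (hcomm.pow_pow _ _).eq, mul_assoc, mul_assoc, add_comm, pow_add, ← mul_assoc,
          ← mul_assoc (zxMul V ^ j), ← (commute_wxMul_zxMul.pow_pow _ _).eq]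
        simp only [mul_assoc]
      have : E (wxMul V ^ N₃ * (zxMul V ^ s * zwMul (ℤ → V) ^ t)) = 0 := by
        rw [e]
        have h0 : ∀ (X Y : Module.End ℂ (ℤ → ℤ → ℤ → V)) (f : ℤ → ℤ → ℤ → V), Y f = 0 →
            (X * Y) f = 0 := fun X Y f hf => by rw [Module.End.mul_apply, hf, map_zero]
        exact Prod.ext (h0 (zwMul (ℤ → V) ^ t * zxMul V ^ (s - N₂)) _ F hF0)
          (h0 (zwMul (ℤ → V) ^ t * zxMul V ^ (s - N₂)) _ G hG0)
      rw [this]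
      exact zero_mem _
    · obtain ⟨j, rfl⟩ := Nat.exists_eq_add_of_le ht
      have e : wxMul V ^ N₃ * (zxMul V ^ s * zwMul (ℤ → V) ^ (N₁ + 1 + j))
          = zwMul (ℤ → V) * (wxMul V ^ N₃ * zxMul V ^ s * zwMul (ℤ → V) ^ j
            * zwMul (ℤ → V) ^ N₁) := by
        have hc : Commute (zwMul (ℤ → V)) (wxMul V ^ N₃ * zxMul V ^ s) :=
          (hcomm.symm.pow_right _).mul_right (commute_zxMul_zwMul.symm.pow_right _)
        rw [mul_assoc (wxMul V ^ N₃ * zxMul V ^ s), ← mul_assoc (zwMul (ℤ → V)), hc.eq,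
          mul_assoc, mul_assoc, ← pow_add, ← pow_succ',
          show N₁ + 1 + j = j + N₁ + 1 by omega]
      rw [e]
      have hmem : ∀ {P : Submodule ℂ (ℤ → ℤ → ℤ → V)},
          (∀ f ∈ P, zwMul (ℤ → V) f ∈ P ∧ zxMul V f ∈ P) → ∀ f ∈ P,
          (wxMul V ^ N₃ * zxMul V ^ s * zwMul (ℤ → V) ^ j * zwMul (ℤ → V) ^ N₁) f ∈ P := by
        intro P hP
        have hpow : ∀ {X : Module.End ℂ (ℤ → ℤ → ℤ → V)}, (∀ f ∈ P, X f ∈ P) →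
            ∀ (i : ℕ), ∀ f ∈ P, (X ^ i) f ∈ P := by
          intro X hX i
          induction i with
          | zero => exact fun f hf => hf
          | succ i ih =>
            intro f hf
            rw [pow_succ, Module.End.mul_apply]
            exact ih _ (hX f hf)
        intro f hf
        refine hpow (fun g hg => ?_) _ _ (hpow (fun g hg => (hP g hg).2) _ _
          (hpow (fun g hg => (hP g hg).1) _ _ (hpow (fun g hg => (hP g hg).1) _ _ hf)))
        rw [wxMul_eq_sub]
        exact P.add_mem (hP g hg).2 (P.neg_mem (hP g hg).1)
      refine mem_nordKer_zwMul (hmem mapsTo_truncW F hF) (hmem mapsTo_truncZ G hG) ?_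
      rw [Module.End.mul_apply, hFG]
      rfl
  -- The binomial expansion of `(w - x) ^ (N₂ + N₁)` in `z - x` and `z - w`.
  have hker : E (wxMul V ^ (N₃ + (N₂ + N₁))) ∈ nordKer V := by
    rw [pow_add]
    nth_rw 2 [wxMul_eq_sub]
    rw [(commute_zxMul_zwMul (V := V)).neg_right.add_pow', Finset.mul_sum, map_sum]
    refine Submodule.sum_mem _ fun st hst => ?_
    have hst' : st.1 + st.2 = N₂ + N₁ := Finset.HasAntidiagonal.mem_antidiagonal.1 hst
    rw [mul_smul_comm, map_nsmul]
    refine Submodule.smul_of_tower_mem _ _ ?_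
    have hmem := hEmem st.1 st.2 (by omega)
    rcases st.2.even_or_odd with h | h
    · rwa [h.neg_pow]
    · rw [h.neg_pow, mul_neg, mul_neg, map_neg]
      exact Submodule.neg_mem _ hmem
  -- `w - x` commutes with the residue in `z` that defines the normally ordered product.
  have hH : ∀ (M : ℕ) n p, ∀ᶠ K : ℕ in atTop,
      (zwMul V ^ M) (fun n p => (A.nord B).mode n (C p v) - σ • C p ((A.nord B).mode n v)) n p
        = nordSum K (fun m n => (wxMul V ^ M) F m n p) (fun m n => (wxMul V ^ M) G m n p) n := by
    intro M
    induction M with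
    | zero =>
      intro n p
      filter_upwards [A.nord_eventually_eq B n (C p v), A.nord_eventually_eq B n v] with K e₁ e₂
      simp only [pow_zero, Module.End.one_apply, e₁, e₂, nordSum, map_add, map_sum, smul_add,
        Finset.smul_sum, F, G, Finset.sum_sub_distrib]
      abel
    | succ M ih =>
      intro n p
      filter_upwards [ih (n + 1) p, ih n (p + 1)] with K e₁ e₂
      rw [zwMul_pow_succ_apply, e₁, e₂]
      simp only [nordSum, pow_succ' (wxMul V), Module.End.mul_apply, wxMul_apply,
        Finset.sum_sub_distrib]
      rw [show ∀ a b c d : V, a + b - (c + d) = a - c + (b - d) by intros; abel]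
      congr 3 <;> funext k
      · rw [add_right_comm]
      · rw [show n + 1 - (k : ℤ) - 1 = n - k - 1 + 1 by ring]
  obtain ⟨K, e₁, e₂⟩ := ((hH (N₃ + (N₂ + N₁)) n p).and (hker n p)).exists
  have h := congrFun₂ (zwMul_pow_map (LinearMap.applyₗ v) (N₃ + (N₂ + N₁))
    fun n p => (A.nord B).mode n * C p - σ • (C p * (A.nord B).mode n)) n p
  exact h.symm.trans (e₁.trans e₂)

end Dong

/-! ### Coefficients of exponentials -/

section Exp

theorem coeff_pow_eq_zero_of_lt {A : Type*} [Ring A] {f : PowerSeries A}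
    (hf : PowerSeries.coeff 0 f = 0) {j n : ℕ} (h : n < j) : PowerSeries.coeff n (f ^ j) = 0 := by
  induction j generalizing n with
  | zero => omega
  | succ j ih =>
    rw [pow_succ', PowerSeries.coeff_mul]
    refine Finset.sum_eq_zero fun x hx => ?_
    have hx' : x.1 + x.2 = n := Finset.HasAntidiagonal.mem_antidiagonal.1 hx
    rcases Nat.eq_zero_or_pos x.1 with h0 | h0
    · rw [h0, hf, zero_mul]
    · rw [ih (by omega), mul_zero]

variable {A : Type*} [Ring A] [Algebra ℂ A]

/-- The Euler derivation `t d/dt` of a power series in `t`. -/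
def eulerDeriv (f : PowerSeries A) : PowerSeries A :=
  PowerSeries.mk fun k => (k : ℂ) • PowerSeries.coeff k f

theorem eulerDeriv_mul (f g : PowerSeries A) :
    eulerDeriv (f * g) = eulerDeriv f * g + f * eulerDeriv g := by
  ext n
  simp only [eulerDeriv, PowerSeries.coeff_mk, map_add, PowerSeries.coeff_mul, Finset.smul_sum,
    ← Finset.sum_add_distrib]
  refine Finset.sum_congr rfl fun x hx => ?_
  rw [← Finset.HasAntidiagonal.mem_antidiagonal.1 hx, smul_mul_assoc, mul_smul_comm, ← add_smul,
    Nat.cast_add]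

theorem eulerDeriv_pow_succ {f : PowerSeries A} (h : Commute (eulerDeriv f) f) (j : ℕ) :
    eulerDeriv (f ^ (j + 1)) = (j + 1) • (eulerDeriv f * f ^ j) := by
  induction j with
  | zero => simp
  | succ j ih =>
    rw [pow_succ', eulerDeriv_mul, ih, mul_smul_comm, ← mul_assoc, ← h.eq, mul_assoc, ← pow_succ',
      succ_nsmul' _ (j + 1)]

theorem commute_eulerDeriv {f : PowerSeries A}
    (h : ∀ i j, Commute (PowerSeries.coeff i f) (PowerSeries.coeff j f)) :
    Commute (eulerDeriv f) f := by
  ext n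
  rw [PowerSeries.coeff_mul, PowerSeries.coeff_mul, ← Finset.Nat.sum_antidiagonal_swap]
  refine Finset.sum_congr rfl fun x _ => ?_
  simp only [eulerDeriv, PowerSeries.coeff_mk, Prod.fst_swap, Prod.snd_swap, smul_mul_assoc,
    mul_smul_comm, (h x.2 x.1).eq]

theorem expCoeff_zero (f : PowerSeries A) : expCoeff f 0 = 1 := by
  simp [expCoeff]

/-- The differential equation of the exponential: `t E' = (t f') E` for `E = exp f`. -/
theorem succ_smul_expCoeff_succ {f : PowerSeries A} (hf : PowerSeries.coeff 0 f = 0)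
    (h : ∀ i j, Commute (PowerSeries.coeff i f) (PowerSeries.coeff j f)) (k : ℕ) :
    ((k : ℂ) + 1) • expCoeff f (k + 1) = ∑ i ∈ Finset.range (k + 1),
      (((i : ℂ) + 1) • PowerSeries.coeff (i + 1) f) * expCoeff f (k - i) := by
  have h1 : ∀ i ∈ Finset.range (k + 1), expCoeff f (k - i)
      = ∑ j ∈ Finset.range (k + 1), ((j.factorial : ℂ)⁻¹) • PowerSeries.coeff (k - i) (f ^ j) := by
    intro i _
    refine Finset.sum_subset (Finset.range_mono (by omega)) fun j _ hj => ?_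
    rw [coeff_pow_eq_zero_of_lt hf (by simpa using hj), smul_zero]
  have h2 : ∀ j, PowerSeries.coeff (k + 1) (eulerDeriv f * f ^ j) = ∑ i ∈ Finset.range (k + 1),
      (((i : ℂ) + 1) • PowerSeries.coeff (i + 1) f) * PowerSeries.coeff (k - i) (f ^ j) := by
    intro j
    rw [PowerSeries.coeff_mul, Finset.Nat.sum_antidiagonal_eq_sum_range_succ_mk,
      Finset.sum_range_succ']
    simp [eulerDeriv]
  rw [Finset.sum_congr rfl fun i hi => by rw [h1 i hi], expCoeff, Finset.sum_range_succ', pow_zero]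
  simp only [Finset.mul_sum, smul_add, Finset.smul_sum]
  rw [Finset.sum_comm, PowerSeries.coeff_one, if_neg (Nat.succ_ne_zero k), smul_zero, smul_zero,
    add_zero]
  refine Finset.sum_congr rfl fun j _ => ?_
  have h3 : ((k : ℂ) + 1) • PowerSeries.coeff (k + 1) (f ^ (j + 1))
      = PowerSeries.coeff (k + 1) (eulerDeriv (f ^ (j + 1))) := by
    simp [eulerDeriv]
  have hj : ((j : ℂ) + 1) ≠ 0 := by exact_mod_cast Nat.succ_ne_zero j
  rw [smul_comm, h3, eulerDeriv_pow_succ (commute_eulerDeriv h), map_nsmul, h2,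
    ← Nat.cast_smul_eq_nsmul ℂ, smul_smul, Finset.smul_sum]
  refine Finset.sum_congr rfl fun i _ => ?_
  rw [mul_smul_comm]
  congr 1
  rw [Nat.factorial_succ]
  push_cast
  field_simp

end Exp

/-! ### Oscillators -/

section Lattice

variable {L : Type*} [AddCommGroup L] {r : ℕ} {B : LinearMap.BilinForm ℤ L}
  {ε : Module.Basis (Fin r) ℤ L}

open MvPolynomial

theorem baseChange_comm (hB : B.IsSymm) (u v : ℂ ⊗[ℤ] L) :
    B.baseChange ℂ u v = B.baseChange ℂ v u :=
  (LinearMap.BilinForm.IsSymm.baseChange ℂ (LinearMap.BilinForm.isSymm_iff.1 hB)).eq u v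

theorem baseChange_one_tmul (lam mu : L) :
    B.baseChange ℂ (1 ⊗ₜ[ℤ] lam) (1 ⊗ₜ[ℤ] mu) = (B lam mu : ℂ) := by
  rw [LinearMap.BilinForm.baseChange_tmul]
  simp

/-- The element `u(-k-1)` of the symmetric algebra. -/
def creator (ε : Module.Basis (Fin r) ℤ L) (u : ℂ ⊗[ℤ] L) (k : ℕ) : Fock r :=
  ∑ i, (ε.baseChange ℂ).repr u i • X (i, k)

/-- The derivation by which `u(m+1)` acts on the symmetric algebra. -/
def annihilator (B : LinearMap.BilinForm ℤ L) (ε : Module.Basis (Fin r) ℤ L) (u : ℂ ⊗[ℤ] L)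
    (m : ℕ) : Derivation ℂ (Fock r) (Fock r) :=
  mkDerivation ℂ fun x : Fin r × ℕ =>
    if x.2 = m then C (((m : ℂ) + 1) * B.baseChange ℂ u (1 ⊗ₜ[ℤ] ε x.1)) else 0

theorem oscillator_negSucc (u : ℂ ⊗[ℤ] L) (k : ℕ) (p : Fock r) :
    oscillator B ε u (-k - 1) p = creator ε u k * p := by
  rw [show (-k - 1 : ℤ) = .negSucc k by omega]
  rfl

theorem oscillator_zero (u : ℂ ⊗[ℤ] L) : oscillator B ε u 0 = 0 := rfl

theorem oscillator_succ (u : ℂ ⊗[ℤ] L) (m : ℕ) (p : Fock r) :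
    oscillator B ε u (m + 1) p = annihilator B ε u m p := rfl

theorem creator_basis (i : Fin r) (k : ℕ) : creator ε (1 ⊗ₜ[ℤ] ε i) k = X (i, k) := by
  rw [creator, Finset.sum_eq_single i]
  · simp
  · intro j _ hj
    simp [Finsupp.single_eq_of_ne hj]
  · simp

theorem annihilator_creator (u v : ℂ ⊗[ℤ] L) (m k : ℕ) :
    annihilator B ε u m (creator ε v k)
      = if k = m then C (((m : ℂ) + 1) * B.baseChange ℂ u v) else 0 := by
  have hX : ∀ i, annihilator B ε u m (X (i, k))
      = if k = m then C (((m : ℂ) + 1) * B.baseChange ℂ u (1 ⊗ₜ[ℤ] ε i)) else 0 :=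
    fun i => mkDerivation_X _ _ _
  simp only [creator, map_sum, Derivation.map_smul, hX]
  split_ifs with h
  · have hv : v = ∑ i, (ε.baseChange ℂ).repr v i • (1 : ℂ) ⊗ₜ[ℤ] ε i := by
      conv_lhs => rw [← (ε.baseChange ℂ).sum_repr v]
      simp
    conv_rhs => rw [hv]
    rw [map_sum, Finset.mul_sum, map_sum]
    refine Finset.sum_congr rfl fun i _ => ?_
    rw [smul_eq_C_mul, ← C_mul, map_smul, smul_eq_mul]
    congr 1
    ring
  · simp only [smul_zero, Finset.sum_const_zero]

theorem annihilator_comm (u v : ℂ ⊗[ℤ] L) (m k : ℕ) (p : Fock r) :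
    annihilator B ε u m (annihilator B ε v k p) = annihilator B ε v k (annihilator B ε u m p) := by
  have h : ⁅annihilator B ε u m, annihilator B ε v k⁆ = 0 := by
    refine derivation_ext fun i => ?_
    simp only [Derivation.commutator_apply, annihilator, mkDerivation_X, Derivation.coe_zero,
      Pi.zero_apply]
    split_ifs <;> simp
  have := congrArg (fun D : Derivation ℂ (Fock r) (Fock r) => D p) h
  simpa [Derivation.commutator_apply, sub_eq_zero] using this

/-- The Heisenberg relations on the symmetric algebra. -/
theorem oscillator_commutator (hB : B.IsSymm) (u v : ℂ ⊗[ℤ] L) (m n : ℤ) (p : Fock r) :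
    oscillator B ε u m (oscillator B ε v n p) - oscillator B ε v n (oscillator B ε u m p)
      = (if m + n = 0 then (m : ℂ) * B.baseChange ℂ u v else 0) • p := by
  have neg_or : ∀ n : ℤ, (∃ k : ℕ, n = -k - 1) ∨ n = 0 ∨ ∃ k : ℕ, n = k + 1 := fun n => by
    rcases lt_trichotomy n 0 with h | h | h
    · exact Or.inl ⟨(-n - 1).toNat, by omega⟩
    · exact Or.inr (Or.inl h)
    · exact Or.inr (Or.inr ⟨(n - 1).toNat, by omega⟩)
  rcases neg_or m with ⟨k, rfl⟩ | rfl | ⟨k, rfl⟩ <;>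
    rcases neg_or n with ⟨l, rfl⟩ | rfl | ⟨l, rfl⟩ <;>
    simp only [oscillator_negSucc, oscillator_zero, oscillator_succ, LinearMap.zero_apply,
      map_zero, sub_zero, Int.cast_zero, zero_mul, ite_self, zero_smul]
  · rw [if_neg (by omega), mul_left_comm, sub_self, zero_smul]
  · rw [if_neg (by omega), zero_smul]
  · rw [Derivation.leibniz, annihilator_creator]
    by_cases h : k = l
    · subst h
      rw [if_pos rfl, if_pos (by omega), baseChange_comm hB u v]
      simp only [smul_eq_mul, smul_eq_C_mul]
      push_cast
      rw [show (-(k : ℂ) - 1) * B.baseChange ℂ v u = -(((k : ℂ) + 1) * B.baseChange ℂ v u) by ring,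
        C_neg]
      ring
    · rw [if_neg h, if_neg (by omega)]
      simp
  · rw [Derivation.leibniz, annihilator_creator]
    by_cases h : l = k
    · subst h
      rw [if_pos rfl, if_pos (by omega)]
      simp only [smul_eq_mul, smul_eq_C_mul]
      push_cast
      ring
    · rw [if_neg h, if_neg (by omega)]
      simp
  · rw [if_neg (by omega), zero_smul]
  · rw [if_neg (by omega), annihilator_comm, sub_self, zero_smul]

/-- Positive modes annihilate constants. -/
theorem oscillator_one (u : ℂ ⊗[ℤ] L) {m : ℤ} (hm : 0 ≤ m) :
    oscillator B ε u m (1 : Fock r) = 0 := by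
  rcases hm.eq_or_lt with rfl | h
  · rfl
  · obtain ⟨k, rfl⟩ : ∃ k : ℕ, m = k + 1 := ⟨(m - 1).toNat, by omega⟩
    rw [oscillator_succ, Derivation.map_one_eq_zero]

/-- The image of a creation operator has no constant term. -/
theorem constantCoeff_oscillator (u : ℂ ⊗[ℤ] L) {m : ℤ} (hm : m < 0) (p : Fock r) :
    constantCoeff (oscillator B ε u m p) = 0 := by
  obtain ⟨k, rfl⟩ : ∃ k : ℕ, m = -k - 1 := ⟨(-m - 1).toNat, by omega⟩
  rw [oscillator_negSucc, map_mul, creator, map_sum, Finset.sum_eq_zero, zero_mul]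
  intro i _
  rw [smul_eq_C_mul, map_mul, constantCoeff_X, mul_zero]

/-! ### The exponentials of the lattice vertex operators -/

/-- If `E` solves `t E' = t (∑ᵢ xᵢ tⁱ) E` and `U` contracts with the single coefficient `xₘ`, then
`[U, E] = a t ^ (m+1) E`. -/
theorem exp_commutator {R : Type*} [Ring R] [Algebra ℂ R] {E : ℤ → R} {x : ℕ → R} {U : R} {a : ℂ}
    {m : ℕ} (hneg : ∀ k < 0, E k = 0) (h0 : E 0 = 1)
    (hrec : ∀ (k : ℤ) (N : ℕ), k ≤ N → (k : ℂ) • E k = ∑ i ∈ Finset.range N, x i * E (k - 1 - i))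
    (hx : ∀ i, U * x i - x i * U = if i = m then (((m : ℂ) + 1) * a) • 1 else 0) (k : ℤ) :
    U * E k - E k * U = a • E (k - (m + 1)) := by
  rcases lt_trichotomy k 0 with hk | rfl | hk
  · rw [hneg k hk, hneg _ (by omega)]
    simp
  · rw [h0, hneg _ (by omega)]
    simp
  lift k to ℕ using hk.le
  induction k using Nat.strong_induction_on with
  | _ k ih =>
    have ih' : ∀ i : ℕ, U * E (k - 1 - i) - E (k - 1 - i) * U = a • E (k - 1 - i - (m + 1)) := by
      intro i
      rcases lt_trichotomy ((k : ℤ) - 1 - i) 0 with hk' | hk' | hk'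
      · rw [hneg _ hk', hneg _ (by omega)]
        simp
      · rw [hk', h0, hneg _ (by omega)]
        simp
      · have := ih (k - 1 - i) (by omega) (by omega)
        rwa [show ((k - 1 - i : ℕ) : ℤ) = k - 1 - i by omega] at this
    have hk0 : (k : ℂ) ≠ 0 := by exact_mod_cast hk.ne'
    have e : (k : ℂ) • (U * E k - E k * U) = (k : ℂ) • a • E (k - (m + 1)) := by
      have h₁ := hrec k (k + (m + 1)) (by push_cast; omega)
      have h₂ := hrec (k - (m + 1)) (k + (m + 1)) (by push_cast; omega)
      rw [Int.cast_natCast] at h₁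
      rw [smul_sub, ← mul_smul_comm, ← smul_mul_assoc, h₁, Finset.mul_sum, Finset.sum_mul,
        ← Finset.sum_sub_distrib]
      -- Leibniz rule: the contraction with `xₘ` contributes `(m + 1) a E`, and the remaining terms
      -- are the recursion for `E (k - m - 1)`, which contributes `(k - m - 1) a E`.
      have h₃ : ∀ i : ℕ, U * (x i * E (k - 1 - i)) - x i * E (k - 1 - i) * U
          = (if i = m then (((m : ℂ) + 1) * a) • E (k - 1 - i) else 0)
            + a • (x i * E (k - (m + 1) - 1 - i)) := by
        intro i
        rw [show (k : ℤ) - (m + 1) - 1 - i = k - 1 - i - (m + 1) by ring, ← mul_smul_comm, ← ih' i]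
        have : U * (x i * E (k - 1 - i)) - x i * E (k - 1 - i) * U
            = (U * x i - x i * U) * E (k - 1 - i)
              + x i * (U * E (k - 1 - i) - E (k - 1 - i) * U) := by noncomm_ring
        rw [this, hx]
        split_ifs <;> simp
      rw [Finset.sum_congr rfl fun i _ => h₃ i, Finset.sum_add_distrib, ← Finset.smul_sum, ← h₂,
        Finset.sum_ite_eq', if_pos (Finset.mem_range.2 (by omega)), smul_smul, smul_smul,
        show (k : ℤ) - 1 - m = k - (m + 1) by ring, ← add_smul]
      push_cast
      congr 1
      ring
    exact smul_right_injective _ hk0 e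

theorem expMinus_zero (lam : L) : expMinus B ε lam 0 = 1 := expCoeff_zero _

theorem expPlus_zero (lam : L) : expPlus B ε lam 0 = 1 := expCoeff_zero _

theorem commute_oscillator (hB : B.IsSymm) (u v : ℂ ⊗[ℤ] L) {m n : ℤ} (h : m + n ≠ 0) :
    Commute (oscillator B ε u m) (oscillator B ε v n) := by
  refine LinearMap.ext fun p => ?_
  have := oscillator_commutator (ε := ε) hB u v m n p
  rw [if_neg h, zero_smul] at this
  exact sub_eq_zero.1 this

theorem expMinus_succ (hB : B.IsSymm) (lam : L) (k : ℕ) :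
    ((k : ℂ) + 1) • expMinus B ε lam (k + 1) = ∑ i ∈ Finset.range (k + 1),
      oscillator B ε (1 ⊗ₜ[ℤ] lam) (-i - 1) * expMinus B ε lam (k - i) := by
  rw [expMinus, succ_smul_expCoeff_succ]
  · refine Finset.sum_congr rfl fun i _ => ?_
    have hi : ((i : ℂ) + 1) ≠ 0 := by exact_mod_cast Nat.succ_ne_zero i
    rw [PowerSeries.coeff_mk, smul_smul, expMinus]
    push_cast
    rw [mul_inv_cancel₀ hi, one_smul, neg_add, sub_eq_add_neg]
  · simp
  · intro i j
    simp only [PowerSeries.coeff_mk]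
    rcases Nat.eq_zero_or_pos i with rfl | hi
    · simp
    refine ((commute_oscillator hB _ _ (by omega)).smul_left _).smul_right _

theorem expPlus_succ (hB : B.IsSymm) (lam : L) (k : ℕ) :
    ((k : ℂ) + 1) • expPlus B ε lam (k + 1) = -∑ i ∈ Finset.range (k + 1),
      oscillator B ε (1 ⊗ₜ[ℤ] lam) (i + 1) * expPlus B ε lam (k - i) := by
  rw [expPlus, succ_smul_expCoeff_succ, ← Finset.sum_neg_distrib]
  · refine Finset.sum_congr rfl fun i _ => ?_
    have hi : ((i : ℂ) + 1) ≠ 0 := by exact_mod_cast Nat.succ_ne_zero i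
    rw [PowerSeries.coeff_mk, smul_smul, expPlus]
    push_cast
    rw [mul_neg, mul_inv_cancel₀ hi, neg_smul, one_smul]
    exact neg_mul (oscillator B ε (1 ⊗ₜ[ℤ] lam) (i + 1)) _
  · simp
  · intro i j
    simp only [PowerSeries.coeff_mk]
    rcases Nat.eq_zero_or_pos i with rfl | hi
    · simp
    refine ((commute_oscillator hB _ _ (by omega)).smul_left _).smul_right _

/-- `expMinus`, extended by zero to negative exponents. -/
def expMinusInt (B : LinearMap.BilinForm ℤ L) (ε : Module.Basis (Fin r) ℤ L) (lam : L) (k : ℤ) :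
    Module.End ℂ (Fock r) :=
  if 0 ≤ k then expMinus B ε lam k.toNat else 0

/-- `expPlus`, extended by zero to negative exponents. -/
def expPlusInt (B : LinearMap.BilinForm ℤ L) (ε : Module.Basis (Fin r) ℤ L) (lam : L) (k : ℤ) :
    Module.End ℂ (Fock r) :=
  if 0 ≤ k then expPlus B ε lam k.toNat else 0

theorem expMinusInt_of_neg (lam : L) {k : ℤ} (hk : k < 0) : expMinusInt B ε lam k = 0 :=
  if_neg hk.not_ge

theorem expPlusInt_of_neg (lam : L) {k : ℤ} (hk : k < 0) : expPlusInt B ε lam k = 0 :=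
  if_neg hk.not_ge

theorem expMinusInt_zero (lam : L) : expMinusInt B ε lam 0 = 1 := expMinus_zero lam

theorem expPlusInt_zero (lam : L) : expPlusInt B ε lam 0 = 1 := expPlus_zero lam

theorem expMinusInt_rec (hB : B.IsSymm) (lam : L) (k : ℤ) (N : ℕ) (hN : k ≤ N) :
    (k : ℂ) • expMinusInt B ε lam k = ∑ i ∈ Finset.range N,
      oscillator B ε (1 ⊗ₜ[ℤ] lam) (-i - 1) * expMinusInt B ε lam (k - 1 - i) := by
  rcases le_or_gt k 0 with hk | hk
  · rw [Finset.sum_eq_zero fun i _ => by rw [expMinusInt_of_neg lam (by omega), mul_zero]]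
    rcases hk.lt_or_eq with hk | rfl
    · rw [expMinusInt_of_neg lam hk, smul_zero]
    · simp
  · obtain ⟨j, rfl⟩ : ∃ j : ℕ, k = j + 1 := ⟨(k - 1).toNat, by omega⟩
    have h := expMinus_succ (ε := ε) hB lam j
    rw [← Finset.sum_subset (Finset.range_mono (show j + 1 ≤ N by omega)) fun i _ hi => by
      rw [expMinusInt_of_neg lam (by simp at hi; omega), mul_zero]]
    push_cast
    rw [expMinusInt, if_pos (by omega), show ((j : ℤ) + 1).toNat = j + 1 by omega, h]
    refine Finset.sum_congr rfl fun i hi => ?_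
    have := Finset.mem_range.1 hi
    rw [expMinusInt, if_pos (by omega), show ((j : ℤ) + 1 - 1 - i).toNat = j - i by omega]

theorem expPlusInt_rec (hB : B.IsSymm) (lam : L) (k : ℤ) (N : ℕ) (hN : k ≤ N) :
    (k : ℂ) • expPlusInt B ε lam k = ∑ i ∈ Finset.range N,
      -oscillator B ε (1 ⊗ₜ[ℤ] lam) (i + 1) * expPlusInt B ε lam (k - 1 - i) := by
  rcases le_or_gt k 0 with hk | hk
  · rw [Finset.sum_eq_zero fun i _ => by rw [expPlusInt_of_neg lam (by omega), mul_zero]]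
    rcases hk.lt_or_eq with hk | rfl
    · rw [expPlusInt_of_neg lam hk, smul_zero]
    · simp
  · obtain ⟨j, rfl⟩ : ∃ j : ℕ, k = j + 1 := ⟨(k - 1).toNat, by omega⟩
    have h := expPlus_succ (ε := ε) hB lam j
    rw [← Finset.sum_subset (Finset.range_mono (show j + 1 ≤ N by omega)) fun i _ hi => by
      rw [expPlusInt_of_neg lam (by simp at hi; omega), mul_zero]]
    push_cast
    rw [expPlusInt, if_pos (by omega), show ((j : ℤ) + 1).toNat = j + 1 by omega, h,
      ← Finset.sum_neg_distrib]
    refine Finset.sum_congr rfl fun i hi => ?_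
    have := Finset.mem_range.1 hi
    rw [expPlusInt, if_pos (by omega), show ((j : ℤ) + 1 - 1 - i).toNat = j - i by omega]
    exact (neg_mul (oscillator B ε (1 ⊗ₜ[ℤ] lam) (i + 1)) _).symm

theorem oscillator_commutator_mul (hB : B.IsSymm) (u v : ℂ ⊗[ℤ] L) (m n : ℤ) :
    oscillator B ε u m * oscillator B ε v n - oscillator B ε v n * oscillator B ε u m
      = (if m + n = 0 then (m : ℂ) * B.baseChange ℂ u v else 0) • 1 :=
  LinearMap.ext fun p => oscillator_commutator hB u v m n p

/-- `[u(n), E⁻(z)] = ⟨u, λ⟩ z ^ n E⁻(z)` for `n > 0`, and `u(n)` commutes with `E⁻(z)` otherwise. -/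
theorem oscillator_expMinusInt (hB : B.IsSymm) (u : ℂ ⊗[ℤ] L) (lam : L) (n k : ℤ) (p : Fock r) :
    oscillator B ε u n (expMinusInt B ε lam k p) = expMinusInt B ε lam k (oscillator B ε u n p)
      + if 0 < n then B.baseChange ℂ u (1 ⊗ₜ[ℤ] lam) • expMinusInt B ε lam (k - n) p else 0 := by
  split_ifs with hn
  · obtain ⟨m, rfl⟩ : ∃ m : ℕ, n = m + 1 := ⟨(n - 1).toNat, by omega⟩
    have h := LinearMap.congr_fun (exp_commutator (U := oscillator B ε u (m + 1))
      (a := B.baseChange ℂ u (1 ⊗ₜ[ℤ] lam)) (m := m) (fun k => expMinusInt_of_neg lam)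
      (expMinusInt_zero lam) (expMinusInt_rec (ε := ε) hB lam) (fun i => by
        rw [oscillator_commutator_mul hB]
        by_cases h : i = m
        · rw [if_pos h, if_pos (by omega)]; push_cast; rfl
        · rw [if_neg h, if_neg (by omega), zero_smul]) k) p
    exact (sub_eq_iff_eq_add.1 h).trans (add_comm _ _)
  · have h := LinearMap.congr_fun (exp_commutator (U := oscillator B ε u n)
      (a := 0) (m := 0) (fun k => expMinusInt_of_neg lam)
      (expMinusInt_zero lam) (expMinusInt_rec (ε := ε) hB lam) (fun i => by
        rw [oscillator_commutator_mul hB, if_neg (by omega), mul_zero, zero_smul, ite_self]) k) p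
    rw [zero_smul] at h
    exact (sub_eq_iff_eq_add.1 h).trans (add_comm _ _)

/-- `[u(n), E⁺(z)] = ⟨u, λ⟩ z ^ n E⁺(z)` for `n < 0`, and `u(n)` commutes with `E⁺(z)` otherwise. -/
theorem oscillator_expPlusInt (hB : B.IsSymm) (u : ℂ ⊗[ℤ] L) (lam : L) (n k : ℤ) (p : Fock r) :
    oscillator B ε u n (expPlusInt B ε lam k p) = expPlusInt B ε lam k (oscillator B ε u n p)
      + if n < 0 then B.baseChange ℂ u (1 ⊗ₜ[ℤ] lam) • expPlusInt B ε lam (k + n) p else 0 := by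
  have hx : ∀ i : ℕ, oscillator B ε u n * -oscillator B ε (1 ⊗ₜ[ℤ] lam) (i + 1)
      - -oscillator B ε (1 ⊗ₜ[ℤ] lam) (i + 1) * oscillator B ε u n
      = (if n + (i + 1) = 0 then (-n : ℂ) * B.baseChange ℂ u (1 ⊗ₜ[ℤ] lam) else 0) • 1 := by
    intro i
    have h := oscillator_commutator_mul (ε := ε) hB u (1 ⊗ₜ[ℤ] lam) n (i + 1)
    have e {R : Type} [Ring R] (X Y : R) : X * -Y - -Y * X = -(X * Y - Y * X) := by
      rw [mul_neg, neg_mul, sub_neg_eq_add, neg_sub, sub_eq_neg_add, add_comm, add_comm]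
    refine (e _ _).trans ?_
    rw [h]
    refine (neg_smul _ (1 : Module.End ℂ (Fock r))).symm.trans ?_
    congr 1
    split_ifs <;> simp
  split_ifs with hn
  · obtain ⟨m, rfl⟩ : ∃ m : ℕ, n = -(m + 1) := ⟨(-n - 1).toNat, by omega⟩
    have h := LinearMap.congr_fun (exp_commutator (U := oscillator B ε u (-(m + 1)))
      (a := B.baseChange ℂ u (1 ⊗ₜ[ℤ] lam)) (m := m) (fun k => expPlusInt_of_neg lam)
      (expPlusInt_zero lam) (expPlusInt_rec (ε := ε) hB lam) (fun i => by
        refine (hx i).trans ?_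
        by_cases h : i = m
        · rw [if_pos h, if_pos (by omega)]; push_cast; rw [neg_neg]
        · rw [if_neg h, if_neg (by omega), zero_smul]) k) p
    exact (sub_eq_iff_eq_add.1 h).trans (add_comm _ _)
  · have h := LinearMap.congr_fun (exp_commutator (U := oscillator B ε u n)
      (a := 0) (m := 0) (fun k => expPlusInt_of_neg lam)
      (expPlusInt_zero lam) (expPlusInt_rec (ε := ε) hB lam) (fun i => by
        refine (hx i).trans ?_
        rw [if_neg (by omega), mul_zero, zero_smul, ite_self]) k) p
    rw [zero_smul] at h
    exact (sub_eq_iff_eq_add.1 h).trans (add_comm _ _)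

theorem expPlusInt_one (hB : B.IsSymm) (lam : L) (k : ℤ) :
    expPlusInt B ε lam k (1 : Fock r) = if k = 0 then 1 else 0 := by
  split_ifs with h
  · rw [h, expPlusInt_zero]
    rfl
  · have hk : (k : ℂ) ≠ 0 := by exact_mod_cast h
    have h := LinearMap.congr_fun (expPlusInt_rec (ε := ε) hB lam k k.toNat (by omega)) 1
    refine smul_right_injective _ hk ?_
    beta_reduce
    rw [smul_zero, ← LinearMap.smul_apply, h, LinearMap.sum_apply, Finset.sum_eq_zero]
    intro i _
    change -(oscillator B ε (1 ⊗ₜ[ℤ] lam) (i + 1) (expPlusInt B ε lam (k - 1 - i) 1)) = 0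
    rw [oscillator_expPlusInt hB, if_neg (by omega), oscillator_one _ (by omega), map_zero,
      add_zero, neg_zero]

theorem constantCoeff_expMinusInt (hB : B.IsSymm) (lam : L) (k : ℤ) (p : Fock r) :
    constantCoeff (expMinusInt B ε lam k p) = if k = 0 then constantCoeff p else 0 := by
  split_ifs with h
  · rw [h, expMinusInt_zero]
    rfl
  · have hk : (k : ℂ) ≠ 0 := by exact_mod_cast h
    have h := LinearMap.congr_fun (expMinusInt_rec (ε := ε) hB lam k k.toNat (by omega)) p
    refine mul_left_cancel₀ hk ?_
    have e := congrArg constantCoeff h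
    rw [LinearMap.smul_apply, smul_eq_C_mul, map_mul, constantCoeff_C] at e
    rw [mul_zero, e, LinearMap.sum_apply, map_sum, Finset.sum_eq_zero]
    intro i _
    exact constantCoeff_oscillator _ (by omega) _

/-- `E⁺(z) p` is a polynomial in `z⁻¹`. -/
theorem exists_expPlusInt_eq_zero (hB : B.IsSymm) (lam : L) (p : Fock r) :
    ∃ N : ℤ, ∀ k, N ≤ k → expPlusInt B ε lam k p = 0 := by
  induction p using MvPolynomial.induction_on with
  | C a =>
    refine ⟨1, fun k hk => ?_⟩
    rw [← mul_one (C a), ← smul_eq_C_mul, map_smul, expPlusInt_one hB, if_neg (by omega), smul_zero]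
  | add p q hp hq =>
    obtain ⟨N, hN⟩ := hp
    obtain ⟨N', hN'⟩ := hq
    refine ⟨max N N', fun k hk => ?_⟩
    rw [map_add, hN k ((le_max_left _ _).trans hk), hN' k ((le_max_right _ _).trans hk), add_zero]
  | mul_X p x hp =>
    obtain ⟨N, hN⟩ := hp
    refine ⟨N + x.2 + 1, fun k hk => ?_⟩
    have h := oscillator_expPlusInt (ε := ε) hB (1 ⊗ₜ[ℤ] ε x.1) lam (-x.2 - 1) k p
    rw [if_pos (by omega), hN k (by omega), hN _ (by omega), map_zero, smul_zero, add_zero,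
      oscillator_negSucc, creator_basis] at h
    rw [mul_comm, ← h]

theorem expInt_zero_lattice (hB : B.IsSymm) (k : ℤ) :
    expMinusInt B ε 0 k = (if k = 0 then 1 else 0) ∧
      expPlusInt B ε 0 k = if k = 0 then 1 else 0 := by
  have h0 : ∀ n, oscillator B ε ((1 : ℂ) ⊗ₜ[ℤ] (0 : L)) n = 0 := by
    intro n
    rcases n with (_ | n) | n
    · rfl
    · refine LinearMap.ext fun p => ?_
      change annihilator B ε _ n p = 0
      have : annihilator B ε ((1 : ℂ) ⊗ₜ[ℤ] (0 : L)) n = 0 :=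
        derivation_ext fun i => by simp [annihilator]
      rw [this]
      rfl
    · refine LinearMap.ext fun p => ?_
      change creator ε _ n * p = 0
      simp [creator]
  by_cases h : k = 0
  · rw [h, expMinusInt_zero, expPlusInt_zero]
    simp
  · have hk : (k : ℂ) ≠ 0 := by exact_mod_cast h
    rw [if_neg h]
    constructor
    · refine smul_right_injective _ hk ?_
      beta_reduce
      rw [smul_zero, expMinusInt_rec hB _ k k.toNat (by omega)]
      exact Finset.sum_eq_zero fun i _ => by rw [h0, zero_mul]
    · refine smul_right_injective _ hk ?_
      beta_reduce
      rw [smul_zero, expPlusInt_rec hB _ k k.toNat (by omega)]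
      refine Finset.sum_eq_zero fun i _ => ?_
      rw [h0]
      exact LinearMap.ext fun p => neg_zero

/-- The coefficient of `t ^ k` in `(1 - t) ^ a`, extended by zero to `k < 0`. -/
def binomCoeff (a k : ℤ) : ℂ :=
  if 0 ≤ k then (-1 : ℂ) ^ k.toNat * (Ring.choose a k.toNat : ℤ) else 0

theorem binomCoeff_natCast (a : ℤ) (k : ℕ) :
    binomCoeff a k = (-1 : ℂ) ^ k * (Ring.choose a k : ℤ) := by
  simp [binomCoeff]

theorem binomCoeff_of_neg (a : ℤ) {k : ℤ} (hk : k < 0) : binomCoeff a k = 0 := if_neg hk.not_ge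

theorem binomCoeff_zero (a : ℤ) : binomCoeff a 0 = 1 := by simp [binomCoeff]

/-- `(1 - t) (1 - t) ^ a = (1 - t) ^ (a + 1)`. -/
theorem binomCoeff_sub (a k : ℤ) :
    binomCoeff a k - binomCoeff a (k - 1) = binomCoeff (a + 1) k := by
  rcases lt_trichotomy k 0 with hk | rfl | hk
  · rw [binomCoeff_of_neg _ hk, binomCoeff_of_neg _ hk, binomCoeff_of_neg _ (by omega), sub_zero]
  · rw [binomCoeff_zero, binomCoeff_zero, binomCoeff_of_neg _ (by omega), sub_zero]
  · obtain ⟨j, rfl⟩ : ∃ j : ℕ, k = j + 1 := ⟨(k - 1).toNat, by omega⟩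
    rw [add_sub_cancel_right, ← Nat.cast_succ, binomCoeff_natCast, binomCoeff_natCast,
      binomCoeff_natCast, Nat.succ_eq_add_one, Ring.choose_succ_succ, pow_succ]
    push_cast
    ring

/-- The symmetry of the binomial coefficients of a natural number. -/
theorem binomCoeff_symm (c : ℕ) (k : ℤ) :
    binomCoeff c k = (-1 : ℂ) ^ c * binomCoeff c (c - k) := by
  rcases lt_or_ge k 0 with hk | hk
  · rw [binomCoeff_of_neg _ hk]
    obtain ⟨j, hj⟩ : ∃ j : ℕ, c - k = j := ⟨(c - k).toNat, by omega⟩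
    rw [hj, binomCoeff_natCast, Ring.choose_natCast, Nat.choose_eq_zero_of_lt (by omega)]
    simp
  · lift k to ℕ using hk
    rcases le_or_gt k c with h | h
    · rw [← Nat.cast_sub h, binomCoeff_natCast, binomCoeff_natCast, Ring.choose_natCast,
        Ring.choose_natCast, Nat.choose_symm h, ← mul_assoc, ← pow_add]
      congr 1
      rw [show c + (c - k) = k + 2 * (c - k) by omega, pow_add, pow_mul]
      simp
    · rw [binomCoeff_of_neg _ (show (c : ℤ) - k < 0 by omega), binomCoeff_natCast,
        Ring.choose_natCast, Nat.choose_eq_zero_of_lt h]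
      simp

theorem sum_binomCoeff (a : ℤ) (k : ℕ) :
    ((k : ℂ) + 1) * binomCoeff a (k + 1) = -(a : ℂ) * ∑ i ∈ Finset.range (k + 1),
      binomCoeff a (k - i) := by
  have h : ∑ i ∈ Finset.range (k + 1), binomCoeff a (k - i) = binomCoeff (a - 1) k := by
    have := Finset.sum_range_sub' (fun i : ℕ => binomCoeff (a - 1) (k - i)) (k + 1)
    rw [Nat.cast_zero, sub_zero,
      binomCoeff_of_neg _ (show (k : ℤ) - ((k + 1 : ℕ) : ℤ) < 0 by omega), sub_zero] at this
    rw [← this]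
    refine Finset.sum_congr rfl fun i _ => ?_
    have e := binomCoeff_sub (a - 1) (k - i)
    rw [sub_add_cancel] at e
    rw [← e]
    push_cast
    rw [sub_sub]
  have h' : ((k : ℂ) + 1) * (Ring.choose a (k + 1) : ℤ) = a * (Ring.choose (a - 1) k : ℤ) := by
    exact_mod_cast choose_succ_mul a k
  rw [h, show (k : ℤ) + 1 = ((k + 1 : ℕ) : ℤ) from rfl, binomCoeff_natCast, binomCoeff_natCast,
    pow_succ]
  linear_combination (-1 : ℂ) ^ k * (-1) * h'

/-- The vacuum expectation `⟨E⁺_λ(z) E⁻_μ(w)⟩ = (1 - w / z) ^ ⟨λ, μ⟩`. -/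
theorem constantCoeff_expPlusInt_expMinusInt (hB : B.IsSymm) (lam mu : L) (s k : ℤ) :
    constantCoeff (expPlusInt B ε lam s (expMinusInt B ε mu k (1 : Fock r)))
      = if s = k then binomCoeff (B lam mu) k else 0 := by
  rcases lt_trichotomy s 0 with hs | rfl | hs
  · rw [expPlusInt_of_neg _ hs, LinearMap.zero_apply, map_zero]
    split_ifs with h
    · rw [binomCoeff_of_neg _ (by omega)]
    · rfl
  · rw [expPlusInt_zero, Module.End.one_apply, constantCoeff_expMinusInt hB, map_one]
    by_cases h : k = 0
    · rw [if_pos h, if_pos h.symm, h, binomCoeff_zero]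
    · rw [if_neg h, if_neg (Ne.symm h)]
  lift s to ℕ using hs.le
  induction s using Nat.strong_induction_on generalizing k with
  | _ s ih =>
    obtain ⟨s, rfl⟩ : ∃ t, s = t + 1 := ⟨s - 1, by omega⟩
    have ih' : ∀ i ∈ Finset.range (s + 1), constantCoeff (expPlusInt B ε lam
        (((s + 1 : ℕ) : ℤ) - 1 - i) (expMinusInt B ε mu (k - (i + 1)) (1 : Fock r)))
        = if (s : ℤ) + 1 = k then binomCoeff (B lam mu) (s - i) else 0 := by
      intro i hi
      have hi' := Finset.mem_range.1 hi
      rw [show ((s + 1 : ℕ) : ℤ) - 1 - i = ((s - i : ℕ) : ℤ) by omega]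
      rcases Nat.eq_zero_or_pos (s - i) with h0 | h0
      · rw [h0, Nat.cast_zero, expPlusInt_zero, Module.End.one_apply, constantCoeff_expMinusInt hB,
          map_one, show (s : ℤ) - i = 0 by omega, binomCoeff_zero]
        exact if_congr (by omega) rfl rfl
      · rw [ih (s - i) (by omega) _ (by omega)]
        by_cases h : (s : ℤ) + 1 = k
        · rw [if_pos h, if_pos (by omega)]
          congr 1; omega
        · rw [if_neg h, if_neg (by omega)]
    have hk0 : (s : ℂ) + 1 ≠ 0 := by exact_mod_cast Nat.succ_ne_zero s
    have h := LinearMap.congr_fun (expPlusInt_rec (ε := ε) hB lam (s + 1 : ℕ) (s + 1) le_rfl)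
      (expMinusInt B ε mu k 1)
    have e := congrArg constantCoeff h
    rw [LinearMap.smul_apply, smul_eq_C_mul, map_mul, constantCoeff_C, LinearMap.sum_apply,
      map_sum] at e
    refine mul_left_cancel₀ hk0 ?_
    push_cast at e ⊢
    rw [e]
    have e' : ∀ i ∈ Finset.range (s + 1), constantCoeff ((-oscillator B ε (1 ⊗ₜ[ℤ] lam) (i + 1)
        * expPlusInt B ε lam ((s : ℤ) + 1 - 1 - i)) (expMinusInt B ε mu k (1 : Fock r)))
        = -(B lam mu : ℂ) * if (s : ℤ) + 1 = k then binomCoeff (B lam mu) (s - i) else 0 := by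
      intro i hi
      rw [← ih' i hi]
      change constantCoeff (-(oscillator B ε (1 ⊗ₜ[ℤ] lam) (i + 1)
        (expPlusInt B ε lam ((s : ℤ) + 1 - 1 - i) (expMinusInt B ε mu k (1 : Fock r))))) = _
      rw [oscillator_expPlusInt hB, if_neg (by omega), add_zero, oscillator_expMinusInt hB,
        if_pos (by omega), oscillator_one _ (by omega), map_zero, zero_add, map_smul, map_neg,
        baseChange_one_tmul, smul_eq_C_mul, map_mul, constantCoeff_C, neg_mul]
      push_cast
      rfl
    rw [Finset.sum_congr rfl e', ← Finset.mul_sum]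
    by_cases h : (s : ℤ) + 1 = k
    · simp only [if_pos h]
      rw [← h, sum_binomCoeff]
    · simp only [if_neg h, Finset.sum_const_zero, mul_zero]

/-! ### The Heisenberg fields -/

theorem heisenberg_single (u : ℂ ⊗[ℤ] L) (m : ℤ) (mu : L) (p : Fock r) :
    heisenberg B ε u m (Finsupp.single mu p) = Finsupp.single mu
      (if m = 0 then B.baseChange ℂ u (1 ⊗ₜ[ℤ] mu) • p else oscillator B ε u m p) := by
  rw [heisenberg, Finsupp.lsum_single, LinearMap.comp_apply]
  split_ifs <;> rfl

theorem heisenberg_zero_single (u : ℂ ⊗[ℤ] L) (mu : L) (p : Fock r) :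
    heisenberg B ε u 0 (Finsupp.single mu p)
      = B.baseChange ℂ u (1 ⊗ₜ[ℤ] mu) • Finsupp.single mu p := by
  rw [heisenberg_single, if_pos rfl, Finsupp.smul_single]

theorem heisenberg_single_of_ne (u : ℂ ⊗[ℤ] L) {m : ℤ} (hm : m ≠ 0) (mu : L) (p : Fock r) :
    heisenberg B ε u m (Finsupp.single mu p) = Finsupp.single mu (oscillator B ε u m p) := by
  rw [heisenberg_single, if_neg hm]

theorem heisenberg_apply_of_ne (u : ℂ ⊗[ℤ] L) {m : ℤ} (hm : m ≠ 0) (w : LatticeSpace L r)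
    (nu : L) : heisenberg B ε u m w nu = oscillator B ε u m (w nu) := by
  classical
  induction w using Finsupp.induction_linear with
  | zero => simp
  | add v w hv hw => simp only [map_add, Finsupp.add_apply, hv, hw]
  | single mu p =>
    rw [heisenberg_single_of_ne u hm, Finsupp.single_apply, Finsupp.single_apply]
    split_ifs <;> simp

theorem oscillator_linear (u v : ℂ ⊗[ℤ] L) (c : ℂ) (m : ℤ) (p : Fock r) :
    oscillator B ε (u + c • v) m p = oscillator B ε u m p + c • oscillator B ε v m p := by
  rcases lt_trichotomy m 0 with hm | rfl | hm
  · obtain ⟨k, rfl⟩ : ∃ k : ℕ, m = -k - 1 := ⟨(-m - 1).toNat, by omega⟩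
    rw [oscillator_negSucc, oscillator_negSucc, oscillator_negSucc, ← smul_mul_assoc, ← add_mul]
    congr 1
    simp only [creator, map_add, map_smul, Finsupp.add_apply, Finsupp.smul_apply, add_smul,
      Finset.sum_add_distrib, Finset.smul_sum, smul_assoc]
  · simp [oscillator_zero]
  · obtain ⟨k, rfl⟩ : ∃ k : ℕ, m = k + 1 := ⟨(m - 1).toNat, by omega⟩
    have h : annihilator B ε (u + c • v) k = annihilator B ε u k + c • annihilator B ε v k := by
      refine derivation_ext fun x => ?_
      rw [Derivation.add_apply, Derivation.smul_apply]
      simp only [annihilator, mkDerivation_X, map_add, map_smul, LinearMap.add_apply,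
        LinearMap.smul_apply]
      split_ifs
      · simp only [smul_eq_C_mul, ← C_mul, ← C_add, smul_eq_mul]
        congr 1
        ring
      · simp
    rw [oscillator_succ, h]
    rfl

/-- The operator `u(m)`, as a linear function of `u`. -/
def heisenbergMap (B : LinearMap.BilinForm ℤ L) (ε : Module.Basis (Fin r) ℤ L) (m : ℤ) :
    ℂ ⊗[ℤ] L →ₗ[ℂ] Module.End ℂ (LatticeSpace L r) :=
  have h : ∀ (u v : ℂ ⊗[ℤ] L) (c : ℂ),
      heisenberg B ε (u + c • v) m = heisenberg B ε u m + c • heisenberg B ε v m := fun u v c => by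
    refine Finsupp.lhom_ext fun mu p => ?_
    rw [LinearMap.add_apply, LinearMap.smul_apply]
    by_cases hm : m = 0
    · subst hm
      rw [heisenberg_zero_single, heisenberg_zero_single, heisenberg_zero_single, map_add,
        map_smul, LinearMap.add_apply, LinearMap.smul_apply, add_smul, smul_assoc]
    · rw [heisenberg_single_of_ne _ hm, heisenberg_single_of_ne _ hm,
        heisenberg_single_of_ne _ hm, Finsupp.smul_single, ← Finsupp.single_add,
        oscillator_linear]
  have h0 : heisenberg B ε 0 m = 0 := by
    have := h 0 0 1
    refine LinearMap.ext fun w => ?_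
    have := LinearMap.congr_fun this w
    rwa [one_smul, one_smul, add_zero, LinearMap.add_apply, left_eq_add] at this
  { toFun := fun u => heisenberg B ε u m
    map_add' := fun u v => by simpa only [one_smul] using h u v 1
    map_smul' := fun c v => by
      refine LinearMap.ext fun w => ?_
      have := LinearMap.congr_fun (h 0 v c) w
      rwa [zero_add, h0, LinearMap.add_apply, LinearMap.zero_apply, zero_add] at this }

theorem heisenbergMap_apply (u : ℂ ⊗[ℤ] L) (m : ℤ) :
    heisenbergMap B ε m u = heisenberg B ε u m := rfl

theorem heisenberg_zero_left (m : ℤ) : heisenberg B ε 0 m = 0 := map_zero (heisenbergMap B ε m)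

/-- The Heisenberg relations `[u(m), v(n)] = m ⟨u, v⟩ δ`. -/
theorem heisenberg_commutator (hB : B.IsSymm) (u v : ℂ ⊗[ℤ] L) (m n : ℤ) :
    heisenberg B ε u m * heisenberg B ε v n - heisenberg B ε v n * heisenberg B ε u m
      = (if m + n = 0 then (m : ℂ) * B.baseChange ℂ u v else 0) • 1 := by
  refine Finsupp.lhom_ext fun mu p => ?_
  rw [LinearMap.sub_apply, Module.End.mul_apply, Module.End.mul_apply, LinearMap.smul_apply,
    Module.End.one_apply]
  by_cases hm : m = 0
  · subst hm
    rw [Int.cast_zero, zero_mul, ite_self, zero_smul]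
    by_cases hn : n = 0
    · subst hn
      rw [heisenberg_zero_single, heisenberg_zero_single, map_smul, map_smul,
        heisenberg_zero_single, heisenberg_zero_single, smul_comm, sub_self]
    · rw [heisenberg_single_of_ne _ hn, heisenberg_zero_single, heisenberg_zero_single, map_smul,
        heisenberg_single_of_ne _ hn, sub_self]
  · by_cases hn : n = 0
    · subst hn
      rw [heisenberg_single_of_ne _ hm, heisenberg_zero_single, heisenberg_zero_single, map_smul,
        heisenberg_single_of_ne _ hm, sub_self, if_neg (by omega), zero_smul]
    · rw [heisenberg_single_of_ne _ hm, heisenberg_single_of_ne _ hn,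
        heisenberg_single_of_ne _ hm, heisenberg_single_of_ne _ hn, ← Finsupp.single_sub,
        oscillator_commutator hB, Finsupp.smul_single]

theorem exists_oscillator_eq_zero (hB : B.IsSymm) (u : ℂ ⊗[ℤ] L) (p : Fock r) :
    ∃ N : ℤ, ∀ n, N ≤ n → oscillator B ε u n p = 0 := by
  induction p using MvPolynomial.induction_on with
  | C a =>
    refine ⟨0, fun k hk => ?_⟩
    rw [← mul_one (C a), ← smul_eq_C_mul, map_smul, oscillator_one _ hk, smul_zero]
  | add p q hp hq =>
    obtain ⟨N, hN⟩ := hp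
    obtain ⟨N', hN'⟩ := hq
    refine ⟨max N N', fun k hk => ?_⟩
    rw [map_add, hN k ((le_max_left _ _).trans hk), hN' k ((le_max_right _ _).trans hk), add_zero]
  | mul_X p x hp =>
    obtain ⟨N, hN⟩ := hp
    refine ⟨max N (x.2 + 2), fun k hk => ?_⟩
    have h := oscillator_commutator (ε := ε) hB u (1 ⊗ₜ[ℤ] ε x.1) k (-x.2 - 1) p
    rw [if_neg (by have := (le_max_right _ _).trans hk; omega), hN k ((le_max_left _ _).trans hk),
      map_zero, sub_zero, zero_smul, oscillator_negSucc, creator_basis] at h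
    rw [mul_comm, h]

/-- The field `u(z)`. -/
def heisenbergField (B : LinearMap.BilinForm ℤ L) (hB : B.IsSymm) (ε : Module.Basis (Fin r) ℤ L)
    (u : ℂ ⊗[ℤ] L) : FormalField (LatticeSpace L r) where
  mode := heisenberg B ε u
  trunc w := by
    induction w using Finsupp.induction_linear with
    | zero => exact ⟨0, fun n _ => map_zero _⟩
    | add v w hv hw =>
      obtain ⟨N, hN⟩ := hv
      obtain ⟨N', hN'⟩ := hw
      refine ⟨max N N', fun k hk => ?_⟩
      rw [map_add, hN k ((le_max_left _ _).trans hk), hN' k ((le_max_right _ _).trans hk), add_zero]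
    | single mu p =>
      obtain ⟨N, hN⟩ := exists_oscillator_eq_zero (ε := ε) hB u p
      refine ⟨max N 1, fun k hk => ?_⟩
      rw [heisenberg_single_of_ne _ (by have := (le_max_right _ _).trans hk; omega),
        hN k ((le_max_left _ _).trans hk), Finsupp.single_zero]

theorem isLocal_heisenberg (hB : B.IsSymm) (u v : ℂ ⊗[ℤ] L) :
    IsLocal 1 (heisenbergField B hB ε u).mode (heisenbergField B hB ε v).mode :=
  IsLocal.of_central (heisenberg_commutator hB u v)

/-! ### Vacuum expectation values -/

/-- The coefficient of `1 ⊗ v_ν`. -/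
def vev (nu : L) : LatticeSpace L r →ₗ[ℂ] ℂ where
  toFun w := constantCoeff (w nu)
  map_add' v w := by rw [Finsupp.add_apply, map_add]
  map_smul' c w := by
    rw [Finsupp.smul_apply, smul_eq_C_mul, map_mul, constantCoeff_C]
    rfl

theorem vev_single {L : Type*} {r : ℕ} [DecidableEq L] (nu mu : L) (p : Fock r) :
    vev nu (Finsupp.single mu p) = if mu = nu then constantCoeff p else 0 := by
  change constantCoeff (Finsupp.single mu p nu) = _
  rw [Finsupp.single_apply]
  split_ifs
  · rfl
  · exact map_zero _

theorem vev_heisenberg_of_neg (u : ℂ ⊗[ℤ] L) {m : ℤ} (hm : m < 0) (nu : L)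
    (w : LatticeSpace L r) : vev nu (heisenberg B ε u m w) = 0 := by
  change constantCoeff (heisenberg B ε u m w nu) = 0
  rw [heisenberg_apply_of_ne _ hm.ne, constantCoeff_oscillator _ hm]

theorem heisenberg_single_one (u : ℂ ⊗[ℤ] L) {m : ℤ} (hm : 0 < m) (mu : L) :
    heisenberg B ε u m (Finsupp.single mu (1 : Fock r)) = 0 := by
  rw [heisenberg_single_of_ne _ hm.ne', oscillator_one _ hm.le, Finsupp.single_zero]

/-- The vector `eᵢ` of a dual basis acts through the partial derivatives. -/
theorem oscillator_dual {e : Fin r → ℂ ⊗[ℤ] L}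
    (he : ∀ i j, B.baseChange ℂ (e i) (1 ⊗ₜ[ℤ] ε j) = if i = j then 1 else 0) (i : Fin r) (k : ℕ)
    (p : Fock r) : oscillator B ε (e i) (k + 1) p = ((k : ℂ) + 1) • pderiv (i, k) p := by
  rw [oscillator_succ]
  have : annihilator B ε (e i) k = ((k : ℂ) + 1) • pderiv (i, k) := by
    refine derivation_ext fun x => ?_
    rw [annihilator, mkDerivation_X, Derivation.smul_apply, pderiv_X, he]
    rcases x with ⟨j, l⟩
    by_cases h : l = k
    · by_cases h' : i = j
      · simp [h, h', smul_eq_C_mul]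
      · simp [h, h', Ne.symm h']
    · simp [h]
  rw [this, Derivation.smul_apply]

/-- Uniqueness principle: a family of operators on `V_L` whose span is stable under commutators
with the Heisenberg operators is determined by the vacuum expectation values. Indeed the
annihilation operators reduce the coefficients of `X v_μ` to constant terms, and the creation
operators generate `V_L` from the vectors `v_μ`. -/
theorem eq_zero_of_vev {e : Fin r → ℂ ⊗[ℤ] L}
    (he : ∀ i j, B.baseChange ℂ (e i) (1 ⊗ₜ[ℤ] ε j) = if i = j then 1 else 0) {ι : Type*}
    {X : ι → Module.End ℂ (LatticeSpace L r)}
    (hX : ∀ u m i, heisenberg B ε u m * X i - X i * heisenberg B ε u m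
      ∈ Submodule.span ℂ (Set.range X))
    (hv : ∀ i mu nu, vev nu (X i (Finsupp.single mu 1)) = 0) (i : ι) : X i = 0 := by
  set S := Submodule.span ℂ (Set.range X) with hS
  have hX' : ∀ u m, ∀ Z ∈ S, heisenberg B ε u m * Z - Z * heisenberg B ε u m ∈ S :=
    fun u m Z hZ => commutator_mem_span (hX u m) hZ
  have hv' : ∀ mu nu, ∀ Z ∈ S, vev nu (Z (Finsupp.single mu 1)) = 0 := by
    intro mu nu Z hZ
    induction hZ using Submodule.span_induction with
    | mem x hx => obtain ⟨i, rfl⟩ := hx; exact hv i mu nu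
    | zero => exact map_zero _
    | add x y _ _ hx hy => rw [LinearMap.add_apply, map_add, hx, hy, add_zero]
    | smul c x _ hx => rw [LinearMap.smul_apply, map_smul, hx, smul_zero]
  -- Since `eᵢ(k+1)` annihilates `v_μ` and acts as `(k + 1) ∂ / ∂εᵢ(-k-1)`, a coefficient of `Z v_μ`
  -- of positive degree is a multiple of a coefficient of lower degree of `[eᵢ(k+1), Z] v_μ`.
  have hcoeff : ∀ (d : ℕ) (s : Fin r × ℕ →₀ ℕ), s.degree = d → ∀ mu nu, ∀ Z ∈ S,
      coeff s (Z (Finsupp.single mu 1) nu) = 0 := by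
    intro d
    induction d with
    | zero =>
      intro s hs mu nu Z hZ
      rw [(Finsupp.degree_eq_zero_iff s).1 hs]
      exact hv' mu nu Z hZ
    | succ d ih =>
      intro s hs mu nu Z hZ
      obtain ⟨⟨i, k⟩, hx⟩ : ∃ x, s x ≠ 0 := by
        by_contra h
        push Not at h
        rw [(Finsupp.ext h : s = 0), map_zero] at hs
        omega
      obtain ⟨t, rfl⟩ : ∃ t, s = t + Finsupp.single (i, k) 1 :=
        ⟨s - Finsupp.single (i, k) 1, (tsub_add_cancel_of_le
          (Finsupp.single_le_iff.2 (Nat.one_le_iff_ne_zero.2 hx))).symm⟩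
      have ht : t.degree = d := by
        rw [map_add, Finsupp.degree_single] at hs
        omega
      have h1 := ih t ht mu nu _ (hX' (e i) (k + 1) Z hZ)
      rw [LinearMap.sub_apply, Module.End.mul_apply, Module.End.mul_apply,
        heisenberg_single_one _ (by omega), map_zero, sub_zero,
        heisenberg_apply_of_ne _ (by omega), oscillator_dual he, coeff_smul, coeff_pderiv,
        smul_eq_mul] at h1
      have hk : (k : ℂ) + 1 ≠ 0 := by exact_mod_cast Nat.succ_ne_zero k
      have ht : (t (i, k) : ℂ) + 1 ≠ 0 := by exact_mod_cast Nat.succ_ne_zero (t (i, k))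
      simpa [hk, ht] using h1
  have hvac : ∀ mu, ∀ Z ∈ S, Z (Finsupp.single mu 1) = 0 := fun mu Z hZ =>
    Finsupp.ext fun nu => MvPolynomial.ext _ _ fun s => hcoeff _ s rfl mu nu Z hZ
  have hall : ∀ mu, ∀ p : Fock r, ∀ Z ∈ S, Z (Finsupp.single mu p) = 0 := by
    intro mu p
    induction p using MvPolynomial.induction_on with
    | C a =>
      intro Z hZ
      rw [← mul_one (C a), ← smul_eq_C_mul, ← Finsupp.smul_single, map_smul, hvac mu Z hZ,
        smul_zero]
    | add p q hp hq =>
      intro Z hZ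
      rw [Finsupp.single_add, map_add, hp Z hZ, hq Z hZ, add_zero]
    | mul_X p x hp =>
      intro Z hZ
      have h1 := hp _ (hX' (1 ⊗ₜ[ℤ] ε x.1) (-x.2 - 1) Z hZ)
      rw [LinearMap.sub_apply, Module.End.mul_apply, Module.End.mul_apply, hp Z hZ, map_zero,
        zero_sub, neg_eq_zero, heisenberg_single_of_ne _ (by omega), oscillator_negSucc,
        creator_basis] at h1
      rw [mul_comm, h1]
  exact Finsupp.lhom_ext fun mu p => hall mu p _ (Submodule.subset_span ⟨i, rfl⟩)

/-! ### The fields of the lattice points -/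

/-- The coefficient of `z ^ (-s)` in `E⁻(z) E⁺(z) q`. -/
def fockVertex (B : LinearMap.BilinForm ℤ L) (hB : B.IsSymm) (ε : Module.Basis (Fin r) ℤ L)
    (lam : L) (s : ℤ) : Module.End ℂ (Fock r) where
  toFun q := ∑ᶠ l : ℕ, expMinusInt B ε lam (l - s) (expPlusInt B ε lam l q)
  map_add' p q := by
    obtain ⟨N, hN⟩ := exists_expPlusInt_eq_zero (ε := ε) hB lam p
    obtain ⟨N', hN'⟩ := exists_expPlusInt_eq_zero (ε := ε) hB lam q
    have h := finsum_nat_eq_sum_range (K := (max N N').toNat)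
      (f := fun l : ℕ => expMinusInt B ε lam (l - s) (expPlusInt B ε lam l p)) fun k hk => by
        rw [hN k (by have := le_max_left N N'; omega), map_zero]
    have h' := finsum_nat_eq_sum_range (K := (max N N').toNat)
      (f := fun l : ℕ => expMinusInt B ε lam (l - s) (expPlusInt B ε lam l q)) fun k hk => by
        rw [hN' k (by have := le_max_right N N'; omega), map_zero]
    have h'' := finsum_nat_eq_sum_range (K := (max N N').toNat)
      (f := fun l : ℕ => expMinusInt B ε lam (l - s) (expPlusInt B ε lam l (p + q))) fun k hk => by
        rw [map_add, hN k (by have := le_max_left N N'; omega),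
          hN' k (by have := le_max_right N N'; omega), add_zero, map_zero]
    rw [h, h', h'', ← Finset.sum_add_distrib]
    simp only [map_add]
  map_smul' c p := by
    simp only [map_smul, RingHom.id_apply, smul_finsum]

theorem fockVertex_eventually_eq (hB : B.IsSymm) (lam : L) (s : ℤ) (q : Fock r) :
    ∀ᶠ K : ℕ in atTop, fockVertex B hB ε lam s q
      = ∑ l ∈ Finset.range K, expMinusInt B ε lam (l - s) (expPlusInt B ε lam l q) := by
  obtain ⟨N, hN⟩ := exists_expPlusInt_eq_zero (ε := ε) hB lam q
  filter_upwards [eventually_ge_atTop N.toNat] with K hK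
  exact finsum_nat_eq_sum_range fun k hk => by rw [hN k (by omega), map_zero]

theorem exists_fockVertex_eq_zero (hB : B.IsSymm) (lam : L) (q : Fock r) :
    ∃ N : ℤ, ∀ s, N ≤ s → fockVertex B hB ε lam s q = 0 := by
  obtain ⟨N, hN⟩ := exists_expPlusInt_eq_zero (ε := ε) hB lam q
  refine ⟨N, fun s hs => ?_⟩
  obtain ⟨K, hK⟩ := (fockVertex_eventually_eq (ε := ε) hB lam s q).exists
  rw [hK]
  refine Finset.sum_eq_zero fun l _ => ?_
  rcases lt_or_ge (l : ℤ) N with h | h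
  · rw [expMinusInt_of_neg _ (by omega), LinearMap.zero_apply]
  · rw [hN l h, map_zero]

theorem constantCoeff_fockVertex (hB : B.IsSymm) (lam : L) (s : ℤ) (q : Fock r) :
    constantCoeff (fockVertex B hB ε lam s q) = constantCoeff (expPlusInt B ε lam s q) := by
  obtain ⟨K, hK, hs⟩ := ((fockVertex_eventually_eq (ε := ε) hB lam s q).and
    (eventually_gt_atTop s.toNat)).exists
  rw [hK, map_sum]
  simp only [constantCoeff_expMinusInt hB]
  rcases lt_or_ge s 0 with h | h
  · rw [expPlusInt_of_neg _ h, LinearMap.zero_apply, map_zero]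
    exact Finset.sum_eq_zero fun l _ => if_neg (by omega)
  · lift s to ℕ using h
    rw [Finset.sum_eq_single s]
    · rw [if_pos (sub_self _)]
    · exact fun l _ hl => if_neg (by omega)
    · exact fun h => absurd (Finset.mem_range.2 hs) h

theorem fockVertex_one (hB : B.IsSymm) (lam : L) (s : ℤ) :
    fockVertex B hB ε lam s 1 = expMinusInt B ε lam (-s) 1 := by
  obtain ⟨K, hK, hs⟩ := ((fockVertex_eventually_eq (ε := ε) hB lam s 1).and
    (eventually_gt_atTop 0)).exists
  rw [hK, Finset.sum_eq_single 0]
  · rw [Nat.cast_zero, expPlusInt_zero, zero_sub]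
    rfl
  · intro l _ hl
    rw [expPlusInt_one hB, if_neg (by omega), map_zero]
  · exact fun h => absurd (Finset.mem_range.2 hs) h

theorem fockVertex_zero_lattice (hB : B.IsSymm) (s : ℤ) (q : Fock r) :
    fockVertex B hB ε 0 s q = if s = 0 then q else 0 := by
  obtain ⟨K, hK, hs⟩ := ((fockVertex_eventually_eq (ε := ε) hB 0 s q).and
    (eventually_gt_atTop 0)).exists
  rw [hK, Finset.sum_eq_single 0]
  · rw [Nat.cast_zero, expPlusInt_zero, zero_sub, (expInt_zero_lattice hB _).1]
    by_cases h : s = 0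
    · simp [h]
    · simp [h]
  · intro l _ hl
    rw [(expInt_zero_lattice hB l).2, if_neg (by omega), LinearMap.zero_apply, map_zero]
  · exact fun h => absurd (Finset.mem_range.2 hs) h

theorem oscillator_fockVertex (hB : B.IsSymm) (u : ℂ ⊗[ℤ] L) (lam : L) {n : ℤ} (hn : n ≠ 0)
    (s : ℤ) (q : Fock r) :
    oscillator B ε u n (fockVertex B hB ε lam s q)
      = fockVertex B hB ε lam s (oscillator B ε u n q)
        + B.baseChange ℂ u (1 ⊗ₜ[ℤ] lam) • fockVertex B hB ε lam (n + s) q := by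
  obtain ⟨N, hN⟩ := exists_expPlusInt_eq_zero (ε := ε) hB lam q
  obtain ⟨K, h₁, h₂, h₃, hK⟩ := ((fockVertex_eventually_eq (ε := ε) hB lam s q).and
    ((fockVertex_eventually_eq (ε := ε) hB lam s (oscillator B ε u n q)).and
    ((fockVertex_eventually_eq (ε := ε) hB lam (n + s) q).and
    (eventually_ge_atTop (N.toNat + n.natAbs))))).exists
  rw [h₁, h₂, h₃, map_sum, Finset.smul_sum, ← sub_eq_iff_eq_add', ← Finset.sum_sub_distrib]
  simp only [oscillator_expMinusInt hB, oscillator_expPlusInt hB]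
  rcases hn.lt_or_gt with hn | hn
  · simp only [if_pos hn, if_neg hn.not_gt, add_zero, map_add, map_smul, add_sub_cancel_left]
    obtain ⟨p, rfl⟩ : ∃ p : ℕ, n = -p := ⟨n.natAbs, by omega⟩
    obtain ⟨K, rfl⟩ : ∃ K', K = p + K' := ⟨K - p, by omega⟩
    rw [Finset.sum_range_add, Finset.sum_eq_zero, zero_add, add_comm p K, Finset.sum_range_add]
    · refine Eq.trans (add_zero _).symm (congrArg₂ (· + ·) (Finset.sum_congr rfl fun l _ => ?_)
        (Finset.sum_eq_zero fun l _ => ?_).symm)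
      · push_cast
        rw [show (p : ℤ) + l - s = l - (-p + s) by ring, show (p : ℤ) + l + -p = l by ring]
      · rw [hN _ (by omega), map_zero, smul_zero]
    · intro l hl
      rw [expPlusInt_of_neg _ (by have := Finset.mem_range.1 hl; omega), LinearMap.zero_apply,
        map_zero, smul_zero]
  · simp only [if_pos hn, if_neg hn.not_gt, add_zero, add_sub_cancel_left]
    refine Finset.sum_congr rfl fun l _ => ?_
    rw [show (l : ℤ) - s - n = l - (n + s) by ring]

theorem vertexModes_single (hB : B.IsSymm) (b : L →+ L →+ ZMod 2) (lam : L) (n : ℤ) (mu : L)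
    (q : Fock r) : vertexModes B b ε lam n (Finsupp.single mu q) = Finsupp.single (lam + mu)
      ((-1 : ℂ) ^ (b lam mu).val • fockVertex B hB ε lam (n + 1 + B lam mu) q) := by
  rw [vertexModes, Finsupp.sum_single_index]
  · congr 2
    refine finsum_congr fun l => ?_
    rw [show (l : ℤ) - (n + 1 + B lam mu) = l - n - 1 - B lam mu by ring, expMinusInt]
    have : expPlusInt B ε lam l = expPlus B ε lam l := by
      rw [expPlusInt, if_pos (by omega), Int.toNat_natCast]
    rw [this]
    split_ifs <;> rfl
  · simp

/-- The field `Y(v_λ, z)`. -/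
def vertexField (B : LinearMap.BilinForm ℤ L) (hB : B.IsSymm) (b : L →+ L →+ ZMod 2)
    (ε : Module.Basis (Fin r) ℤ L) (lam : L) : FormalField (LatticeSpace L r) where
  mode n := Finsupp.lsum ℂ fun mu => Finsupp.lsingle (lam + mu) ∘ₗ
    ((-1 : ℂ) ^ (b lam mu).val • fockVertex B hB ε lam (n + 1 + B lam mu))
  trunc w := by
    induction w using Finsupp.induction_linear with
    | zero => exact ⟨0, fun n _ => map_zero _⟩
    | add v w hv hw =>
      obtain ⟨N, hN⟩ := hv
      obtain ⟨N', hN'⟩ := hw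
      refine ⟨max N N', fun k hk => ?_⟩
      rw [map_add, hN k ((le_max_left _ _).trans hk), hN' k ((le_max_right _ _).trans hk), add_zero]
    | single mu p =>
      obtain ⟨N, hN⟩ := exists_fockVertex_eq_zero (ε := ε) hB lam p
      refine ⟨N - 1 - B lam mu, fun k hk => ?_⟩
      rw [Finsupp.lsum_single, LinearMap.comp_apply, LinearMap.smul_apply, hN _ (by omega),
        smul_zero, map_zero]

theorem vertexField_single (hB : B.IsSymm) (lam : L) (n : ℤ) (mu : L) (q : Fock r) :
    (vertexField B hB b ε lam).mode n (Finsupp.single mu q) = Finsupp.single (lam + mu)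
      ((-1 : ℂ) ^ (b lam mu).val • fockVertex B hB ε lam (n + 1 + B lam mu) q) := by
  rw [vertexField, Finsupp.lsum_single]
  rfl

theorem vertexField_apply (hB : B.IsSymm) (lam : L) (n : ℤ) (w : LatticeSpace L r) :
    (vertexField B hB b ε lam).mode n w = vertexModes B b ε lam n w := by
  conv_rhs => rw [vertexModes]
  conv_lhs => rw [← Finsupp.sum_single w, Finsupp.sum, map_sum]
  refine Finset.sum_congr rfl fun mu _ => ?_
  rw [vertexField_single, ← vertexModes_single hB, vertexModes, Finsupp.sum_single_index]
  simp

/-- `[u(m), Y(v_λ, z)] = ⟨u, λ⟩ z ^ m Y(v_λ, z)`. -/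
theorem heisenberg_vertexField (hB : B.IsSymm) (u : ℂ ⊗[ℤ] L) (lam : L) (m n : ℤ) :
    heisenberg B ε u m * (vertexField B hB b ε lam).mode n
        - (vertexField B hB b ε lam).mode n * heisenberg B ε u m
      = B.baseChange ℂ u (1 ⊗ₜ[ℤ] lam) • (vertexField B hB b ε lam).mode (m + n) := by
  refine Finsupp.lhom_ext fun mu q => ?_
  rw [LinearMap.sub_apply, Module.End.mul_apply, Module.End.mul_apply, LinearMap.smul_apply]
  by_cases hm : m = 0
  · subst hm
    rw [heisenberg_zero_single, map_smul, vertexField_single, heisenberg_zero_single, ← sub_smul,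
      TensorProduct.tmul_add, map_add, add_sub_cancel_right, zero_add, vertexField_single]
  · rw [heisenberg_single_of_ne _ hm, vertexField_single, vertexField_single, vertexField_single,
      heisenberg_single_of_ne _ hm, ← Finsupp.single_sub, map_smul, oscillator_fockVertex hB _ _ hm,
      smul_add, add_sub_cancel_left, smul_comm, Finsupp.smul_single]
    rw [← add_assoc, ← add_assoc]

/-! ### Locality of the fields of the lattice points -/

/-- The character `x ↦ (-1) ^ x` of `ℤ/2`. -/
def sgn (x : ZMod 2) : ℂ := (-1 : ℂ) ^ x.val

theorem sgn_add (x y : ZMod 2) : sgn (x + y) = sgn x * sgn y := by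
  rw [sgn, sgn, sgn, ZMod.val_add, ← pow_add, ← neg_one_pow_eq_pow_mod_two]

theorem sgn_mul_self (x : ZMod 2) : sgn x * sgn x = 1 := by
  rw [← sgn_add, CharTwo.add_self_eq_zero]
  simp [sgn]

theorem sgn_natCast (n : ℕ) : sgn (n : ZMod 2) = (-1 : ℂ) ^ n := by
  induction n with
  | zero => simp [sgn]
  | succ n ih =>
    rw [Nat.cast_succ, sgn_add, ih, pow_succ]
    simp [sgn, ZMod.val_one]

theorem sgn_mul (x y : ZMod 2) : sgn (x * y) = (-1 : ℂ) ^ (x.val * y.val) := by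
  rw [sgn, ZMod.val_mul, ← neg_one_pow_eq_pow_mod_two]

/-- The distribution `z ^ (-s) (1 - w / z) ^ a` up to powers of `z` and `w`. -/
def binomDist (a s d : ℤ) (m n : ℤ) : ℂ :=
  if m + n + s = 0 then binomCoeff a (-(n + d)) else 0

theorem zwMul_pow_binomDist (N : ℕ) (a s d : ℤ) :
    (zwMul ℂ ^ N) (binomDist a s d) = binomDist (a + N) (s + N) d := by
  induction N with
  | zero => simp
  | succ N ih =>
    ext m n
    rw [pow_succ', Module.End.mul_apply, ih, zwMul_apply]
    simp only [binomDist]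
    by_cases h : m + n + (s + (N + 1 : ℕ)) = 0
    · rw [if_pos h, if_pos (by push_cast at h; omega), if_pos (by push_cast at h; omega),
        show -(n + 1 + d) = -(n + d) - 1 by ring, binomCoeff_sub]
      push_cast
      rw [add_assoc]
    · rw [if_neg h, if_neg (by push_cast at h; omega), if_neg (by push_cast at h; omega), sub_zero]

theorem vev_vertexField_vertexField [DecidableEq L] (hB : B.IsSymm) (lam mu nu nu' : L)
    (m n : ℤ) :
    vev nu' ((vertexField B hB b ε lam).mode m ((vertexField B hB b ε mu).mode n
        (Finsupp.single nu 1)))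
      = if lam + (mu + nu) = nu' then sgn (b lam (mu + nu)) * sgn (b mu nu)
          * binomDist (B lam mu) (B lam mu + B lam nu + 1 + (1 + B mu nu)) (1 + B mu nu) m n
        else 0 := by
  rw [vertexField_single, vertexField_single, vev_single]
  refine if_congr Iff.rfl ?_ rfl
  rw [fockVertex_one, LinearMap.map_smul, smul_smul, smul_eq_C_mul, map_mul,
    constantCoeff_C, constantCoeff_fockVertex,
    constantCoeff_expPlusInt_expMinusInt hB, sgn, sgn, binomDist, add_assoc n]
  congr 1
  refine if_congr ?_ rfl rfl
  rw [map_add]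
  omega

/-- The vertex operators of `v_λ` and `v_μ` are mutually local: both products satisfy the same
commutation relations with the Heisenberg operators, so only the vacuum expectation values matter,
and these are expansions of `(z - w) ^ ⟨λ, μ⟩`, up to powers of `z` and `w`. -/
theorem isLocal_vertexField (hB : B.IsSymm) {e : Fin r → ℂ ⊗[ℤ] L}
    (he : ∀ i j, B.baseChange ℂ (e i) (1 ⊗ₜ[ℤ] ε j) = if i = j then 1 else 0)
    (hb : ∀ lam mu, b lam mu + b mu lam = ((B lam mu + B lam lam * B mu mu : ℤ) : ZMod 2))
    (lam mu : L) :
    IsLocal (sgn ((B lam lam : ZMod 2) * (B mu mu : ZMod 2)))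
      (vertexField B hB b ε lam).mode (vertexField B hB b ε mu).mode := by
  classical
  set σ := sgn ((B lam lam : ZMod 2) * (B mu mu : ZMod 2)) with hσ
  -- This power of `z - w` makes the exponent `c = ⟨λ, μ⟩ + N` non-negative, so that both expansions
  -- of `(z - w) ^ c` agree.
  set N := (B lam mu).natAbs with hN
  refine ⟨N, ?_⟩
  let X : ℤ × ℤ → Module.End ℂ (LatticeSpace L r) := fun p => (zwMul _ ^ N) (fun m n =>
    (vertexField B hB b ε lam).mode m * (vertexField B hB b ε mu).mode n
      - σ • ((vertexField B hB b ε mu).mode n * (vertexField B hB b ε lam).mode m)) p.1 p.2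
  have h0 : ∀ p, X p = 0 := by
    refine eq_zero_of_vev he (fun u k p => ?_) fun p nu nu' => ?_
    · have := commutator_zwMul_pow (heisenberg_vertexField (b := b) (ε := ε) hB u lam k)
        (heisenberg_vertexField (b := b) hB u mu k) σ N p.1 p.2
      refine (congrArg (· ∈ _) this).mpr (Submodule.add_mem _ (Submodule.smul_mem _ _
        (Submodule.subset_span ⟨(k + p.1, p.2), rfl⟩)) (Submodule.smul_mem _ _
        (Submodule.subset_span ⟨(p.1, k + p.2), rfl⟩)))
    · obtain ⟨c, hc⟩ : ∃ c : ℕ, B lam mu + N = c := ⟨(B lam mu + N).toNat, by omega⟩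
      have h := congrFun₂ (zwMul_pow_map (vev nu' ∘ₗ LinearMap.applyₗ (Finsupp.single nu 1)) N
        fun m n => (vertexField B hB b ε lam).mode m * (vertexField B hB b ε mu).mode n
          - σ • ((vertexField B hB b ε mu).mode n * (vertexField B hB b ε lam).mode m)) p.1 p.2
      refine h.symm.trans ?_
      have e₁ : (fun m n : ℤ => (vev nu' ∘ₗ LinearMap.applyₗ (Finsupp.single nu 1))
          ((vertexField B hB b ε lam).mode m * (vertexField B hB b ε mu).mode n
          - σ • ((vertexField B hB b ε mu).mode n * (vertexField B hB b ε lam).mode m)))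
          = fun m n : ℤ => vev nu' ((vertexField B hB b ε lam).mode m
              ((vertexField B hB b ε mu).mode n (Finsupp.single nu 1)))
            - σ * vev nu' ((vertexField B hB b ε mu).mode n
              ((vertexField B hB b ε lam).mode m (Finsupp.single nu 1))) := by
        ext m n
        change vev nu' (_ - σ • _) = _
        rw [map_sub, map_smul, smul_eq_mul]
        rfl
      have hsymm : B mu lam = B lam mu := hB.eq mu lam
      rw [e₁]
      simp only [vev_vertexField_vertexField]
      rw [add_left_comm mu lam nu]
      by_cases hnu : lam + (mu + nu) = nu'
      · simp only [if_pos hnu, hsymm]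
        have e₂ : (fun m n : ℤ => sgn (b lam (mu + nu)) * sgn (b mu nu)
              * binomDist (B lam mu) (B lam mu + B lam nu + 1 + (1 + B mu nu)) (1 + B mu nu) m n
            - σ * (sgn (b mu (lam + nu)) * sgn (b lam nu)
              * binomDist (B lam mu) (B lam mu + B mu nu + 1 + (1 + B lam nu)) (1 + B lam nu) n m))
            = (sgn (b lam (mu + nu)) * sgn (b mu nu)) •
                binomDist (B lam mu) (B lam mu + B lam nu + 1 + (1 + B mu nu)) (1 + B mu nu)
              - (σ * (sgn (b mu (lam + nu)) * sgn (b lam nu))) • fun m n =>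
                binomDist (B lam mu) (B lam mu + B mu nu + 1 + (1 + B lam nu)) (1 + B lam nu)
                  n m := by
          ext m n
          simp only [Pi.sub_apply, Pi.smul_apply, smul_eq_mul]
          ring
        rw [e₂, map_sub, map_smul, map_smul, zwMul_pow_swap N (binomDist (B lam mu)
            (B lam mu + B mu nu + 1 + (1 + B lam nu)) (1 + B lam nu)), zwMul_pow_binomDist,
          zwMul_pow_binomDist, hc]
        simp only [Pi.sub_apply, Pi.smul_apply, smul_eq_mul, binomDist, map_add, sgn_add]
        by_cases hp : p.1 + p.2 + (B lam mu + B lam nu + 1 + (1 + B mu nu) + N) = 0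
        · rw [if_pos hp, if_pos (by omega), binomCoeff_symm c,
            show (c : ℤ) - -(p.2 + (1 + B mu nu)) = -(p.1 + (1 + B lam nu)) by omega]
          -- The sign rule of the cocycle.
          have hs : sgn (b lam mu) * (-1) ^ c = σ * sgn (b mu lam) * (-1) ^ N := by
            have h₁ : (-1 : ℂ) ^ c = sgn (B lam mu : ZMod 2) * (-1) ^ N := by
              rw [← sgn_natCast, ← sgn_natCast, ← sgn_add]
              congr 1
              exact_mod_cast (congrArg (Int.cast : ℤ → ZMod 2) hc).symm
            have h₂ : sgn (b lam mu) * sgn (b mu lam) = sgn (B lam mu : ZMod 2) * σ := by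
              rw [hσ, ← sgn_add, ← sgn_add, hb]
              push_cast
              rfl
            have h₃ := sgn_mul_self (b mu lam)
            have h₄ := sgn_mul_self (B lam mu : ZMod 2)
            rw [h₁]
            linear_combination (-1 : ℂ) ^ N * (-sgn (b lam mu) * sgn (B lam mu : ZMod 2) * h₃
              + sgn (b mu lam) * sgn (B lam mu : ZMod 2) * h₂ + σ * sgn (b mu lam) * h₄)
          linear_combination sgn (b lam nu) * sgn (b mu nu)
            * binomCoeff c (-(p.1 + (1 + B lam nu))) * hs
        · rw [if_neg hp, if_neg (by omega)]
          ring
      · simp only [if_neg hnu, mul_zero, sub_zero]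
        exact congrFun₂ (map_zero (zwMul ℂ ^ N)) p.1 p.2
  ext1 m; ext1 n
  exact h0 (m, n)

/-- `u(z)` and `Y(v_λ, w)` are mutually local. -/
theorem isLocal_heisenberg_vertexField (hB : B.IsSymm) (u : ℂ ⊗[ℤ] L) (lam : L) :
    IsLocal 1 (heisenbergField B hB ε u).mode (vertexField B hB b ε lam).mode := by
  refine IsLocal.of_shift (c := B.baseChange ℂ u (1 ⊗ₜ[ℤ] lam)) fun m n => ?_
  exact heisenberg_vertexField hB u lam m n

/-! ### Translation covariance -/

/-- The derivation `εᵢ(-k-1) ↦ (k+1) εᵢ(-k-2)` of the symmetric algebra. -/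
def fockTranslation (r : ℕ) : Derivation ℂ (Fock r) (Fock r) :=
  mkDerivation ℂ fun x : Fin r × ℕ => ((x.2 : ℂ) + 1) • X (x.1, x.2 + 1)

/-- The translation operator of `V_L`: it extends `fockTranslation` and maps `v_μ` to
`μ(-1) v_μ`. -/
def translationOp (B : LinearMap.BilinForm ℤ L) (ε : Module.Basis (Fin r) ℤ L) :
    Module.End ℂ (LatticeSpace L r) :=
  Finsupp.lsum ℂ fun mu => Finsupp.lsingle mu ∘ₗ
    ((fockTranslation r).toLinearMap + oscillator B ε (1 ⊗ₜ[ℤ] mu) (-1))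

theorem translationOp_single (mu : L) (p : Fock r) :
    translationOp B ε (Finsupp.single mu p) = Finsupp.single mu
      (fockTranslation r p + oscillator B ε (1 ⊗ₜ[ℤ] mu) (-1) p) := by
  rw [translationOp, Finsupp.lsum_single]
  rfl

theorem fockTranslation_creator (u : ℂ ⊗[ℤ] L) (k : ℕ) :
    fockTranslation r (creator ε u k) = ((k : ℂ) + 1) • creator ε u (k + 1) := by
  have hX : ∀ i, fockTranslation r (X (i, k)) = ((k : ℂ) + 1) • X (i, k + 1) :=
    fun i => mkDerivation_X _ _ _
  simp only [creator, map_sum, Derivation.map_smul, hX, Finset.smul_sum]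
  exact Finset.sum_congr rfl fun i _ => smul_comm _ _ _

theorem fockTranslation_annihilator (u : ℂ ⊗[ℤ] L) (m : ℕ) (p : Fock r) :
    fockTranslation r (annihilator B ε u m p) - annihilator B ε u m (fockTranslation r p)
      = -((m : ℂ) + 1) • oscillator B ε u m p := by
  have hX : ∀ x, fockTranslation r (X x) = ((x.2 : ℂ) + 1) • X (x.1, x.2 + 1) :=
    fun i => mkDerivation_X _ _ _
  have hA : ∀ (n : ℕ) (x : Fin r × ℕ), annihilator B ε u n (X x)
      = if x.2 = n then C (((n : ℂ) + 1) * B.baseChange ℂ u (1 ⊗ₜ[ℤ] ε x.1)) else 0 :=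
    fun n i => mkDerivation_X _ _ _
  have hT : ∀ (n : ℕ) (x : Fin r × ℕ), fockTranslation r (annihilator B ε u n (X x)) = 0 := by
    intro n x
    rw [hA]
    split_ifs
    · exact derivation_C _ _
    · exact map_zero _
  rcases m with _ | m
  · have h : ⁅fockTranslation r, annihilator B ε u 0⁆ = 0 := by
      refine derivation_ext fun x => ?_
      rw [Derivation.commutator_apply, hX, Derivation.map_smul, hT, hA, if_neg (by simp)]
      simp
    have := congrArg (fun D : Derivation ℂ (Fock r) (Fock r) => D p) h
    simp only [Derivation.commutator_apply] at this
    rw [this, Nat.cast_zero, Nat.cast_zero, oscillator_zero]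
    simp
  · have h : ⁅fockTranslation r, annihilator B ε u (m + 1)⁆
        = -((m : ℂ) + 1 + 1) • annihilator B ε u m := by
      refine derivation_ext fun x => ?_
      rw [Derivation.commutator_apply, Derivation.smul_apply, hX, Derivation.map_smul, hT, hA, hA]
      by_cases hx : x.2 = m
      · rw [if_pos (by omega), if_pos hx, hx]
        simp only [smul_eq_C_mul, ← C_mul, zero_sub, ← C_neg]
        push_cast
        congr 1
        ring
      · rw [if_neg (by omega), if_neg hx]
        simp
    have := congrArg (fun D : Derivation ℂ (Fock r) (Fock r) => D p) h
    simp only [Derivation.commutator_apply, Derivation.smul_apply] at this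
    rw [this]
    push_cast
    rfl

theorem fockTranslation_oscillator_neg (u : ℂ ⊗[ℤ] L) (k : ℕ) (p : Fock r) :
    fockTranslation r (oscillator B ε u (-k - 1) p)
      - oscillator B ε u (-k - 1) (fockTranslation r p)
      = ((k : ℂ) + 1) • oscillator B ε u (-k - 1 - 1) p := by
  rw [oscillator_negSucc, oscillator_negSucc, Derivation.leibniz, fockTranslation_creator,
    show (-k - 1 - 1 : ℤ) = -(k + 1 : ℕ) - 1 by push_cast; ring, oscillator_negSucc,
    smul_eq_mul, smul_eq_mul, add_sub_cancel_left, mul_smul_comm, mul_comm p]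

/-- `[T, u(z)] = ∂ u(z)`. -/
theorem translationOp_heisenberg (hB : B.IsSymm) (u : ℂ ⊗[ℤ] L) (n : ℤ) :
    translationOp B ε * heisenberg B ε u n - heisenberg B ε u n * translationOp B ε
      = -(n : ℂ) • heisenberg B ε u (n - 1) := by
  refine Finsupp.lhom_ext fun mu p => ?_
  rw [LinearMap.sub_apply, Module.End.mul_apply, Module.End.mul_apply, LinearMap.smul_apply,
    translationOp_single]
  rcases lt_trichotomy n 0 with hn | rfl | hn
  · obtain ⟨k, rfl⟩ : ∃ k : ℕ, n = -k - 1 := ⟨(-n - 1).toNat, by omega⟩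
    have h₁ := fockTranslation_oscillator_neg (B := B) (ε := ε) u k p
    have h₂ := oscillator_commutator (ε := ε) hB (1 ⊗ₜ[ℤ] mu) u (-1) (-k - 1) p
    rw [if_neg (by omega), zero_smul] at h₂
    rw [heisenberg_single_of_ne _ (by omega), heisenberg_single_of_ne _ (by omega),
      heisenberg_single_of_ne _ (by omega), translationOp_single, ← Finsupp.single_sub,
      Finsupp.smul_single, map_add, add_sub_add_comm, h₁, h₂, add_zero]
    congr 2
    push_cast
    ring
  · rw [heisenberg_zero_single, heisenberg_zero_single, map_smul, translationOp_single, sub_self]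
    simp
  · obtain ⟨k, rfl⟩ : ∃ k : ℕ, n = k + 1 := ⟨(n - 1).toNat, by omega⟩
    have h₁ := fockTranslation_annihilator (B := B) (ε := ε) u k p
    have h₂ := oscillator_commutator (ε := ε) hB (1 ⊗ₜ[ℤ] mu) u (-1) (k + 1) p
    rw [heisenberg_single_of_ne _ (by omega), heisenberg_single_of_ne _ (by omega),
      translationOp_single, ← Finsupp.single_sub, map_add, add_sub_add_comm, h₂,
      oscillator_succ, oscillator_succ, h₁, add_sub_cancel_right]
    by_cases hk : k = 0
    · subst hk
      rw [Nat.cast_zero, Nat.cast_zero, heisenberg_zero_single, oscillator_zero,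
        if_pos (by norm_num), baseChange_comm hB, Finsupp.smul_single, Finsupp.smul_single]
      congr 1
      rw [LinearMap.zero_apply, smul_zero, zero_add, smul_smul]
      congr 1
      push_cast
      ring
    · rw [if_neg (by omega), zero_smul, add_zero, heisenberg_single_of_ne _ (by omega),
        Finsupp.smul_single]
      push_cast
      rfl

theorem constantCoeff_fockTranslation (p : Fock r) : constantCoeff (fockTranslation r p) = 0 := by
  induction p using MvPolynomial.induction_on with
  | C a => rw [fockTranslation, derivation_C, map_zero]
  | add p q hp hq => rw [map_add, map_add, hp, hq, add_zero]
  | mul_X p x hp =>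
    have hX : fockTranslation r (X x) = ((x.2 : ℂ) + 1) • X (x.1, x.2 + 1) := mkDerivation_X _ _ _
    rw [Derivation.leibniz, hX, smul_eq_mul, smul_eq_mul, smul_eq_C_mul, map_add, map_mul, map_mul,
      map_mul, hp, constantCoeff_X, constantCoeff_X]
    ring

theorem vev_translationOp (nu : L) (w : LatticeSpace L r) :
    vev nu (translationOp B ε w) = 0 := by
  classical
  induction w using Finsupp.induction_linear with
  | zero => rw [map_zero, map_zero]
  | add v w hv hw => rw [map_add, map_add, hv, hw, add_zero]
  | single mu p =>
    rw [translationOp_single, vev_single, map_add, constantCoeff_fockTranslation,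
      constantCoeff_oscillator _ (by omega), add_zero, ite_self]

theorem translationOp_single_one (mu : L) :
    translationOp B ε (Finsupp.single mu (1 : Fock r))
      = heisenberg B ε (1 ⊗ₜ[ℤ] mu) (-1) (Finsupp.single mu 1) := by
  rw [translationOp_single, heisenberg_single_of_ne _ (by omega), Derivation.map_one_eq_zero,
    zero_add]

theorem vev_vertexField [DecidableEq L] (hB : B.IsSymm) (lam mu nu : L) (n : ℤ) :
    vev nu ((vertexField B hB b ε lam).mode n (Finsupp.single mu 1))
      = if lam + mu = nu then sgn (b lam mu) * (if n + 1 + B lam mu = 0 then 1 else 0) else 0 := by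
  rw [vertexField_single, vev_single, smul_eq_C_mul, map_mul, constantCoeff_C,
    constantCoeff_fockVertex, expPlusInt_one hB, sgn]
  split_ifs <;> simp

/-- `[T, Y(v_λ, z)] = ∂ Y(v_λ, z)`. -/
theorem translationOp_vertexField (hB : B.IsSymm) {e : Fin r → ℂ ⊗[ℤ] L}
    (he : ∀ i j, B.baseChange ℂ (e i) (1 ⊗ₜ[ℤ] ε j) = if i = j then 1 else 0) (lam : L) (n : ℤ) :
    translationOp B ε * (vertexField B hB b ε lam).mode n
        - (vertexField B hB b ε lam).mode n * translationOp B ε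
      = -(n : ℂ) • (vertexField B hB b ε lam).mode (n - 1) := by
  classical
  let X : ℤ → Module.End ℂ (LatticeSpace L r) := fun n =>
    translationOp B ε * (vertexField B hB b ε lam).mode n
        - (vertexField B hB b ε lam).mode n * translationOp B ε
      + (n : ℂ) • (vertexField B hB b ε lam).mode (n - 1)
  have h0 : X n = 0 := by
    refine eq_zero_of_vev he (fun u k n => ?_) (fun n mu nu => ?_) n
    · have := commutator_covariance_defect (translationOp_heisenberg (ε := ε) hB u)
        (heisenberg_vertexField (b := b) (ε := ε) hB u lam) k n
      exact (congrArg (· ∈ _) this).mpr (Submodule.smul_mem _ _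
        (Submodule.subset_span ⟨k + n, rfl⟩))
    · change vev nu (translationOp B ε ((vertexField B hB b ε lam).mode n (Finsupp.single mu 1))
        - (vertexField B hB b ε lam).mode n (translationOp B ε (Finsupp.single mu 1))
        + (n : ℂ) • (vertexField B hB b ε lam).mode (n - 1) (Finsupp.single mu 1)) = 0
      -- As `T v_μ = μ(-1) v_μ`, and `μ(-1)` on the left does not contribute, only the commutator
      -- with `μ(-1)` remains.
      have h := LinearMap.congr_fun
        (heisenberg_vertexField (b := b) (ε := ε) hB (1 ⊗ₜ[ℤ] mu) lam (-1) n)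
        (Finsupp.single mu 1)
      rw [LinearMap.sub_apply, Module.End.mul_apply, Module.End.mul_apply, LinearMap.smul_apply,
        baseChange_one_tmul, show -1 + n = n - 1 by ring] at h
      rw [map_add, map_sub, vev_translationOp, translationOp_single_one, ← sub_eq_iff_eq_add'.2
        (sub_eq_iff_eq_add.1 h), map_sub, vev_heisenberg_of_neg _ (by omega), map_smul, map_smul,
        vev_vertexField, smul_eq_mul, smul_eq_mul, hB.eq mu lam]
      by_cases h1 : n - 1 + 1 + B lam mu = 0
      · have : (n : ℂ) + B lam mu = 0 := by
          exact_mod_cast (show n + B lam mu = 0 by omega)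
        linear_combination (if lam + mu = nu then sgn (b lam mu)
          * (if n - 1 + 1 + B lam mu = 0 then 1 else 0) else 0) * this
      · rw [if_neg h1]
        simp
  exact (eq_neg_of_add_eq_zero_left h0).trans (neg_smul _ _).symm

/-! ### The Kummer involution -/

theorem theta_single (mu : L) (p : Fock r) :
    theta (Finsupp.single mu p)
      = Finsupp.single (-mu) (aeval (fun x : Fin r × ℕ => -(X x : Fock r)) p) := by
  refine (congrArg (Finsupp.mapDomain _) (Finsupp.mapRange_single (hf := map_zero
    (aeval fun x : Fin r × ℕ => -(X x : Fock r)).toLinearMap))).trans ?_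
  exact Finsupp.mapDomain_single

theorem theta_theta (w : LatticeSpace L r) : theta (theta w) = w := by
  induction w using Finsupp.induction_linear with
  | zero => rw [map_zero, map_zero]
  | add v w hv hw => rw [map_add, map_add, hv, hw]
  | single mu p =>
    rw [theta_single, theta_single, neg_neg]
    congr 1
    change ((aeval fun x : Fin r × ℕ => -(X x : Fock r)).comp (aeval fun x => -X x)) p
      = AlgHom.id ℂ _ p
    congr 1
    ext x
    simp

theorem vev_theta (nu : L) (w : LatticeSpace L r) : vev nu (theta w) = vev (-nu) w := by
  classical
  induction w using Finsupp.induction_linear with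
  | zero => simp only [map_zero]
  | add v w hv hw => simp only [map_add, hv, hw]
  | single mu p =>
    rw [theta_single, vev_single, vev_single]
    refine if_congr neg_eq_iff_eq_neg ?_ rfl
    induction p using MvPolynomial.induction_on with
    | C a => simp
    | add p q hp hq => simp only [map_add, hp, hq]
    | mul_X p x hp => simp

/-- `θ u(m) = - u(m) θ`. -/
theorem theta_heisenberg (u : ℂ ⊗[ℤ] L) (m : ℤ) (w : LatticeSpace L r) :
    theta (heisenberg B ε u m w) = (-1 : ℂ) • heisenberg B ε u m (theta w) := by
  induction w using Finsupp.induction_linear with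
  | zero => simp only [map_zero, smul_zero]
  | add v w hv hw => simp only [map_add, hv, hw, smul_add]
  | single mu p =>
    rcases lt_trichotomy m 0 with hm | rfl | hm
    · obtain ⟨k, rfl⟩ : ∃ k : ℕ, m = -k - 1 := ⟨(-m - 1).toNat, by omega⟩
      rw [heisenberg_single_of_ne _ hm.ne, theta_single, theta_single,
        heisenberg_single_of_ne _ hm.ne, Finsupp.smul_single, oscillator_negSucc,
        oscillator_negSucc, map_mul, neg_one_smul, ← neg_mul]
      congr 2
      simp [creator]
    · rw [heisenberg_zero_single, map_smul, theta_single, heisenberg_zero_single, smul_smul]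
      congr 1
      rw [TensorProduct.tmul_neg, map_neg]
      ring
    · obtain ⟨k, rfl⟩ : ∃ k : ℕ, m = k + 1 := ⟨(m - 1).toNat, by omega⟩
      rw [heisenberg_single_of_ne _ hm.ne', theta_single, theta_single,
        heisenberg_single_of_ne _ hm.ne', Finsupp.smul_single, oscillator_succ, oscillator_succ]
      congr 1
      induction p using MvPolynomial.induction_on with
      | C a =>
        simp only [annihilator, aeval_C, derivation_C]
        rw [algebraMap_eq, derivation_C, map_zero, smul_zero]
      | add p q hp hq => simp only [map_add, hp, hq, smul_add]
      | mul_X p x hp =>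
        have hA : annihilator B ε u k (X x)
            = if x.2 = k then C (((k : ℂ) + 1) * B.baseChange ℂ u (1 ⊗ₜ[ℤ] ε x.1)) else 0 :=
          mkDerivation_X _ _ _
        have hA' : aeval (fun x : Fin r × ℕ => -(X x : Fock r)) (annihilator B ε u k (X x))
            = annihilator B ε u k (X x) := by
          rw [hA]
          split_ifs <;> simp
        rw [map_mul (aeval _) p (X x), aeval_X, Derivation.leibniz, Derivation.leibniz, map_add,
          smul_eq_mul, smul_eq_mul, smul_eq_mul, smul_eq_mul, map_mul, map_mul, hp, hA', aeval_X,
          map_neg]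
        simp only [smul_eq_C_mul, C_neg, C_1]
        ring

/-- `θ Y(v_λ, z) = Y(v_{-λ}, z) θ`. -/
theorem theta_vertexField (hB : B.IsSymm) {e : Fin r → ℂ ⊗[ℤ] L}
    (he : ∀ i j, B.baseChange ℂ (e i) (1 ⊗ₜ[ℤ] ε j) = if i = j then 1 else 0) (lam : L) (n : ℤ)
    (w : LatticeSpace L r) : theta ((vertexField B hB b ε lam).mode n w)
      = (vertexField B hB b ε (-lam)).mode n (theta w) := by
  classical
  let X : ℤ → Module.End ℂ (LatticeSpace L r) := fun n =>
    theta * (vertexField B hB b ε lam).mode n * theta - (vertexField B hB b ε (-lam)).mode n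
  have h0 : X n = 0 := by
    refine eq_zero_of_vev he (fun u k n => ?_) (fun n mu nu => ?_) n
    · have h : heisenberg B ε u k * X n - X n * heisenberg B ε u k
          = B.baseChange ℂ u (1 ⊗ₜ[ℤ] (-lam)) • X (k + n) := by
        refine LinearMap.ext fun w => ?_
        have h₁ := LinearMap.congr_fun
          (heisenberg_vertexField (b := b) (ε := ε) hB u lam k n) (theta w)
        have h₂ := LinearMap.congr_fun
          (heisenberg_vertexField (b := b) (ε := ε) hB u (-lam) k n) w
        have h₃ := congrArg theta h₁
        have h₄ : heisenberg B ε u k (theta ((vertexField B hB b ε lam).mode n (theta w)))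
            = (-1 : ℂ) • theta (heisenberg B ε u k
              ((vertexField B hB b ε lam).mode n (theta w))) := by
          rw [theta_heisenberg, smul_smul]
          norm_num
        have h₅ : theta (heisenberg B ε u k w) = (-1 : ℂ) • heisenberg B ε u k (theta w) :=
          theta_heisenberg u k w
        simp only [LinearMap.sub_apply, Module.End.mul_apply, LinearMap.smul_apply, map_sub,
          map_smul, X] at h₂ h₃ ⊢
        rw [h₄, h₅, map_smul, map_smul, smul_sub, ← h₂, sub_sub_sub_comm, ← smul_sub, h₃,
          TensorProduct.tmul_neg, map_neg]
        module
      exact (congrArg (· ∈ _) h).mpr (Submodule.smul_mem _ _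
        (Submodule.subset_span ⟨k + n, rfl⟩))
    · change vev nu (theta ((vertexField B hB b ε lam).mode n (theta (Finsupp.single mu 1)))
        - (vertexField B hB b ε (-lam)).mode n (Finsupp.single mu 1)) = 0
      rw [map_sub, vev_theta, theta_single, map_one, vev_vertexField, vev_vertexField, sub_eq_zero]
      have e₁ : B lam (-mu) = B (-lam) mu := by simp
      have e₂ : b lam (-mu) = b (-lam) mu := by simp
      rw [e₁, e₂]
      exact if_congr (by rw [← neg_inj, neg_add, neg_neg, neg_neg]) rfl rfl
  have h := LinearMap.congr_fun h0 (theta w)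
  change theta ((vertexField B hB b ε lam).mode n (theta (theta w)))
    - (vertexField B hB b ε (-lam)).mode n (theta w) = 0 at h
  rwa [theta_theta, sub_eq_zero] at h

end Lattice

/-! ### The vertex algebra of the lattice -/

/-- `:A(z) B(z): v` has no poles if `A(z) v` and `B(z) v` have none, and its constant term is
`A₍₋₁₎ B₍₋₁₎ v`. -/
theorem FormalField.nord_apply_of_annihilated {V : Type*} [AddCommGroup V] [Module ℂ V]
    (A B : FormalField V) {v : V} (hA : ∀ k : ℤ, 0 ≤ k → A.mode k v = 0)
    (hB : ∀ k : ℤ, 0 ≤ k → B.mode k v = 0) :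
    (A.nord B).mode (-1) v = A.mode (-1) (B.mode (-1) v) ∧
      ∀ n, 0 ≤ n → (A.nord B).mode n v = 0 := by
  constructor
  · obtain ⟨K, hK, h0⟩ := ((A.nord_eventually_eq B (-1) v).and (eventually_gt_atTop 0)).exists
    rw [hK, nordSum, Finset.sum_eq_single 0, Finset.sum_eq_zero, add_zero]
    · simp
    · intro k _
      rw [hA k (by omega), map_zero]
    · intro k _ hk
      rw [hB _ (by omega), map_zero]
    · exact fun h => absurd (Finset.mem_range.2 h0) h
  · intro n hn
    obtain ⟨K, hK⟩ := (A.nord_eventually_eq B n v).exists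
    rw [hK, nordSum, Finset.sum_eq_zero, Finset.sum_eq_zero, add_zero]
    · intro k _
      rw [hA k (by omega), map_zero]
    · intro k _
      rw [hB _ (by omega), map_zero]

section Lattice

variable {L : Type*} [AddCommGroup L] {r : ℕ} {B : LinearMap.BilinForm ℤ L}
  {ε : Module.Basis (Fin r) ℤ L} {b : L →+ L →+ ZMod 2}

open MvPolynomial

/-- The iterated normally ordered product
`: ∂^{k₁} ε_{i₁}(z) / k₁! ⋯ ∂^{kₛ} ε_{iₛ}(z) / kₛ! Y(v_λ, z) :`. -/
def monomialField (B : LinearMap.BilinForm ℤ L) (hB : B.IsSymm) (b : L →+ L →+ ZMod 2)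
    (ε : Module.Basis (Fin r) ℤ L) (lam : L) : List (Fin r × ℕ) → FormalField (LatticeSpace L r)
  | [] => vertexField B hB b ε lam
  | (i, k) :: xs =>
    ((heisenbergField B hB ε (1 ⊗ₜ[ℤ] ε i)).deriv k).nord (monomialField B hB b ε lam xs)

theorem monomialField_apply (hB : B.IsSymm) (lam : L) (xs : List (Fin r × ℕ)) (n : ℤ)
    (w : LatticeSpace L r) :
    (monomialField B hB b ε lam xs).mode n w = monomialModes B b ε lam xs n w := by
  induction xs generalizing n w with
  | nil => exact vertexField_apply hB lam n w
  | cons x xs ih =>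
    have h : (fun n v => (monomialField B hB b ε lam xs).mode n v) = monomialModes B b ε lam xs :=
      funext₂ ih
    rw [monomialField, FormalField.nord_apply, h, monomialModes]
    rfl

theorem isLocal_heisenberg_deriv (hB : B.IsSymm) (u v : ℂ ⊗[ℤ] L) (k l : ℕ) :
    IsLocal 1 ((heisenbergField B hB ε u).deriv k).mode
      ((heisenbergField B hB ε v).deriv l).mode :=
  ((((isLocal_heisenberg hB u v).deriv k).symm (one_mul 1)).deriv l).symm (one_mul 1)

theorem isLocal_heisenberg_monomialField (hB : B.IsSymm) (u : ℂ ⊗[ℤ] L) (k : ℕ) (lam : L)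
    (xs : List (Fin r × ℕ)) :
    IsLocal 1 ((heisenbergField B hB ε u).deriv k).mode (monomialField B hB b ε lam xs).mode := by
  induction xs generalizing u k with
  | nil => exact (isLocal_heisenberg_vertexField hB u lam).deriv k
  | cons x xs ih =>
    exact (IsLocal.nord (ih _ _) (isLocal_heisenberg_deriv hB _ u _ k)
      ((ih u k).symm (one_mul 1))).symm (one_mul 1)

/-- The fields of `V_L` are mutually local. -/
theorem isLocal_monomialField (hB : B.IsSymm) {e : Fin r → ℂ ⊗[ℤ] L}
    (he : ∀ i j, B.baseChange ℂ (e i) (1 ⊗ₜ[ℤ] ε j) = if i = j then 1 else 0)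
    (hb : ∀ lam mu, b lam mu + b mu lam = ((B lam mu + B lam lam * B mu mu : ℤ) : ZMod 2))
    (lam mu : L) (xs ys : List (Fin r × ℕ)) :
    IsLocal (sgn ((B lam lam : ZMod 2) * (B mu mu : ZMod 2)))
      (monomialField B hB b ε lam xs).mode (monomialField B hB b ε mu ys).mode := by
  induction xs with
  | nil =>
    induction ys with
    | nil => exact isLocal_vertexField hB he hb lam mu
    | cons y ys ih =>
      exact (IsLocal.nord (isLocal_heisenberg_monomialField hB _ _ mu ys)
        ((isLocal_heisenberg_vertexField hB _ lam).deriv _) (ih.symm (sgn_mul_self _))).symm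
        (sgn_mul_self _)
  | cons x xs ih =>
    exact IsLocal.nord (isLocal_heisenberg_monomialField hB _ _ lam xs)
      (isLocal_heisenberg_monomialField hB _ _ mu ys) ih

theorem translationOp_monomialField (hB : B.IsSymm) {e : Fin r → ℂ ⊗[ℤ] L}
    (he : ∀ i j, B.baseChange ℂ (e i) (1 ⊗ₜ[ℤ] ε j) = if i = j then 1 else 0) (lam : L)
    (xs : List (Fin r × ℕ)) (n : ℤ) :
    translationOp B ε * (monomialField B hB b ε lam xs).mode n
        - (monomialField B hB b ε lam xs).mode n * translationOp B ε
      = -(n : ℂ) • (monomialField B hB b ε lam xs).mode (n - 1) := by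
  induction xs generalizing n with
  | nil => exact translationOp_vertexField hB he lam n
  | cons x xs ih =>
    exact FormalField.nord_covariant
      (FormalField.deriv_covariant (A := heisenbergField B hB ε (1 ⊗ₜ[ℤ] ε x.1))
        (translationOp_heisenberg hB _) x.2) ih n

theorem deriv_heisenberg_apply (hB : B.IsSymm) (u : ℂ ⊗[ℤ] L) (k : ℕ) (n : ℤ)
    (w : LatticeSpace L r) : ((heisenbergField B hB ε u).deriv k).mode n w
      = ((-1 : ℂ) ^ k * (Ring.choose n k : ℤ)) • heisenberg B ε u (n - k) w := rfl

theorem theta_monomialField (hB : B.IsSymm) {e : Fin r → ℂ ⊗[ℤ] L}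
    (he : ∀ i j, B.baseChange ℂ (e i) (1 ⊗ₜ[ℤ] ε j) = if i = j then 1 else 0) (lam : L)
    (xs : List (Fin r × ℕ)) (n : ℤ) (w : LatticeSpace L r) :
    theta ((monomialField B hB b ε lam xs).mode n w)
      = (-1 : ℂ) ^ xs.length • (monomialField B hB b ε (-lam) xs).mode n (theta w) := by
  induction xs generalizing n w with
  | nil =>
    rw [List.length_nil, pow_zero, one_smul]
    exact theta_vertexField hB he lam n w
  | cons x xs ih =>
    rw [List.length_cons, pow_succ']
    refine FormalField.nord_intertwine theta (fun n v => ?_) ih n w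
    rw [deriv_heisenberg_apply, deriv_heisenberg_apply, map_smul, theta_heisenberg, smul_comm]

theorem heisenberg_vacuum (u : ℂ ⊗[ℤ] L) {m : ℤ} (hm : 0 ≤ m) :
    heisenberg B ε u m (Finsupp.single 0 (1 : Fock r)) = 0 := by
  rcases hm.eq_or_lt with rfl | hm
  · rw [heisenberg_zero_single, TensorProduct.tmul_zero, map_zero, zero_smul]
  · exact heisenberg_single_one u hm 0

theorem deriv_heisenberg_vacuum (hB : B.IsSymm) (u : ℂ ⊗[ℤ] L) (k : ℕ) {m : ℤ} (hm : 0 ≤ m) :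
    ((heisenbergField B hB ε u).deriv k).mode m (Finsupp.single 0 1) = 0 := by
  rw [deriv_heisenberg_apply]
  rcases le_or_gt (k : ℤ) m with h | h
  · rw [heisenberg_vacuum u (by omega), smul_zero]
  · obtain ⟨n, rfl⟩ := Int.eq_ofNat_of_zero_le hm
    rw [Ring.choose_natCast, Nat.choose_eq_zero_of_lt (by omega)]
    simp

theorem deriv_mode_neg_one {V : Type*} [AddCommGroup V] [Module ℂ V] (A : FormalField V) (k : ℕ) :
    (A.deriv k).mode (-1) = A.mode (-k - 1) := by
  have h : Ring.choose (-1 : ℤ) k = (-1) ^ k := by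
    rw [Ring.choose_neg, add_sub_cancel_left, Ring.choose_natCast, Nat.choose_self,
      Int.negOnePow_def]
    simp [Units.smul_def]
  change ((-1 : ℂ) ^ k * (Ring.choose (-1 : ℤ) k : ℤ)) • A.mode (-1 - k) = _
  rw [h, show (-1 - k : ℤ) = -k - 1 by ring]
  push_cast
  rw [← mul_pow, neg_one_mul, neg_neg, one_pow, one_smul]

/-- `Y(a, z) v₀` lies in `a + z V_L[[z]]`, for a monomial `a`. -/
theorem monomialField_vacuum (hB : B.IsSymm) (lam : L) (xs : List (Fin r × ℕ)) :
    (monomialField B hB b ε lam xs).mode (-1) (Finsupp.single 0 1)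
        = Finsupp.single lam (xs.map X).prod ∧
      ∀ n, 0 ≤ n → (monomialField B hB b ε lam xs).mode n (Finsupp.single 0 1) = 0 := by
  induction xs with
  | nil =>
    have h : ∀ n, (vertexField B hB b ε lam).mode n (Finsupp.single 0 1)
        = Finsupp.single lam (expMinusInt B ε lam (-(n + 1)) 1) := fun n => by
      rw [vertexField_single, fockVertex_one, add_zero, map_zero, map_zero, ZMod.val_zero,
        pow_zero, one_smul, add_zero]
    refine ⟨(h _).trans ?_, fun n hn => (h n).trans ?_⟩
    · rw [neg_add_cancel, neg_zero, expMinusInt_zero]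
      rfl
    · rw [expMinusInt_of_neg _ (by omega)]
      exact Finsupp.single_zero _
  | cons x xs ih =>
    have h := FormalField.nord_apply_of_annihilated
      ((heisenbergField B hB ε (1 ⊗ₜ[ℤ] ε x.1)).deriv x.2) (monomialField B hB b ε lam xs)
      (fun k hk => deriv_heisenberg_vacuum hB _ _ hk) ih.2
    refine ⟨h.1.trans ?_, h.2⟩
    rw [ih.1, deriv_mode_neg_one, heisenbergField, heisenberg_single_of_ne _ (by omega),
      oscillator_negSucc, creator_basis]
    rfl

theorem monomial_eq_prod_toList (s : Fin r × ℕ →₀ ℕ) :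
    (monomial s 1 : Fock r) = ((Finsupp.toMultiset s).toList.map X).prod := by
  rw [← Multiset.prod_coe, ← Multiset.map_coe, Multiset.coe_toList, Finsupp.toMultiset_map,
    Finsupp.prod_toMultiset, Finsupp.prod_mapDomain_index (fun _ => pow_zero _)
    (fun _ _ _ => pow_add _ _ _), monomial_eq, C_1, one_mul]

/-- A property of vectors of `V_K` which is stable under linear combinations can be checked on the
monomials. -/
theorem induction_monomial {L : Type*} {r : ℕ} {K : Set L} {P : LatticeSpace L r → Prop} (h0 : P 0)
    (hadd : ∀ v w, P v → P w → P (v + w)) (hsmul : ∀ (c : ℂ) v, P v → P (c • v))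
    (hmono : ∀ lam ∈ K, ∀ s, P (Finsupp.single lam (monomial s 1))) {a : LatticeSpace L r}
    (ha : a ∈ subspaceOn K) : P a := by
  rw [← Finsupp.sum_single a]
  refine Finset.sum_induction _ P hadd h0 fun lam hlam => ?_
  generalize a lam = p
  induction p using MvPolynomial.induction_on' with
  | add p q hp hq => rw [Finsupp.single_add]; exact hadd _ _ hp hq
  | monomial s c =>
    have h := hsmul c _ (hmono lam (ha hlam) s)
    rwa [Finsupp.smul_single, smul_monomial, smul_eq_mul, mul_one] at h

/-- The mode `a₍ₙ₎` of a vector `a` of `V_L`, as a linear operator. -/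
def latticeMode (B : LinearMap.BilinForm ℤ L) (hB : B.IsSymm) (b : L →+ L →+ ZMod 2)
    (ε : Module.Basis (Fin r) ℤ L) (n : ℤ) :
    LatticeSpace L r →ₗ[ℂ] Module.End ℂ (LatticeSpace L r) :=
  Finsupp.lsum ℂ fun lam => (basisMonomials (Fin r × ℕ) ℂ).constr ℂ fun s =>
    (monomialField B hB b ε lam (Finsupp.toMultiset s).toList).mode n

theorem latticeMode_monomial (hB : B.IsSymm) (n : ℤ) (lam : L) (s : Fin r × ℕ →₀ ℕ) :
    latticeMode B hB b ε n (Finsupp.single lam (monomial s 1))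
      = (monomialField B hB b ε lam (Finsupp.toMultiset s).toList).mode n := by
  rw [latticeMode, Finsupp.lsum_single, ← congrFun (coe_basisMonomials _ _) s,
    Module.Basis.constr_basis]

theorem latticeMode_apply (hB : B.IsSymm) (a : LatticeSpace L r) (n : ℤ) (w : LatticeSpace L r) :
    latticeMode B hB b ε n a w = latticeY B b ε a n w := by
  conv_lhs => rw [← Finsupp.sum_single a, Finsupp.sum, map_sum, LinearMap.sum_apply]
  refine Finset.sum_congr rfl fun lam _ => ?_
  conv_lhs => rw [← support_sum_monomial_coeff (a lam), Finsupp.single_finsetSum, map_sum,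
    LinearMap.sum_apply]
  refine Finset.sum_congr rfl fun s _ => ?_
  rw [← monomialField_apply hB, ← latticeMode_monomial, ← LinearMap.smul_apply, ← map_smul,
    Finsupp.smul_single, smul_monomial, smul_eq_mul, mul_one]

theorem latticeMode_trunc (hB : B.IsSymm) (a w : LatticeSpace L r) :
    ∃ N : ℤ, ∀ n, N ≤ n → latticeMode B hB b ε n a w = 0 := by
  have ha : a ∈ subspaceOn (r := r) (Set.univ : Set L) := Set.subset_univ _
  refine induction_monomial
    (P := fun a => ∃ N : ℤ, ∀ n, N ≤ n → latticeMode B hB b ε n a w = 0)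
    ⟨0, fun n _ => by rw [map_zero, LinearMap.zero_apply]⟩ ?_ ?_ ?_ ha
  · rintro v v' ⟨N, hN⟩ ⟨N', hN'⟩
    refine ⟨max N N', fun n hn => ?_⟩
    rw [map_add, LinearMap.add_apply, hN n ((le_max_left _ _).trans hn),
      hN' n ((le_max_right _ _).trans hn), add_zero]
  · rintro c v ⟨N, hN⟩
    exact ⟨N, fun n hn => by rw [map_smul, LinearMap.smul_apply, hN n hn, smul_zero]⟩
  · rintro lam - s
    simp only [latticeMode_monomial]
    exact (monomialField B hB b ε lam _).trunc w

theorem latticeMode_vacuum_left (hB : B.IsSymm) (n : ℤ) :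
    latticeMode B hB b ε n (Finsupp.single 0 1) = if n = -1 then 1 else 0 := by
  have h := latticeMode_monomial (b := b) (ε := ε) hB n 0 0
  rw [monomial_zero', C_1, map_zero, Multiset.toList_zero] at h
  rw [h]
  refine Finsupp.lhom_ext fun mu p => ?_
  change (vertexField B hB b ε 0).mode n _ = _
  rw [vertexField_single, fockVertex_zero_lattice]
  by_cases hn : n = -1
  · subst hn
    simp
  · rw [if_neg hn, if_neg (by simp; omega)]
    simp

theorem latticeMode_vacuum_right (hB : B.IsSymm) (a : LatticeSpace L r) :
    latticeMode B hB b ε (-1) a (Finsupp.single 0 1) = a ∧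
      ∀ n, 0 ≤ n → latticeMode B hB b ε n a (Finsupp.single 0 1) = 0 := by
  have ha : a ∈ subspaceOn (r := r) (Set.univ : Set L) := Set.subset_univ _
  refine induction_monomial
    (P := fun a => latticeMode B hB b ε (-1) a (Finsupp.single 0 1) = a ∧
      ∀ n, 0 ≤ n → latticeMode B hB b ε n a (Finsupp.single 0 1) = 0) ?_ ?_ ?_ ?_ ha
  · simp
  · rintro v w ⟨h₁, h₂⟩ ⟨h₃, h₄⟩
    refine ⟨by rw [map_add, LinearMap.add_apply, h₁, h₃], fun n hn => ?_⟩
    rw [map_add, LinearMap.add_apply, h₂ n hn, h₄ n hn, add_zero]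
  · rintro c v ⟨h₁, h₂⟩
    refine ⟨by rw [map_smul, LinearMap.smul_apply, h₁], fun n hn => ?_⟩
    rw [map_smul, LinearMap.smul_apply, h₂ n hn, smul_zero]
  · rintro lam - s
    simp only [latticeMode_monomial]
    rw [monomial_eq_prod_toList]
    exact monomialField_vacuum hB lam _

theorem translationOp_latticeMode (hB : B.IsSymm) {e : Fin r → ℂ ⊗[ℤ] L}
    (he : ∀ i j, B.baseChange ℂ (e i) (1 ⊗ₜ[ℤ] ε j) = if i = j then 1 else 0)
    (a : LatticeSpace L r) (n : ℤ) (w : LatticeSpace L r) :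
    translationOp B ε (latticeMode B hB b ε n a w)
        - latticeMode B hB b ε n a (translationOp B ε w)
      = -(n : ℂ) • latticeMode B hB b ε (n - 1) a w := by
  have ha : a ∈ subspaceOn (r := r) (Set.univ : Set L) := Set.subset_univ _
  refine induction_monomial (P := fun a => translationOp B ε (latticeMode B hB b ε n a w)
        - latticeMode B hB b ε n a (translationOp B ε w)
      = -(n : ℂ) • latticeMode B hB b ε (n - 1) a w) ?_ ?_ ?_ ?_ ha
  · simp
  · intro v w h₁ h₂
    simp only [map_add, LinearMap.add_apply]
    rw [add_sub_add_comm, h₁, h₂, smul_add]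
  · intro c v h
    simp only [map_smul, LinearMap.smul_apply]
    rw [← smul_sub, h, smul_comm]
  · rintro lam - s
    simp only [latticeMode_monomial]
    have h := LinearMap.congr_fun (translationOp_monomialField (b := b) hB he lam
      (Finsupp.toMultiset s).toList n) w
    rwa [LinearMap.sub_apply, Module.End.mul_apply, Module.End.mul_apply,
      LinearMap.smul_apply] at h

theorem translationOp_vacuum : translationOp B ε (Finsupp.single 0 (1 : Fock r)) = 0 := by
  rw [translationOp_single_one, TensorProduct.tmul_zero, heisenberg_zero_left]
  rfl

theorem latticeMode_neg_two_vacuum (hB : B.IsSymm) {e : Fin r → ℂ ⊗[ℤ] L}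
    (he : ∀ i j, B.baseChange ℂ (e i) (1 ⊗ₜ[ℤ] ε j) = if i = j then 1 else 0)
    (a : LatticeSpace L r) :
    latticeMode B hB b ε (-2) a (Finsupp.single 0 1) = translationOp B ε a := by
  have h := translationOp_latticeMode (b := b) hB he a (-1) (Finsupp.single 0 1)
  rw [translationOp_vacuum, map_zero, sub_zero, (latticeMode_vacuum_right hB a).1] at h
  rw [h]
  norm_num

/-- Locality in `V_L`, for vectors of parity `i` and `j`. -/
theorem isLocal_latticeMode (hB : B.IsSymm) {e : Fin r → ℂ ⊗[ℤ] L}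
    (he : ∀ i j, B.baseChange ℂ (e i) (1 ⊗ₜ[ℤ] ε j) = if i = j then 1 else 0)
    (hb : ∀ lam mu, b lam mu + b mu lam = ((B lam mu + B lam lam * B mu mu : ℤ) : ZMod 2))
    {i j : ZMod 2} {v w : LatticeSpace L r} (hv : v ∈ subspaceOn {lam | (B lam lam : ZMod 2) = i})
    (hw : w ∈ subspaceOn {lam | (B lam lam : ZMod 2) = j}) :
    IsLocal (sgn (i * j)) (fun n => latticeMode B hB b ε n v)
      (fun n => latticeMode B hB b ε n w) := by
  have hz : ∀ {C : ℤ → Module.End ℂ (LatticeSpace L r)} {σ : ℂ},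
      IsLocal σ (fun n => latticeMode B hB b ε n 0) C := fun {C σ} => by
    simp only [map_zero]
    exact IsLocal.zero_left
  have ha : ∀ {C : ℤ → Module.End ℂ (LatticeSpace L r)} {σ : ℂ} (v w : LatticeSpace L r),
      IsLocal σ (fun n => latticeMode B hB b ε n v) C →
      IsLocal σ (fun n => latticeMode B hB b ε n w) C →
      IsLocal σ (fun n => latticeMode B hB b ε n (v + w)) C := fun {C σ} v w h h' => by
    simp only [map_add]
    exact h.add h'
  have hs : ∀ {C : ℤ → Module.End ℂ (LatticeSpace L r)} {σ : ℂ} (c : ℂ) (v : LatticeSpace L r),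
      IsLocal σ (fun n => latticeMode B hB b ε n v) C →
      IsLocal σ (fun n => latticeMode B hB b ε n (c • v)) C := fun {C σ} c v h => by
    simp only [map_smul]
    exact h.smul c
  refine induction_monomial hz ha hs (fun lam hlam s => ?_) hv
  refine IsLocal.symm (sgn_mul_self _) (induction_monomial hz ha hs (fun mu hmu t => ?_) hw)
  refine IsLocal.symm (sgn_mul_self _) ?_
  simp only [latticeMode_monomial]
  rw [← show (B lam lam : ZMod 2) = i from hlam, ← show (B mu mu : ZMod 2) = j from hmu]
  exact isLocal_monomialField hB he hb lam mu _ _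

/-- `θ` is an automorphism of the vertex algebra `V_L`. -/
theorem theta_latticeMode (hB : B.IsSymm) {e : Fin r → ℂ ⊗[ℤ] L}
    (he : ∀ i j, B.baseChange ℂ (e i) (1 ⊗ₜ[ℤ] ε j) = if i = j then 1 else 0)
    (a : LatticeSpace L r) (n : ℤ) (w : LatticeSpace L r) :
    theta (latticeMode B hB b ε n a w) = latticeMode B hB b ε n (theta a) (theta w) := by
  have ha : a ∈ subspaceOn (r := r) (Set.univ : Set L) := Set.subset_univ _
  refine induction_monomial (P := fun a => theta (latticeMode B hB b ε n a w)
    = latticeMode B hB b ε n (theta a) (theta w)) ?_ ?_ ?_ ?_ ha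
  · simp only [map_zero, LinearMap.zero_apply]
  · intro v w h₁ h₂
    simp only [map_add, LinearMap.add_apply, h₁, h₂]
  · intro c v h
    simp only [map_smul, LinearMap.smul_apply, h]
  · rintro lam - s
    have h : ∀ xs : List (Fin r × ℕ), aeval (fun x : Fin r × ℕ => -(X x : Fock r))
        ((xs.map X).prod : Fock r) = (-1 : ℂ) ^ xs.length • ((xs.map X).prod : Fock r) := by
      intro xs
      induction xs with
      | nil => simp
      | cons x xs ih =>
        rw [List.map_cons, List.prod_cons, map_mul, ih, aeval_X, List.length_cons, pow_succ',
          mul_smul, neg_one_smul, mul_smul_comm, neg_mul, smul_neg]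
    rw [latticeMode_monomial, theta_monomialField hB he, theta_single, monomial_eq_prod_toList, h,
      ← monomial_eq_prod_toList, ← Finsupp.smul_single, map_smul, LinearMap.smul_apply,
      latticeMode_monomial]

end Lattice

section Fields

variable {V : Type*} [AddCommGroup V] [Module ℂ V]

/-! ### Quadratic fields -/

theorem FormalField.ext_mode {A A' : FormalField V} (h : ∀ n v, A.mode n v = A'.mode n v) :
    A = A' := by
  obtain ⟨f, hf⟩ := A
  obtain ⟨f', hf'⟩ := A'
  obtain rfl : f = f' := funext fun n => LinearMap.ext (h n)
  rfl

theorem FormalField.deriv_zero (A : FormalField V) : A.deriv 0 = A :=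
  FormalField.ext_mode fun n v => by rw [A.deriv_zero_mode]

theorem FormalField.nord_of_identity (A I : FormalField V)
    (hI : ∀ n v, I.mode n v = if n = -1 then v else 0) : A.nord I = A := by
  refine FormalField.ext_mode fun n v => ?_
  obtain ⟨K, hK, hn⟩ := ((A.nord_eventually_eq I n v).and
    (eventually_gt_atTop n.natAbs)).exists
  rw [hK, nordSum]
  rcases lt_or_ge n 0 with h | h
  · obtain ⟨m, rfl⟩ : ∃ m : ℕ, n = -m - 1 := ⟨(-n - 1).toNat, by omega⟩
    rw [Finset.sum_eq_single m, Finset.sum_eq_zero, add_zero, hI, if_pos (by omega)]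
    · intro k _
      rw [hI, if_neg (by omega)]
    · intro k _ hk
      rw [hI, if_neg (by omega), map_zero]
    · exact fun h => absurd (Finset.mem_range.2 (by omega)) h
  · obtain ⟨m, rfl⟩ := Int.eq_ofNat_of_zero_le h
    rw [Finset.sum_eq_zero, Finset.sum_eq_single m, zero_add, hI, if_pos (by omega)]
    · intro k _ hk
      rw [hI, if_neg (by omega)]
    · exact fun h => absurd (Finset.mem_range.2 (by omega)) h
    · intro k _
      rw [hI, if_neg (by omega), map_zero]

theorem FormalField.nord_add_smul_left {ι : Type*} (s : Finset ι) (c : ι → ℂ)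
    (A : ι → FormalField V) (A' B : FormalField V)
    (h : ∀ n v, A'.mode n v = ∑ i ∈ s, c i • (A i).mode n v) (n : ℤ) (v : V) :
    (A'.nord B).mode n v = ∑ i ∈ s, c i • ((A i).nord B).mode n v := by
  have hK : ∀ᶠ K : ℕ in atTop, ∀ i ∈ s, ((A i).nord B).mode n v
      = nordSum K (fun m n => (A i).mode m (B.mode n v)) (fun m n => B.mode n ((A i).mode m v)) n :=
    (Filter.eventually_all_finset s).2 fun i _ => (A i).nord_eventually_eq B n v
  obtain ⟨K, h₁, h₂⟩ := ((A'.nord_eventually_eq B n v).and hK).exists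
  rw [h₁, Finset.sum_congr rfl fun i hi => by rw [h₂ i hi]]
  simp only [nordSum, h, map_sum, map_smul, smul_add, Finset.smul_sum, Finset.sum_add_distrib]
  rw [Finset.sum_comm]
  congr 1
  exact Finset.sum_comm

/-- If `H` satisfies `[H, A(z)] = α z ^ (k-1)` and `[H, B(z)] = β z ^ (k-1)`, then
`[H, :A(z) B(z):] = z ^ (k-1) (α B(z) + β A(z))`. -/
theorem FormalField.commutator_nord {A B : FormalField V} {H : Module.End ℂ V} {α β : ℂ} {k : ℤ}
    (hA : ∀ n v, H (A.mode n v) - A.mode n (H v) = (if k + n = 0 then α else 0) • v)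
    (hB : ∀ n v, H (B.mode n v) - B.mode n (H v) = (if k + n = 0 then β else 0) • v) (n : ℤ)
    (v : V) : H ((A.nord B).mode n v) - (A.nord B).mode n (H v)
      = α • B.mode (n + k - 1) v + β • A.mode (n + k - 1) v := by
  obtain ⟨K, h₁, h₂, hK, hK'⟩ := ((A.nord_eventually_eq B n v).and
    ((A.nord_eventually_eq B n (H v)).and ((eventually_gt_atTop k.natAbs).and
      (eventually_gt_atTop (n.natAbs + k.natAbs))))).exists
  have hA' := fun n v => sub_eq_iff_eq_add.1 (hA n v)
  have hB' := fun n v => sub_eq_iff_eq_add.1 (hB n v)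
  -- Just one term of the normally ordered product has a non-zero contraction with `H`; the sign of
  -- `k`, respectively of `n + k`, decides in which half it occurs.
  have e₁ : ∑ j ∈ Finset.range K, (if k + (-j - 1) = 0 then α else 0) • B.mode (n + j) v
      + ∑ j ∈ Finset.range K, (if k + j = 0 then α else 0) • B.mode (n - j - 1) v
      = α • B.mode (n + k - 1) v := by
    rcases lt_or_ge 0 k with h | h
    · rw [Finset.sum_eq_single (k - 1).toNat, Finset.sum_eq_zero, add_zero, if_pos (by omega),
        show n + ((k - 1).toNat : ℤ) = n + k - 1 by omega]
      · intro j _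
        rw [if_neg (by omega), zero_smul]
      · intro j _ hj
        rw [if_neg (by omega), zero_smul]
      · exact fun h => absurd (Finset.mem_range.2 (by omega)) h
    · rw [Finset.sum_eq_zero, Finset.sum_eq_single (-k).toNat, zero_add, if_pos (by omega),
        show n - ((-k).toNat : ℤ) - 1 = n + k - 1 by omega]
      · intro j _ hj
        rw [if_neg (by omega), zero_smul]
      · exact fun h => absurd (Finset.mem_range.2 (by omega)) h
      · intro j _
        rw [if_neg (by omega), zero_smul]
  have e₂ : ∑ j ∈ Finset.range K, (if k + (n + j) = 0 then β else 0) • A.mode (-j - 1) v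
      + ∑ j ∈ Finset.range K, (if k + (n - j - 1) = 0 then β else 0) • A.mode j v
      = β • A.mode (n + k - 1) v := by
    rcases lt_or_ge 0 (n + k) with h | h
    · rw [Finset.sum_eq_zero, Finset.sum_eq_single (n + k - 1).toNat, zero_add, if_pos (by omega),
        show ((n + k - 1).toNat : ℤ) = n + k - 1 by omega]
      · intro j _ hj
        rw [if_neg (by omega), zero_smul]
      · exact fun h => absurd (Finset.mem_range.2 (by omega)) h
      · intro j _
        rw [if_neg (by omega), zero_smul]
    · rw [Finset.sum_eq_single (-(n + k)).toNat, Finset.sum_eq_zero, add_zero, if_pos (by omega),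
        show -((-(n + k)).toNat : ℤ) - 1 = n + k - 1 by omega]
      · intro j _
        rw [if_neg (by omega), zero_smul]
      · intro j _ hj
        rw [if_neg (by omega), zero_smul]
      · exact fun h => absurd (Finset.mem_range.2 (by omega)) h
  rw [h₁, h₂, ← e₁, ← e₂]
  simp only [nordSum, map_add, map_sum, hA', hB', map_smul, Finset.sum_add_distrib]
  abel

end Fields

section Lattice

variable {L : Type*} [AddCommGroup L] {r : ℕ} {B : LinearMap.BilinForm ℤ L}
  {ε : Module.Basis (Fin r) ℤ L} {b : L →+ L →+ ZMod 2}

open MvPolynomial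

/-- The field `:u(z) v(z):`. -/
def quadraticField (B : LinearMap.BilinForm ℤ L) (hB : B.IsSymm) (ε : Module.Basis (Fin r) ℤ L)
    (u v : ℂ ⊗[ℤ] L) : FormalField (LatticeSpace L r) :=
  (heisenbergField B hB ε u).nord (heisenbergField B hB ε v)

theorem heisenberg_commutator_apply (hB : B.IsSymm) (u v : ℂ ⊗[ℤ] L) (m n : ℤ)
    (w : LatticeSpace L r) :
    heisenberg B ε u m (heisenberg B ε v n w) - heisenberg B ε v n (heisenberg B ε u m w)
      = (if m + n = 0 then (m : ℂ) * B.baseChange ℂ u v else 0) • w := by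
  have h := LinearMap.congr_fun (heisenberg_commutator (ε := ε) hB u v m n) w
  rwa [LinearMap.sub_apply, LinearMap.smul_apply] at h

theorem heisenberg_quadraticField (hB : B.IsSymm) (u v v' : ℂ ⊗[ℤ] L) (k n : ℤ)
    (w : LatticeSpace L r) :
    heisenberg B ε u k ((quadraticField B hB ε v v').mode n w)
        - (quadraticField B hB ε v v').mode n (heisenberg B ε u k w)
      = ((k : ℂ) * B.baseChange ℂ u v) • heisenberg B ε v' (n + k - 1) w
        + ((k : ℂ) * B.baseChange ℂ u v') • heisenberg B ε v (n + k - 1) w :=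
  FormalField.commutator_nord (A := heisenbergField B hB ε v) (B := heisenbergField B hB ε v')
    (heisenberg_commutator_apply hB u v k) (heisenberg_commutator_apply hB u v' k) n w

theorem vev_heisenberg_zero (u : ℂ ⊗[ℤ] L) (nu : L) (w : LatticeSpace L r) :
    vev nu (heisenberg B ε u 0 w) = B.baseChange ℂ u (1 ⊗ₜ[ℤ] nu) * vev nu w := by
  classical
  induction w using Finsupp.induction_linear with
  | zero => simp only [map_zero, mul_zero]
  | add v w hv hw => simp only [map_add, hv, hw, mul_add]
  | single mu p =>
    rw [heisenberg_zero_single, map_smul, smul_eq_mul, vev_single]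
    split_ifs with h
    · rw [h]
    · rw [mul_zero, mul_zero]

/-- The vacuum expectation value of `u(m) v(n)`. -/
theorem vev_heisenberg_heisenberg [DecidableEq L] (hB : B.IsSymm) (u v : ℂ ⊗[ℤ] L) (m n : ℤ)
    (mu nu : L) :
    vev nu (heisenberg B ε u m (heisenberg B ε v n (Finsupp.single mu 1)))
      = if mu = nu then (if m = 0 ∧ n = 0 then
            B.baseChange ℂ u (1 ⊗ₜ[ℤ] mu) * B.baseChange ℂ v (1 ⊗ₜ[ℤ] mu) else 0)
          + (if 0 < m ∧ m + n = 0 then (m : ℂ) * B.baseChange ℂ u v else 0) else 0 := by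
  have h1 : vev nu (Finsupp.single mu (1 : Fock r)) = if mu = nu then 1 else 0 := by
    rw [vev_single, map_one]
  rcases lt_trichotomy m 0 with hm | rfl | hm
  · rw [vev_heisenberg_of_neg u hm, if_neg (show ¬(m = 0 ∧ n = 0) by omega),
      if_neg (show ¬(0 < m ∧ m + n = 0) by omega), add_zero, ite_self]
  · rw [vev_heisenberg_zero]
    rcases lt_trichotomy n 0 with hn | rfl | hn
    · rw [vev_heisenberg_of_neg v hn, if_neg (show ¬((0 : ℤ) = 0 ∧ n = 0) by omega),
        if_neg (show ¬((0 : ℤ) < 0 ∧ 0 + n = 0) by omega), add_zero, ite_self, mul_zero]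
    · rw [vev_heisenberg_zero, h1, if_pos (show (0 : ℤ) = 0 ∧ (0 : ℤ) = 0 from ⟨rfl, rfl⟩),
        if_neg (show ¬((0 : ℤ) < 0 ∧ (0 : ℤ) + 0 = 0) by omega), add_zero]
      split_ifs with h
      · rw [h, mul_one]
      · rw [mul_zero, mul_zero]
    · rw [heisenberg_single_one v hn, map_zero, if_neg (show ¬((0 : ℤ) = 0 ∧ n = 0) by omega),
        if_neg (show ¬((0 : ℤ) < 0 ∧ 0 + n = 0) by omega), add_zero, ite_self, mul_zero]
  · have h := heisenberg_commutator_apply (ε := ε) hB u v m n (Finsupp.single mu 1)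
    rw [heisenberg_single_one u hm, map_zero, sub_zero] at h
    rw [h, map_smul, h1, smul_eq_mul, if_neg (show ¬(m = 0 ∧ n = 0) by omega), zero_add]
    by_cases h0 : m + n = 0
    · rw [if_pos h0, if_pos (show 0 < m ∧ m + n = 0 from ⟨hm, h0⟩)]
      split_ifs <;> simp
    · rw [if_neg h0, if_neg (show ¬(0 < m ∧ m + n = 0) from fun h => h0 h.2), zero_mul, ite_self]

theorem quadraticField_eventually_eq (hB : B.IsSymm) (u v : ℂ ⊗[ℤ] L) (n : ℤ)
    (w : LatticeSpace L r) : ∀ᶠ K : ℕ in atTop, (quadraticField B hB ε u v).mode n w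
      = ∑ j ∈ Finset.range K, heisenberg B ε u (-j - 1) (heisenberg B ε v (n + j) w)
        + ∑ j ∈ Finset.range K, heisenberg B ε v (n - j - 1) (heisenberg B ε u j w) :=
  FormalField.nord_eventually_eq (heisenbergField B hB ε u) (heisenbergField B hB ε v) n w

theorem quadraticField_single_one_of_lt (hB : B.IsSymm) (u v : ℂ ⊗[ℤ] L) {n : ℤ} (hn : 1 < n)
    (mu : L) : (quadraticField B hB ε u v).mode n (Finsupp.single mu 1) = 0 := by
  obtain ⟨K, hK⟩ := (quadraticField_eventually_eq (ε := ε) hB u v n (Finsupp.single mu 1)).exists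
  rw [hK, Finset.sum_eq_zero, Finset.sum_eq_zero, add_zero]
  · intro j _
    rcases j with _ | j
    · rw [Nat.cast_zero, heisenberg_zero_single, map_smul, heisenberg_single_one v (by omega),
        smul_zero]
    · rw [heisenberg_single_one u (by omega), map_zero]
  · intro j _
    rw [heisenberg_single_one v (by omega), map_zero]

theorem quadraticField_single_one_of_eq (hB : B.IsSymm) (u v : ℂ ⊗[ℤ] L) (mu : L) :
    (quadraticField B hB ε u v).mode 1 (Finsupp.single mu 1)
      = (B.baseChange ℂ u (1 ⊗ₜ[ℤ] mu) * B.baseChange ℂ v (1 ⊗ₜ[ℤ] mu)) • Finsupp.single mu 1 := by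
  obtain ⟨K, hK, h0⟩ := ((quadraticField_eventually_eq (ε := ε) hB u v 1
    (Finsupp.single mu 1)).and (eventually_gt_atTop 0)).exists
  rw [hK, Finset.sum_eq_zero, Finset.sum_eq_single 0, zero_add, Nat.cast_zero,
    heisenberg_zero_single, map_smul, sub_zero, sub_self, heisenberg_zero_single, smul_smul]
  · intro j _ hj
    rw [heisenberg_single_one u (by omega), map_zero]
  · exact fun h => absurd (Finset.mem_range.2 h0) h
  · intro j _
    rw [heisenberg_single_one v (by omega), map_zero]

theorem vev_quadraticField_of_lt (hB : B.IsSymm) (u v : ℂ ⊗[ℤ] L) {n : ℤ} (hn : n < 1) (nu : L)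
    (w : LatticeSpace L r) : vev nu ((quadraticField B hB ε u v).mode n w) = 0 := by
  obtain ⟨K, hK⟩ := (quadraticField_eventually_eq (ε := ε) hB u v n w).exists
  rw [hK, map_add, map_sum, map_sum, Finset.sum_eq_zero, Finset.sum_eq_zero, add_zero]
  · exact fun j _ => vev_heisenberg_of_neg _ (by omega) _ _
  · exact fun j _ => vev_heisenberg_of_neg _ (by omega) _ _

theorem vev_quadraticField_of_eq (hB : B.IsSymm) (u v : ℂ ⊗[ℤ] L) (nu : L)
    (w : LatticeSpace L r) : vev nu ((quadraticField B hB ε u v).mode 1 w)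
      = B.baseChange ℂ u (1 ⊗ₜ[ℤ] nu) * B.baseChange ℂ v (1 ⊗ₜ[ℤ] nu) * vev nu w := by
  obtain ⟨K, hK, h0⟩ := ((quadraticField_eventually_eq (ε := ε) hB u v 1 w).and
    (eventually_gt_atTop 0)).exists
  rw [hK, map_add, map_sum, map_sum, Finset.sum_eq_zero, Finset.sum_eq_single 0, zero_add,
    Nat.cast_zero, sub_zero, sub_self, vev_heisenberg_zero, vev_heisenberg_zero]
  · ring
  · exact fun j _ hj => vev_heisenberg_of_neg _ (by omega) _ _
  · exact fun h => absurd (Finset.mem_range.2 h0) h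
  · exact fun j _ => vev_heisenberg_of_neg _ (by omega) _ _

/-- `:u(z) v(z): = :v(z) u(z):`. -/
theorem quadraticField_comm (hB : B.IsSymm) {e : Fin r → ℂ ⊗[ℤ] L}
    (he : ∀ i j, B.baseChange ℂ (e i) (1 ⊗ₜ[ℤ] ε j) = if i = j then 1 else 0) (u v : ℂ ⊗[ℤ] L) :
    quadraticField B hB ε u v = quadraticField B hB ε v u := by
  classical
  refine FormalField.ext_mode fun n w => ?_
  let X : ℤ → Module.End ℂ (LatticeSpace L r) := fun n =>
    (quadraticField B hB ε u v).mode n - (quadraticField B hB ε v u).mode n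
  have hX : X n = 0 := by
    refine eq_zero_of_vev he (fun u' k n => ?_) (fun n mu nu => ?_) n
    · have h : heisenberg B ε u' k * X n - X n * heisenberg B ε u' k = 0 := by
        refine LinearMap.ext fun w => ?_
        have h₁ := heisenberg_quadraticField (ε := ε) hB u' u v k n w
        have h₂ := heisenberg_quadraticField (ε := ε) hB u' v u k n w
        simp only [X, LinearMap.sub_apply, Module.End.mul_apply, map_sub, LinearMap.zero_apply]
        rw [sub_sub_sub_comm, h₁, h₂, add_comm, sub_self]
      exact (congrArg (· ∈ _) h).mpr (Submodule.zero_mem _)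
    · rw [LinearMap.sub_apply, map_sub]
      rcases lt_trichotomy n 1 with hn | rfl | hn
      · rw [vev_quadraticField_of_lt hB _ _ hn, vev_quadraticField_of_lt hB _ _ hn, sub_zero]
      · rw [vev_quadraticField_of_eq, vev_quadraticField_of_eq]
        ring
      · rw [quadraticField_single_one_of_lt hB _ _ hn, quadraticField_single_one_of_lt hB _ _ hn,
          sub_self]
  exact sub_eq_zero.1 (LinearMap.congr_fun hX w)

/-! ### Dual bases -/

theorem sum_baseChange_dual_smul (hB : B.IsSymm) {e : Fin r → ℂ ⊗[ℤ] L}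
    (he : ∀ i j, B.baseChange ℂ (e i) (1 ⊗ₜ[ℤ] ε j) = if i = j then 1 else 0) (u : ℂ ⊗[ℤ] L) :
    ∑ i, B.baseChange ℂ u (e i) • ((1 : ℂ) ⊗ₜ[ℤ] ε i) = u := by
  have h : ∑ i, ((B.baseChange ℂ).flip (e i)).smulRight ((1 : ℂ) ⊗ₜ[ℤ] ε i) = LinearMap.id := by
    refine (ε.baseChange ℂ).ext fun j => ?_
    rw [LinearMap.sum_apply, Module.Basis.baseChange_apply, LinearMap.id_apply,
      Finset.sum_eq_single j]
    · rw [LinearMap.smulRight_apply, LinearMap.BilinForm.flip_apply, baseChange_comm hB, he,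
        if_pos rfl, one_smul]
    · intro i _ hi
      rw [LinearMap.smulRight_apply, LinearMap.BilinForm.flip_apply, baseChange_comm hB, he,
        if_neg hi, zero_smul]
    · exact fun h => absurd (Finset.mem_univ _) h
  have := LinearMap.congr_fun h u
  rw [LinearMap.sum_apply] at this
  exact this

theorem sum_baseChange_smul_dual (hB : B.IsSymm) {e : Fin r → ℂ ⊗[ℤ] L}
    (he : ∀ i j, B.baseChange ℂ (e i) (1 ⊗ₜ[ℤ] ε j) = if i = j then 1 else 0) (u : ℂ ⊗[ℤ] L) :
    ∑ i, B.baseChange ℂ u (1 ⊗ₜ[ℤ] ε i) • e i = u := by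
  conv_rhs => rw [← sum_baseChange_dual_smul hB he u]
  calc ∑ i, B.baseChange ℂ u (1 ⊗ₜ[ℤ] ε i) • e i
      = ∑ i, ∑ j, B.baseChange ℂ u (B.baseChange ℂ (e j) (e i) • (1 ⊗ₜ[ℤ] ε i))
          • ((1 : ℂ) ⊗ₜ[ℤ] ε j) := by
        refine Finset.sum_congr rfl fun i _ => ?_
        conv_lhs => rw [← sum_baseChange_dual_smul hB he (e i), Finset.smul_sum]
        refine Finset.sum_congr rfl fun j _ => ?_
        rw [map_smul, smul_smul, smul_eq_mul, baseChange_comm hB (e i), mul_comm]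
    _ = _ := by
        rw [Finset.sum_comm]
        refine Finset.sum_congr rfl fun j _ => ?_
        rw [← Finset.sum_smul, ← map_sum, sum_baseChange_dual_smul hB he]

theorem sum_dual_mul (hB : B.IsSymm) {e : Fin r → ℂ ⊗[ℤ] L}
    (he : ∀ i j, B.baseChange ℂ (e i) (1 ⊗ₜ[ℤ] ε j) = if i = j then 1 else 0) (mu : L) :
    ∑ i, B.baseChange ℂ (e i) (1 ⊗ₜ[ℤ] mu) * B.baseChange ℂ (1 ⊗ₜ[ℤ] ε i) (1 ⊗ₜ[ℤ] mu)
      = (B mu mu : ℂ) := by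
  have h := congrArg (B.baseChange ℂ (1 ⊗ₜ[ℤ] mu)) (sum_baseChange_dual_smul hB he (1 ⊗ₜ[ℤ] mu))
  rw [map_sum, baseChange_one_tmul] at h
  rw [← h]
  refine Finset.sum_congr rfl fun i _ => ?_
  rw [map_smul, smul_eq_mul, baseChange_comm hB (e i), baseChange_comm hB (1 ⊗ₜ[ℤ] ε i)]

/-! ### The Virasoro algebra -/

/-- The operator `L(m)` of the conformal vector, for a basis `e` which is dual to `ε`. -/
def virasoroOp (B : LinearMap.BilinForm ℤ L) (hB : B.IsSymm) (ε : Module.Basis (Fin r) ℤ L)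
    (e : Fin r → ℂ ⊗[ℤ] L) (m : ℤ) : Module.End ℂ (LatticeSpace L r) :=
  (1 / 2 : ℂ) • ∑ i, (quadraticField B hB ε (e i) (1 ⊗ₜ[ℤ] ε i)).mode (m + 1)

theorem virasoroOp_apply (hB : B.IsSymm) (e : Fin r → ℂ ⊗[ℤ] L) (m : ℤ) (w : LatticeSpace L r) :
    virasoroOp B hB ε e m w
      = (1 / 2 : ℂ) • ∑ i, (quadraticField B hB ε (e i) (1 ⊗ₜ[ℤ] ε i)).mode (m + 1) w := by
  rw [virasoroOp, LinearMap.smul_apply, LinearMap.sum_apply]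

/-- `[u(k), L(m)] = k u(m + k)`. -/
theorem heisenberg_virasoroOp (hB : B.IsSymm) {e : Fin r → ℂ ⊗[ℤ] L}
    (he : ∀ i j, B.baseChange ℂ (e i) (1 ⊗ₜ[ℤ] ε j) = if i = j then 1 else 0) (u : ℂ ⊗[ℤ] L)
    (k m : ℤ) (w : LatticeSpace L r) :
    heisenberg B ε u k (virasoroOp B hB ε e m w) - virasoroOp B hB ε e m (heisenberg B ε u k w)
      = (k : ℂ) • heisenberg B ε u (m + k) w := by
  have h₁ : ∑ i, B.baseChange ℂ u (e i) • heisenberg B ε (1 ⊗ₜ[ℤ] ε i) (m + k) w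
      = heisenberg B ε u (m + k) w := by
    conv_rhs => rw [← sum_baseChange_dual_smul hB he u]
    simp only [← heisenbergMap_apply, map_sum, map_smul, LinearMap.sum_apply, LinearMap.smul_apply]
  have h₂ : ∑ i, B.baseChange ℂ u (1 ⊗ₜ[ℤ] ε i) • heisenberg B ε (e i) (m + k) w
      = heisenberg B ε u (m + k) w := by
    conv_rhs => rw [← sum_baseChange_smul_dual hB he u]
    simp only [← heisenbergMap_apply, map_sum, map_smul, LinearMap.sum_apply, LinearMap.smul_apply]
  rw [virasoroOp_apply, virasoroOp_apply, map_smul, map_sum, ← smul_sub, ← Finset.sum_sub_distrib]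
  simp only [heisenberg_quadraticField, mul_smul]
  rw [Finset.sum_add_distrib, ← Finset.smul_sum, ← Finset.smul_sum,
    show m + 1 + k - 1 = m + k by ring, h₁, h₂]
  module

theorem virasoroOp_single_one_of_pos (hB : B.IsSymm) (e : Fin r → ℂ ⊗[ℤ] L) {m : ℤ} (hm : 0 < m)
    (mu : L) : virasoroOp B hB ε e m (Finsupp.single mu 1) = 0 := by
  rw [virasoroOp_apply, Finset.sum_eq_zero, smul_zero]
  exact fun i _ => quadraticField_single_one_of_lt hB _ _ (by omega) _

theorem virasoroOp_zero_single_one (hB : B.IsSymm) {e : Fin r → ℂ ⊗[ℤ] L}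
    (he : ∀ i j, B.baseChange ℂ (e i) (1 ⊗ₜ[ℤ] ε j) = if i = j then 1 else 0) (mu : L) :
    virasoroOp B hB ε e 0 (Finsupp.single mu 1)
      = ((B mu mu : ℂ) / 2) • Finsupp.single mu 1 := by
  rw [virasoroOp_apply, zero_add]
  simp only [quadraticField_single_one_of_eq]
  rw [← Finset.sum_smul, sum_dual_mul hB he, smul_smul]
  congr 1
  ring

theorem vev_virasoroOp_of_neg (hB : B.IsSymm) (e : Fin r → ℂ ⊗[ℤ] L) {m : ℤ} (hm : m < 0)
    (nu : L) (w : LatticeSpace L r) : vev nu (virasoroOp B hB ε e m w) = 0 := by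
  rw [virasoroOp_apply, map_smul, map_sum, Finset.sum_eq_zero, smul_zero]
  exact fun i _ => vev_quadraticField_of_lt hB _ _ (by omega) _ _

theorem vev_virasoroOp_zero (hB : B.IsSymm) {e : Fin r → ℂ ⊗[ℤ] L}
    (he : ∀ i j, B.baseChange ℂ (e i) (1 ⊗ₜ[ℤ] ε j) = if i = j then 1 else 0) (nu : L)
    (w : LatticeSpace L r) :
    vev nu (virasoroOp B hB ε e 0 w) = (B nu nu : ℂ) / 2 * vev nu w := by
  rw [virasoroOp_apply, map_smul, map_sum, zero_add]
  simp only [vev_quadraticField_of_eq]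
  rw [← Finset.sum_mul, sum_dual_mul hB he, smul_eq_mul]
  ring

/-- `L(-1)` is the translation operator: both have the same commutators with the Heisenberg
operators, and no vacuum expectation values. -/
theorem virasoroOp_neg_one (hB : B.IsSymm) {e : Fin r → ℂ ⊗[ℤ] L}
    (he : ∀ i j, B.baseChange ℂ (e i) (1 ⊗ₜ[ℤ] ε j) = if i = j then 1 else 0) :
    virasoroOp B hB ε e (-1) = translationOp B ε := by
  let X : Unit → Module.End ℂ (LatticeSpace L r) := fun _ =>
    virasoroOp B hB ε e (-1) - translationOp B ε
  have hX : X () = 0 := by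
    refine eq_zero_of_vev he (fun u k _ => ?_) (fun _ mu nu => ?_) ()
    · have h : heisenberg B ε u k * X () - X () * heisenberg B ε u k = 0 := by
        refine LinearMap.ext fun w => ?_
        have h₁ := heisenberg_virasoroOp (ε := ε) hB he u k (-1) w
        have h₂ := LinearMap.congr_fun (translationOp_heisenberg (ε := ε) hB u k) w
        rw [LinearMap.sub_apply, Module.End.mul_apply, Module.End.mul_apply,
          LinearMap.smul_apply] at h₂
        simp only [X, LinearMap.sub_apply, Module.End.mul_apply, map_sub, LinearMap.zero_apply]
        rw [sub_sub_sub_comm, h₁, ← neg_sub (translationOp B ε _), h₂,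
          show -1 + k = k - 1 by ring]
        module
      exact (congrArg (· ∈ _) h).mpr (Submodule.zero_mem _)
    · rw [LinearMap.sub_apply, map_sub, vev_translationOp, vev_virasoroOp_of_neg hB e (by omega),
        sub_zero]
  exact sub_eq_zero.1 hX

theorem vev_virasoroOp_heisenberg (hB : B.IsSymm) {e : Fin r → ℂ ⊗[ℤ] L}
    (he : ∀ i j, B.baseChange ℂ (e i) (1 ⊗ₜ[ℤ] ε j) = if i = j then 1 else 0) (u : ℂ ⊗[ℤ] L)
    {k : ℤ} (hk : k < 0) (m : ℤ) (nu : L) (w : LatticeSpace L r) :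
    vev nu (virasoroOp B hB ε e m (heisenberg B ε u k w))
      = -(k : ℂ) * vev nu (heisenberg B ε u (m + k) w) := by
  have h := congrArg (vev nu) (heisenberg_virasoroOp hB he u k m w)
  rw [map_sub, vev_heisenberg_of_neg u hk, map_smul, smul_eq_mul] at h
  linear_combination -h

theorem sum_succ_mul_sub (M : ℕ) :
    ∑ j ∈ Finset.range M, ((j : ℂ) + 1) * ((M : ℂ) - 1 - j) = ((M : ℂ) ^ 3 - M) / 6 := by
  have h : ∀ M : ℕ, ∑ j ∈ Finset.range M, ((j : ℂ) + 1) = (M : ℂ) * (M + 1) / 2 := fun M => by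
    induction M with
    | zero => simp
    | succ M ih =>
      rw [Finset.sum_range_succ, ih]
      push_cast
      ring
  induction M with
  | zero => simp
  | succ M ih =>
    have h' : ∀ j : ℕ, ((j : ℂ) + 1) * (((M + 1 : ℕ) : ℂ) - 1 - j)
        = ((j : ℂ) + 1) * ((M : ℂ) - 1 - j) + ((j : ℂ) + 1) := fun j => by
      push_cast
      ring
    rw [Finset.sum_range_succ]
    simp only [h']
    rw [Finset.sum_add_distrib, ih, h]
    push_cast
    ring

/-- The vacuum expectation value of `L(M)` times a negative mode of `:u(z) v(z):`. Commuting `L(M)`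
past the creation operators `u(-j-1)` gives `(j + 1) u(M-j-1)`, whose contraction with `v(j+1-M)` is
`(j + 1) (M - j - 1) ⟨u, v⟩`; the sum over `j` is `⟨u, v⟩ (M³ - M) / 6`. The other
summand comes from the zero modes. -/
theorem vev_virasoroOp_quadraticField [DecidableEq L] (hB : B.IsSymm) {e : Fin r → ℂ ⊗[ℤ] L}
    (he : ∀ i j, B.baseChange ℂ (e i) (1 ⊗ₜ[ℤ] ε j) = if i = j then 1 else 0) (u v : ℂ ⊗[ℤ] L)
    (M : ℕ) (hM : 0 < M) {n : ℤ} (hn : n < 0) (mu nu : L) :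
    vev nu (virasoroOp B hB ε e M
        ((quadraticField B hB ε u v).mode (n + 1) (Finsupp.single mu 1)))
      = if mu = nu ∧ M + n = 0 then
          2 * (M : ℂ) * (B.baseChange ℂ u (1 ⊗ₜ[ℤ] mu) * B.baseChange ℂ v (1 ⊗ₜ[ℤ] mu))
            + B.baseChange ℂ u v * (((M : ℂ) ^ 3 - M) / 6) else 0 := by
  obtain ⟨K, hK, hKM⟩ := ((quadraticField_eventually_eq (ε := ε) hB u v (n + 1)
    (Finsupp.single mu 1)).and (eventually_ge_atTop M)).exists
  have h₁ : ∀ j : ℕ, vev nu (virasoroOp B hB ε e M (heisenberg B ε u (-j - 1)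
      (heisenberg B ε v (n + 1 + j) (Finsupp.single mu 1)))) = if mu = nu ∧ M + n = 0 then
        (if j + 1 = M then (M : ℂ) * (B.baseChange ℂ u (1 ⊗ₜ[ℤ] mu)
          * B.baseChange ℂ v (1 ⊗ₜ[ℤ] mu)) else 0)
        + (if j < M then B.baseChange ℂ u v * (((j : ℂ) + 1) * ((M : ℂ) - 1 - j)) else 0)
        else 0 := fun j => by
    rw [vev_virasoroOp_heisenberg hB he _ (by omega), vev_heisenberg_heisenberg hB]
    by_cases hmu : mu = nu
    · by_cases hMn : M + n = 0
      · rw [if_pos hmu, if_pos (show mu = nu ∧ (M : ℤ) + n = 0 from ⟨hmu, hMn⟩), mul_add]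
        congr 1
        · by_cases hj : j + 1 = M
          · rw [if_pos (by omega), if_pos hj, ← hj]
            push_cast
            ring
          · rw [if_neg (by omega), if_neg hj, mul_zero]
        · by_cases hj : j + 1 < M
          · rw [if_pos (by omega), if_pos (by omega)]
            push_cast
            ring
          · rw [if_neg (by omega), mul_zero]
            split_ifs with h
            · have : (M : ℂ) = j + 1 := by exact_mod_cast (show M = j + 1 by omega)
              rw [this]
              ring
            · rfl
      · rw [if_pos hmu, if_neg (by omega), if_neg (by omega), if_neg (fun h => hMn h.2), add_zero,
          mul_zero]
    · rw [if_neg hmu, if_neg (fun h => hmu h.1), mul_zero]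
  have h₂ : ∀ j : ℕ, vev nu (virasoroOp B hB ε e M (heisenberg B ε v (n + 1 - j - 1)
      (heisenberg B ε u j (Finsupp.single mu 1)))) = if mu = nu ∧ M + n = 0 then
        (if j = 0 then (M : ℂ) * (B.baseChange ℂ u (1 ⊗ₜ[ℤ] mu)
          * B.baseChange ℂ v (1 ⊗ₜ[ℤ] mu)) else 0) else 0 := fun j => by
    rw [vev_virasoroOp_heisenberg hB he _ (by omega), vev_heisenberg_heisenberg hB]
    by_cases hmu : mu = nu
    · rw [if_pos hmu, if_neg (show ¬(0 < (M : ℤ) + (n + 1 - j - 1) ∧ _) by omega), add_zero]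
      by_cases hMn : M + n = 0
      · rw [if_pos (show mu = nu ∧ M + n = 0 from ⟨hmu, hMn⟩)]
        by_cases hj : j = 0
        · have : (M : ℂ) = -n := by exact_mod_cast (show (M : ℤ) = -n by omega)
          rw [if_pos (by omega), if_pos hj, hj, this]
          push_cast
          ring
        · rw [if_neg (by omega), if_neg hj, mul_zero]
      · rw [if_neg (by omega), if_neg (fun h => hMn h.2), mul_zero]
    · rw [if_neg hmu, if_neg (fun h => hmu h.1), mul_zero]
  rw [hK]
  simp only [map_add, map_sum, h₁, h₂]
  split_ifs with h
  · rw [Finset.sum_add_distrib, Finset.sum_eq_single (M - 1), if_pos (by omega), Finset.sum_ite_eq',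
      if_pos (Finset.mem_range.2 (by omega)), ← Finset.sum_filter,
      show (Finset.range K).filter (· < M) = Finset.range M by
        ext j; simp only [Finset.mem_filter, Finset.mem_range]; omega,
      ← Finset.mul_sum, sum_succ_mul_sub]
    · ring
    · intro j _ hj
      rw [if_neg (by omega)]
    · exact fun h => absurd (Finset.mem_range.2 (by omega)) h
  · simp

/-- The vacuum expectation value of `L(m) L(n)`. -/
theorem vev_virasoroOp_virasoroOp [DecidableEq L] (hB : B.IsSymm) {e : Fin r → ℂ ⊗[ℤ] L}
    (he : ∀ i j, B.baseChange ℂ (e i) (1 ⊗ₜ[ℤ] ε j) = if i = j then 1 else 0) (m n : ℤ)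
    (mu nu : L) :
    vev nu (virasoroOp B hB ε e m (virasoroOp B hB ε e n (Finsupp.single mu 1)))
      = if mu = nu ∧ m + n = 0 then (if 0 < m then (m : ℂ) * B mu mu + ((m : ℂ) ^ 3 - m) / 12 * r
          else if m = 0 then (B mu mu : ℂ) ^ 2 / 4 else 0) else 0 := by
  have h1 : vev nu (Finsupp.single mu (1 : Fock r)) = if mu = nu then 1 else 0 := by
    rw [vev_single, map_one]
  rcases lt_trichotomy m 0 with hm | rfl | hm
  · rw [vev_virasoroOp_of_neg hB e hm, if_neg hm.not_gt, if_neg hm.ne, ite_self]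
  · rw [vev_virasoroOp_zero hB he, if_neg (lt_irrefl _), if_pos rfl, zero_add]
    rcases lt_trichotomy n 0 with hn | rfl | hn
    · rw [vev_virasoroOp_of_neg hB e hn, if_neg (fun h => hn.ne h.2), mul_zero]
    · rw [vev_virasoroOp_zero hB he, h1]
      by_cases h : mu = nu
      · rw [if_pos h, if_pos ⟨h, rfl⟩, h]
        ring
      · rw [if_neg h, if_neg (fun h' => h h'.1)]
        ring
    · rw [virasoroOp_single_one_of_pos hB e hn, map_zero, if_neg (fun h => hn.ne' h.2), mul_zero]
  · rcases lt_trichotomy n 0 with hn | rfl | hn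
    · obtain ⟨M, rfl⟩ := Int.eq_ofNat_of_zero_le hm.le
      rw [virasoroOp_apply hB e n, map_smul, map_sum, map_smul, map_sum]
      simp only [vev_virasoroOp_quadraticField hB he _ _ M (by omega) hn]
      split_ifs with h
      · rw [Finset.sum_add_distrib, ← Finset.mul_sum, sum_dual_mul hB he, ← Finset.sum_mul]
        simp only [he, if_true]
        rw [Finset.sum_const, Finset.card_univ, Fintype.card_fin, nsmul_eq_mul, smul_eq_mul,
          Int.cast_natCast]
        ring
      · simp
    · rw [virasoroOp_zero_single_one hB he, map_smul, virasoroOp_single_one_of_pos hB e hm,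
        smul_zero, map_zero, if_neg (by omega)]
    · rw [virasoroOp_single_one_of_pos hB e hn, map_zero, map_zero, if_neg (by omega)]

/-- The Virasoro relations, with central charge `r`: both sides have the same commutators with the
Heisenberg operators and the same vacuum expectation values. -/
theorem virasoroOp_commutator (hB : B.IsSymm) {e : Fin r → ℂ ⊗[ℤ] L}
    (he : ∀ i j, B.baseChange ℂ (e i) (1 ⊗ₜ[ℤ] ε j) = if i = j then 1 else 0) (m n : ℤ)
    (w : LatticeSpace L r) :
    virasoroOp B hB ε e m (virasoroOp B hB ε e n w)
        - virasoroOp B hB ε e n (virasoroOp B hB ε e m w)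
      = ((m : ℂ) - n) • virasoroOp B hB ε e (m + n) w
        + (if m + n = 0 then ((m : ℂ) ^ 3 - m) / 12 * r else 0) • w := by
  classical
  let X : Unit → Module.End ℂ (LatticeSpace L r) := fun _ =>
    virasoroOp B hB ε e m * virasoroOp B hB ε e n - virasoroOp B hB ε e n * virasoroOp B hB ε e m
      - (((m : ℂ) - n) • virasoroOp B hB ε e (m + n)
        + (if m + n = 0 then ((m : ℂ) ^ 3 - m) / 12 * r else 0) • 1)
  have hXa : ∀ w, X () w = virasoroOp B hB ε e m (virasoroOp B hB ε e n w)
        - virasoroOp B hB ε e n (virasoroOp B hB ε e m w)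
      - (((m : ℂ) - n) • virasoroOp B hB ε e (m + n) w
        + (if m + n = 0 then ((m : ℂ) ^ 3 - m) / 12 * r else 0) • w) := fun w => rfl
  have hX : X () = 0 := by
    refine eq_zero_of_vev he (fun u k _ => ?_) (fun _ mu nu => ?_) ()
    · have h : heisenberg B ε u k * X () - X () * heisenberg B ε u k = 0 := by
        refine LinearMap.ext fun w => ?_
        have hc : ∀ m w, heisenberg B ε u k (virasoroOp B hB ε e m w)
            = virasoroOp B hB ε e m (heisenberg B ε u k w)
              + (k : ℂ) • heisenberg B ε u (m + k) w := fun m w =>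
          sub_eq_iff_eq_add'.1 (heisenberg_virasoroOp hB he u k m w)
        have hc' : ∀ m j w, virasoroOp B hB ε e m (heisenberg B ε u j w)
            = heisenberg B ε u j (virasoroOp B hB ε e m w)
              - (j : ℂ) • heisenberg B ε u (m + j) w := fun m j w =>
          eq_sub_of_add_eq (sub_eq_iff_eq_add'.1 (heisenberg_virasoroOp hB he u j m w)).symm
        rw [LinearMap.sub_apply, Module.End.mul_apply, Module.End.mul_apply, hXa, hXa,
          LinearMap.zero_apply]
        simp only [hc', map_sub, map_add, map_smul]
        rw [show m + (n + k) = m + n + k by ring, show n + (m + k) = m + n + k by ring]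
        push_cast
        module
      exact (congrArg (· ∈ _) h).mpr (Submodule.zero_mem _)
    · rw [hXa, map_sub, map_sub, map_add, map_smul, map_smul, vev_virasoroOp_virasoroOp hB he,
        vev_virasoroOp_virasoroOp hB he, vev_single, map_one, smul_eq_mul, smul_eq_mul]
      by_cases hmn : m + n = 0
      · obtain rfl : n = -m := by omega
        rw [hmn, vev_virasoroOp_zero hB he, vev_single, map_one]
        by_cases hmu : mu = nu
        · simp only [hmu, true_and, neg_add_cancel, if_true]
          rcases lt_trichotomy m 0 with hm | rfl | hm
          · rw [if_neg hm.not_gt, if_neg hm.ne, if_pos (by omega)]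
            push_cast
            ring
          · simp
          · rw [if_pos hm, if_neg (by omega), if_neg (by omega)]
            push_cast
            ring
        · simp only [hmu, false_and, if_false]
          ring
      · have h0 : vev nu (virasoroOp B hB ε e (m + n) (Finsupp.single mu 1)) = 0 := by
          rcases lt_or_gt_of_ne hmn with h | h
          · exact vev_virasoroOp_of_neg hB e h _ _
          · rw [virasoroOp_single_one_of_pos hB e h, map_zero]
        rw [h0, if_neg (fun h => hmn h.2), if_neg (fun h => hmn (by omega)), if_neg hmn]
        ring
  exact sub_eq_zero.1 ((hXa w).symm.trans (LinearMap.congr_fun hX w))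

/-- `L(0)` is diagonal on the monomials: `εᵢ(-k-1)` raises the weight by `k + 1`, and `v_μ` has
weight `⟨μ, μ⟩ / 2`. -/
theorem virasoroOp_zero_monomial (hB : B.IsSymm) {e : Fin r → ℂ ⊗[ℤ] L}
    (he : ∀ i j, B.baseChange ℂ (e i) (1 ⊗ₜ[ℤ] ε j) = if i = j then 1 else 0) (mu : L)
    (s : Fin r × ℕ →₀ ℕ) :
    virasoroOp B hB ε e 0 (Finsupp.single mu (monomial s 1))
      = (((s.sum fun x n => n * (x.2 + 1) : ℕ) : ℂ) + (B mu mu : ℂ) / 2)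
        • Finsupp.single mu (monomial s 1) := by
  have h : ∀ xs : List (Fin r × ℕ), virasoroOp B hB ε e 0 (Finsupp.single mu (xs.map X).prod)
      = ((((xs.map fun x => x.2 + 1).sum : ℕ) : ℂ) + (B mu mu : ℂ) / 2)
        • Finsupp.single mu (xs.map X).prod := by
    intro xs
    induction xs with
    | nil =>
      rw [List.map_nil, List.prod_nil, virasoroOp_zero_single_one hB he]
      simp
    | cons x xs ih =>
      have hx : Finsupp.single mu (((x :: xs).map X).prod : Fock r)
          = heisenberg B ε (1 ⊗ₜ[ℤ] ε x.1) (-x.2 - 1) (Finsupp.single mu (xs.map X).prod) := by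
        rw [heisenberg_single_of_ne _ (by omega), oscillator_negSucc, creator_basis]
        rfl
      have hc := heisenberg_virasoroOp (ε := ε) hB he (1 ⊗ₜ[ℤ] ε x.1) (-x.2 - 1) 0
        (Finsupp.single mu (xs.map X).prod)
      rw [ih, map_smul, ← hx, zero_add, ← hx, sub_eq_iff_eq_add] at hc
      have hsum : ((x :: xs).map fun x => x.2 + 1).sum
          = x.2 + 1 + (xs.map fun x => x.2 + 1).sum := by rw [List.map_cons, List.sum_cons]
      rw [hsum, ← sub_eq_iff_eq_add'.2 hc]
      push_cast
      module
  have hs : (s.sum fun x n => n * (x.2 + 1))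
      = ((Finsupp.toMultiset s).toList.map fun x => x.2 + 1).sum := by
    rw [← Multiset.sum_coe, ← Multiset.map_coe, Multiset.coe_toList]
    induction s using Finsupp.induction_linear with
    | zero => simp
    | add s t hs ht =>
      rw [Finsupp.sum_add_index' (fun _ => zero_mul _) (fun _ _ _ => add_mul _ _ _), hs, ht,
        map_add, Multiset.map_add, Multiset.sum_add]
    | single x n =>
      rw [Finsupp.sum_single_index (zero_mul _), Finsupp.toMultiset_single, Multiset.map_nsmul,
        Multiset.map_singleton, Multiset.sum_nsmul, Multiset.sum_singleton, smul_eq_mul]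
  rw [monomial_eq_prod_toList, h, hs]

/-! ### The modes of the conformal vector -/

theorem vertexField_zero_lattice (hB : B.IsSymm) (n : ℤ) (w : LatticeSpace L r) :
    (vertexField B hB b ε 0).mode n w = if n = -1 then w else 0 := by
  have h := latticeMode_monomial (b := b) (ε := ε) hB n 0 0
  rw [monomial_zero', C_1, map_zero, Multiset.toList_zero, latticeMode_vacuum_left] at h
  change (monomialField B hB b ε 0 []).mode n w = _
  rw [← h]
  split_ifs <;> rfl

theorem latticeMode_basis_pair (hB : B.IsSymm) {e : Fin r → ℂ ⊗[ℤ] L}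
    (he : ∀ i j, B.baseChange ℂ (e i) (1 ⊗ₜ[ℤ] ε j) = if i = j then 1 else 0) (i j : Fin r)
    (n : ℤ) :
    latticeMode B hB b ε n (heisenberg B ε (1 ⊗ₜ[ℤ] ε i) (-1)
        (heisenberg B ε (1 ⊗ₜ[ℤ] ε j) (-1) (Finsupp.single 0 1)))
      = (quadraticField B hB ε (1 ⊗ₜ[ℤ] ε i) (1 ⊗ₜ[ℤ] ε j)).mode n := by
  have h : ∀ i j, monomialField B hB b ε 0 [(i, 0), (j, 0)]
      = quadraticField B hB ε (1 ⊗ₜ[ℤ] ε i) (1 ⊗ₜ[ℤ] ε j) := fun i j => by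
    rw [monomialField, monomialField, monomialField, FormalField.deriv_zero,
      FormalField.deriv_zero, FormalField.nord_of_identity _ _ (vertexField_zero_lattice hB),
      quadraticField]
  have hm : heisenberg B ε (1 ⊗ₜ[ℤ] ε i) (-1)
      (heisenberg B ε (1 ⊗ₜ[ℤ] ε j) (-1) (Finsupp.single 0 1))
      = Finsupp.single 0 (monomial (Finsupp.single (i, 0) 1 + Finsupp.single (j, 0) 1) 1) := by
    have hX : ∀ (i : Fin r) (p : Fock r), oscillator B ε (1 ⊗ₜ[ℤ] ε i) (-1) p = X (i, 0) * p :=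
      fun i p => by
        have := oscillator_negSucc (B := B) (ε := ε) (1 ⊗ₜ[ℤ] ε i) 0 p
        rwa [creator_basis] at this
    rw [heisenberg_single_of_ne _ (by omega), heisenberg_single_of_ne _ (by omega), hX, hX,
      mul_one, X, X, monomial_mul, mul_one]
  rw [hm, latticeMode_monomial, map_add, Finsupp.toMultiset_single, Finsupp.toMultiset_single,
    one_smul, one_smul]
  have hp : (({(i, 0)} + {(j, 0)} : Multiset (Fin r × ℕ)).toList).Perm [(i, 0), (j, 0)] := by
    rw [← Multiset.coe_eq_coe, Multiset.coe_toList]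
    rfl
  -- Either order of the two factors may be the one chosen by `Multiset.toList`.
  rcases List.perm_pair.1 hp with h' | h'
  · rw [h', h]
  · rw [h', h, quadraticField_comm hB he]

/-- The modes of `u(-1) εⱼ(-1) v₀` are those of `:u(z) εⱼ(z):`. -/
theorem latticeMode_pair (hB : B.IsSymm) {e : Fin r → ℂ ⊗[ℤ] L}
    (he : ∀ i j, B.baseChange ℂ (e i) (1 ⊗ₜ[ℤ] ε j) = if i = j then 1 else 0) (u : ℂ ⊗[ℤ] L)
    (j : Fin r) (n : ℤ) (w : LatticeSpace L r) :
    latticeMode B hB b ε n (heisenberg B ε u (-1)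
        (heisenberg B ε (1 ⊗ₜ[ℤ] ε j) (-1) (Finsupp.single 0 1))) w
      = (quadraticField B hB ε u (1 ⊗ₜ[ℤ] ε j)).mode n w := by
  have hu : ∀ m w, heisenberg B ε u m w
      = ∑ i, B.baseChange ℂ u (e i) • heisenberg B ε (1 ⊗ₜ[ℤ] ε i) m w := fun m w => by
    conv_lhs => rw [← sum_baseChange_dual_smul hB he u]
    simp only [← heisenbergMap_apply, map_sum, map_smul, LinearMap.sum_apply, LinearMap.smul_apply]
  rw [hu, map_sum, LinearMap.sum_apply, quadraticField, FormalField.nord_add_smul_left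
    Finset.univ (fun i => B.baseChange ℂ u (e i))
    (fun i => heisenbergField B hB ε (1 ⊗ₜ[ℤ] ε i)) _ _ hu]
  refine Finset.sum_congr rfl fun i _ => ?_
  rw [map_smul, LinearMap.smul_apply, latticeMode_basis_pair hB he, quadraticField]

/-- The extension of scalars `ℚ ⊗ L → ℂ ⊗ L`. -/
abbrev complexify (L : Type*) [AddCommGroup L] : ℚ ⊗[ℤ] L →ₗ[ℤ] ℂ ⊗[ℤ] L :=
  LinearMap.rTensor L (Algebra.linearMap ℚ ℂ |>.restrictScalars ℤ)

theorem baseChange_complexify (x : ℚ ⊗[ℤ] L) (y : L) :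
    B.baseChange ℂ (complexify L x) (1 ⊗ₜ[ℤ] y) = (B.baseChange ℚ x (1 ⊗ₜ[ℤ] y) : ℚ) := by
  induction x using TensorProduct.induction_on with
  | zero => simp
  | tmul q l =>
    change B.baseChange ℂ (algebraMap ℚ ℂ q ⊗ₜ[ℤ] l) (1 ⊗ₜ[ℤ] y) = _
    rw [LinearMap.BilinForm.baseChange_tmul,
      LinearMap.BilinForm.baseChange_tmul]
    simp
  | add x x' hx hx' => simp only [map_add, LinearMap.add_apply, hx, hx', Rat.cast_add]

theorem dual_complexify {ε' : Fin r → ℚ ⊗[ℤ] L}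
    (hε' : ∀ i j, B.baseChange ℚ (ε' i) (1 ⊗ₜ[ℤ] ε j) = if i = j then 1 else 0) (i j : Fin r) :
    B.baseChange ℂ (complexify L (ε' i)) (1 ⊗ₜ[ℤ] ε j) = if i = j then 1 else 0 := by
  rw [baseChange_complexify, hε']
  split_ifs <;> simp

theorem latticeMode_coneOmega (hB : B.IsSymm) {ε' : Fin r → ℚ ⊗[ℤ] L}
    (hε' : ∀ i j, B.baseChange ℚ (ε' i) (1 ⊗ₜ[ℤ] ε j) = if i = j then 1 else 0) (m : ℤ)
    (w : LatticeSpace L r) :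
    latticeMode B hB b ε (m + 1) (coneOmega B ε ε') w
      = virasoroOp B hB ε (fun i => complexify L (ε' i)) m w := by
  rw [virasoroOp_apply, coneOmega, map_smul, map_sum, LinearMap.smul_apply, LinearMap.sum_apply]
  congr 1
  exact Finset.sum_congr rfl fun i _ => latticeMode_pair hB (dual_complexify hε') _ i _ w

theorem theta_vacuum : theta (Finsupp.single 0 1 : LatticeSpace L r) = Finsupp.single 0 1 := by
  rw [theta_single, neg_zero, map_one]

theorem theta_coneOmega (ε' : Fin r → ℚ ⊗[ℤ] L) :
    theta (coneOmega B ε ε' : LatticeSpace L r) = coneOmega B ε ε' := by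
  simp only [coneOmega, map_smul, map_sum, theta_heisenberg, theta_vacuum, smul_smul]
  norm_num

/-! ### The cone space -/

theorem compP_add (x y : LatticeSpace L r) : compP ε (x + y) = compP ε x + compP ε y := by
  classical exact Finsupp.filter_add

theorem compN_add (x y : LatticeSpace L r) : compN ε (x + y) = compN ε x + compN ε y := by
  classical exact Finsupp.filter_add

theorem compP_smul (c : ℂ) (x : LatticeSpace L r) : compP ε (c • x) = c • compP ε x := by
  classical exact Finsupp.filter_smul

theorem compN_smul (c : ℂ) (x : LatticeSpace L r) : compN ε (c • x) = c • compN ε x := by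
  classical exact Finsupp.filter_smul

theorem compP_add_compN (x : LatticeSpace L r) : compP ε x + compN ε x = x := by
  classical
  unfold compP compN
  convert Finsupp.filter_add_filter_not x _

theorem compP_eq_self {x : LatticeSpace L r} (hx : x ∈ subspaceOn (latticePoints (coneP ε))) :
    compP ε x = x := by
  classical
  exact (Finsupp.filter_eq_self_iff _ _).2 fun l hl => hx (Finsupp.mem_support_iff.2 hl)

theorem compN_eq_zero {x : LatticeSpace L r} (hx : x ∈ subspaceOn (latticePoints (coneP ε))) :
    compN ε x = 0 := by
  have h := compP_add_compN (ε := ε) x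
  rwa [compP_eq_self hx, add_eq_left] at h

theorem compP_eq_zero {x : LatticeSpace L r} (hx : x ∈ subspaceOn (latticePoints (coneP ε))ᶜ) :
    compP ε x = 0 := by
  classical
  exact (Finsupp.filter_eq_zero_iff _ _).2 fun l hl => by
    by_contra h
    exact hx (Finsupp.mem_support_iff.2 h) hl

theorem compN_eq_self {x : LatticeSpace L r} (hx : x ∈ subspaceOn (latticePoints (coneP ε))ᶜ) :
    compN ε x = x := by
  have h := compP_add_compN (ε := ε) x
  rwa [compP_eq_zero hx, zero_add] at h

theorem compN_mem_compl (x : LatticeSpace L r) :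
    compN ε x ∈ subspaceOn (r := r) (latticePoints (coneP ε))ᶜ := by
  classical
  intro μ hμ
  have h : μ ∈ x.support ∧ μ ∉ latticePoints (coneP ε) := by
    simpa [compN, Finsupp.support_filter] using hμ
  exact h.2

theorem compP_compN_mem {K : Set L} {x : LatticeSpace L r} (hx : x ∈ subspaceOn K) :
    compP ε x ∈ subspaceOn (r := r) K ∧ compN ε x ∈ subspaceOn (r := r) K := by
  classical
  constructor <;> intro μ hμ
  · have h : μ ∈ x.support ∧ μ ∈ latticePoints (coneP ε) := by
      simpa [compP, Finsupp.support_filter] using hμ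
    exact hx h.1
  · have h : μ ∈ x.support ∧ μ ∉ latticePoints (coneP ε) := by
      simpa [compN, Finsupp.support_filter] using hμ
    exact hx h.1

/-- The linear map `x + y ↦ x + s θ(y)`, for `x ∈ V_{P(L)}` and `y ∈ V_{N(L)}`. -/
def coneFold (ε : Module.Basis (Fin r) ℤ L) (s : ℂ) : ConeSpace ε →ₗ[ℂ] LatticeSpace L r where
  toFun x := compP ε x + s • theta (compN ε x)
  map_add' x y := by
    simp only [Submodule.coe_add, compP_add, compN_add, map_add, smul_add]
    abel
  map_smul' c x := by
    simp only [Submodule.coe_smul, compP_smul, compN_smul, map_smul, smul_add, RingHom.id_apply]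
    rw [smul_comm]

theorem coneFold_apply (s : ℂ) (x : ConeSpace ε) :
    coneFold ε s x = compP ε x + s • theta (compN ε (x : LatticeSpace L r)) := rfl

/-- The maps `coneFold ε 1` and `coneFold ε (-1)` are jointly injective. -/
theorem coneFold_injective {x y : ConeSpace ε} (h : ∀ s : ℂ, s * s = 1 →
    coneFold ε s x = coneFold ε s y) : x = y := by
  have h₁ := h 1 (by norm_num)
  have h₂ := h (-1) (by norm_num)
  rw [coneFold_apply, coneFold_apply] at h₁ h₂
  have hP : compP ε (x : LatticeSpace L r) = compP ε y := by
    have h₃ : (2 : ℂ) • compP ε (x : LatticeSpace L r)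
        = (2 : ℂ) • compP ε (y : LatticeSpace L r) := by
      have key : ∀ p a q c : LatticeSpace L r, p + (1 : ℂ) • a = q + (1 : ℂ) • c →
          p + (-1 : ℂ) • a = q + (-1 : ℂ) • c → (2 : ℂ) • p = (2 : ℂ) • q := by
        intro p a q c h h'
        calc (2 : ℂ) • p = (p + (1 : ℂ) • a) + (p + (-1 : ℂ) • a) := by module
          _ = (q + (1 : ℂ) • c) + (q + (-1 : ℂ) • c) := by rw [h, h']
          _ = (2 : ℂ) • q := by module
      exact key _ _ _ _ h₁ h₂
    exact smul_right_injective _ (two_ne_zero' ℂ) h₃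
  have hN : theta (compN ε (x : LatticeSpace L r)) = theta (compN ε y) := by
    rw [hP, one_smul, one_smul] at h₁
    exact add_left_cancel h₁
  have hN' := congrArg theta hN
  rw [theta_theta, theta_theta] at hN'
  apply Subtype.ext
  rw [← compP_add_compN (ε := ε) (x : LatticeSpace L r), hP, hN', compP_add_compN]

/-- The maps `coneFold ε s`, `s = ±1`, intertwine the vertex operators of `V_{D(L)}` with those of
`V_L`. -/
theorem coneFold_coneY (hB : B.IsSymm) {e : Fin r → ℂ ⊗[ℤ] L}
    (he : ∀ i j, B.baseChange ℂ (e i) (1 ⊗ₜ[ℤ] ε j) = if i = j then 1 else 0) {s : ℂ}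
    (hs : s * s = 1) (x : ConeSpace ε) (n : ℤ) (y : ConeSpace ε) :
    coneFold ε s (coneY B b ε x n y)
      = latticeMode B hB b ε n (coneFold ε s x) (coneFold ε s y) := by
  set xP := compP ε (x : LatticeSpace L r) with hxP
  set xN := compN ε (x : LatticeSpace L r) with hxN
  set yP := compP ε (y : LatticeSpace L r) with hyP
  set yN := compN ε (y : LatticeSpace L r) with hyN
  have htw : ((coneY B b ε x n y : ConeSpace ε) : LatticeSpace L r)
      = (latticeMode B hB b ε n xP yP + theta (latticeMode B hB b ε n xN yN))
        + (latticeMode B hB b ε n (theta xP) yN + latticeMode B hB b ε n xN (theta yP)) := by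
    simp only [latticeMode_apply]
    change twistedY B b ε x n y = _
    rw [twistedY]
    abel
  have hP : latticeMode B hB b ε n xP yP + theta (latticeMode B hB b ε n xN yN)
      ∈ subspaceOn (r := r) (latticePoints (coneP ε)) := by
    simp only [latticeMode_apply]
    refine Submodule.add_mem _ ?_ ?_
    · exact latticeY_mem B b ε (fun _ h _ h' => add_mem_coneP h h') n (compP_mem ε _)
        (compP_mem ε _)
    · exact theta_mem (fun _ h => neg_mem_coneP h) (latticeY_mem B b ε
        (fun _ h _ h' => add_mem_coneN h h') n (compN_mem ε x.2) (compN_mem ε y.2))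
  -- If `-λ + μ` lies in `P` for some `λ` in `P`, then so does `μ`.
  have hN : latticeMode B hB b ε n (theta xP) yN + latticeMode B hB b ε n xN (theta yP)
      ∈ subspaceOn (r := r) (latticePoints (coneP ε))ᶜ := by
    have hneg : ∀ lam ∈ latticePoints (coneP ε), -lam ∈ {z | -z ∈ latticePoints (coneP ε)} :=
      fun lam h => by simpa using h
    simp only [latticeMode_apply]
    refine Submodule.add_mem _ ?_ ?_
    · refine latticeY_mem B b ε (K := {z | -z ∈ latticePoints (coneP ε)})
        (K' := (latticePoints (coneP ε))ᶜ) (K'' := (latticePoints (coneP ε))ᶜ)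
        (fun l h m h' hlm => h' ?_) n
        (theta_mem hneg (compP_mem ε _)) (compN_mem_compl _)
      have := add_mem_coneP (show -l ∈ latticePoints (coneP ε) from h) hlm
      rwa [neg_add_cancel_left] at this
    · refine latticeY_mem B b ε (K := (latticePoints (coneP ε))ᶜ)
        (K' := {z | -z ∈ latticePoints (coneP ε)}) (K'' := (latticePoints (coneP ε))ᶜ)
        (fun l h m h' hlm => h ?_) n
        (compN_mem_compl _)
        (theta_mem hneg (compP_mem ε _))
      have := add_mem_coneP hlm (show -m ∈ latticePoints (coneP ε) from h')
      rwa [add_neg_cancel_right] at this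
  rw [coneFold_apply, htw, compP_add, compN_add, compP_eq_self hP, compP_eq_zero hN,
    compN_eq_zero hP, compN_eq_self hN, coneFold_apply, coneFold_apply, ← hxP, ← hxN, ← hyP, ← hyN]
  simp only [map_add, map_smul, LinearMap.add_apply, LinearMap.smul_apply, smul_add,
    theta_latticeMode hB he, theta_theta, smul_smul, hs, one_smul, add_zero, zero_add]
  abel

theorem coneFold_coneVac (s : ℂ) : coneFold ε s (coneVac ε) = Finsupp.single 0 1 := by
  have h : (coneVac ε : LatticeSpace L r) ∈ subspaceOn (r := r) (latticePoints (coneP ε)) :=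
    Finsupp.single_mem_supported ℂ _ ⟨0, fun _ => le_rfl, by simp⟩
  rw [coneFold_apply, compP_eq_self h, compN_eq_zero h, map_zero, smul_zero, add_zero]
  rfl

theorem coneOmega_mem_P (ε' : Fin r → ℚ ⊗[ℤ] L) {K : Set L} (hK : (0 : L) ∈ K) :
    (coneOmega B ε ε' : LatticeSpace L r) ∈ subspaceOn (r := r) K :=
  Submodule.smul_mem _ _ (Submodule.sum_mem _ fun _ _ => heisenberg_mem B ε _ _
    (heisenberg_mem B ε _ _ (Finsupp.single_mem_supported ℂ _ hK)))

theorem zero_mem_coneP : (0 : L) ∈ latticePoints (coneP ε) := ⟨0, fun _ => le_rfl, by simp⟩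

theorem coneFold_coneOmega (ε' : Fin r → ℚ ⊗[ℤ] L) (s : ℂ) :
    coneFold ε s (coneOmega B ε ε') = coneOmega B ε ε' := by
  have h := coneOmega_mem_P (B := B) (ε := ε) ε' (zero_mem_coneP (ε := ε))
  rw [coneFold_apply, compP_eq_self h, compN_eq_zero h, map_zero, smul_zero, add_zero]

/-- The operators `L(m)` of `V_{D(L)}` are the restrictions of those of `V_L`. -/
theorem coneY_coneOmega (hB : B.IsSymm) {ε' : Fin r → ℚ ⊗[ℤ] L}
    (hε' : ∀ i j, B.baseChange ℚ (ε' i) (1 ⊗ₜ[ℤ] ε j) = if i = j then 1 else 0) (m : ℤ)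
    (x : ConeSpace ε) : (coneY B b ε (coneOmega B ε ε') (m + 1) x : LatticeSpace L r)
      = virasoroOp B hB ε (fun i => complexify L (ε' i)) m x := by
  have h := coneOmega_mem_P (B := B) (ε := ε) ε' (zero_mem_coneP (ε := ε))
  change twistedY B b ε _ _ _ = _
  rw [twistedY, compP_eq_self h, compN_eq_zero h, theta_coneOmega]
  simp only [← latticeMode_apply hB, map_zero, LinearMap.zero_apply, add_zero]
  rw [← map_add, compP_add_compN, latticeMode_coneOmega hB hε']

end Lattice

/-! ### The super vertex algebra of the cone -/

theorem isInternal_of_forall {V : Type*} [AddCommGroup V] [Module ℂ V]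
    {par : ZMod 2 → Submodule ℂ V} (h : ∀ x, x ∈ par 0 → x ∈ par 1 → x = 0)
    (h' : ∀ x, ∃ y ∈ par 0, ∃ z ∈ par 1, y + z = x) : DirectSum.IsInternal par := by
  have h2 : ∀ i : ZMod 2, i = 0 ∨ i = 1 := by decide
  exact (DirectSum.isInternal_submodule_iff_isCompl par zero_ne_one
    (Set.ext fun i => by simpa using h2 i)).2 ⟨Submodule.disjoint_def.2 h,
      codisjoint_iff.2 (Submodule.eq_top_iff'.2 fun x => Submodule.mem_sup.2 (h' x))⟩

section Lattice

variable {L : Type*} [AddCommGroup L] {r : ℕ} {B : LinearMap.BilinForm ℤ L}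
  {ε : Module.Basis (Fin r) ℤ L} {b : L →+ L →+ ZMod 2}

open MvPolynomial

/-- The set of lattice points `λ` with `⟨λ, λ⟩ ≡ i` modulo `2`. -/
abbrev parityClass (B : LinearMap.BilinForm ℤ L) (i : ZMod 2) : Set L :=
  {lam | (B lam lam : ZMod 2) = i}

theorem neg_mem_parityClass {i : ZMod 2} {lam : L} (h : lam ∈ parityClass B i) :
    -lam ∈ parityClass B i := by
  simpa [parityClass] using h

theorem add_mem_parityClass (hB : B.IsSymm) {i j : ZMod 2} {lam mu : L}
    (h : lam ∈ parityClass B i) (h' : mu ∈ parityClass B j) : lam + mu ∈ parityClass B (i + j) := by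
  have h₁ : B (lam + mu) (lam + mu) = B lam lam + B mu mu + (B lam mu + B lam mu) := by
    have := hB.eq mu lam
    simp only [map_add, LinearMap.add_apply]
    change B mu lam = B lam mu at this
    rw [this]
    ring
  change ((B (lam + mu) (lam + mu) : ℤ) : ZMod 2) = i + j
  rw [h₁, Int.cast_add, Int.cast_add, Int.cast_add, CharTwo.add_self_eq_zero, add_zero,
    show ((B lam lam : ℤ) : ZMod 2) = i from h, show ((B mu mu : ℤ) : ZMod 2) = j from h']

theorem eq_zero_of_mem_conePar (x : ConeSpace ε) (h₀ : x ∈ conePar B ε 0)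
    (h₁ : x ∈ conePar B ε 1) : x = 0 := by
  refine Subtype.ext (Finsupp.support_eq_empty.1
    (Finset.eq_empty_of_forall_notMem fun lam hlam => zero_ne_one (α := ZMod 2) ?_))
  have h₀' : ((B lam lam : ℤ) : ZMod 2) = 0 := h₀ hlam
  have h₁' : ((B lam lam : ℤ) : ZMod 2) = 1 := h₁ hlam
  exact h₀'.symm.trans h₁'

theorem exists_add_conePar (x : ConeSpace ε) :
    ∃ y ∈ conePar B ε 0, ∃ z ∈ conePar B ε 1, y + z = x := by
  classical
  let p : L → Prop := fun lam => ((B lam lam : ℤ) : ZMod 2) = 0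
  have hm : ∀ (q : L → Prop) [DecidablePred q] (lam : L),
      lam ∈ ((x : LatticeSpace L r).filter q).support → lam ∈ latticePoints (coneD ε) ∧ q lam := by
    intro q _ lam hlam
    rw [Finsupp.support_filter, Finset.mem_filter] at hlam
    exact ⟨x.2 hlam.1, hlam.2⟩
  have h2 : ∀ i : ZMod 2, ¬i = 0 → i = 1 := by decide
  let y : ConeSpace ε := ⟨(x : LatticeSpace L r).filter p, fun lam h => (hm p lam h).1⟩
  let z : ConeSpace ε := ⟨(x : LatticeSpace L r).filter fun lam => ¬p lam,
    fun lam h => (hm _ lam h).1⟩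
  have hy : y ∈ conePar B ε 0 := fun lam h => (hm p lam h).2
  have hz : z ∈ conePar B ε 1 := fun lam h => h2 _ (hm _ lam h).2
  exact ⟨y, hy, z, hz, Subtype.ext (Finsupp.filter_add_filter_not _ _)⟩

theorem coneFold_mem {i : ZMod 2} {x : ConeSpace ε} (hx : x ∈ conePar B ε i) (s : ℂ) :
    coneFold ε s x ∈ subspaceOn (r := r) (parityClass B i) := by
  have h := compP_compN_mem (ε := ε) (show (x : LatticeSpace L r) ∈ subspaceOn (parityClass B i)
    from hx)
  exact Submodule.add_mem _ h.1 (Submodule.smul_mem _ _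
    (theta_mem (fun _ => neg_mem_parityClass) h.2))

theorem mem_conePar_of_coneFold {i : ZMod 2} {x : ConeSpace ε}
    (h : ∀ s : ℂ, s * s = 1 → coneFold ε s x ∈ subspaceOn (r := r) (parityClass B i)) :
    x ∈ conePar B ε i := by
  have h₁ := h 1 (by norm_num)
  have h₂ := h (-1) (by norm_num)
  rw [coneFold_apply] at h₁ h₂
  have hP : compP ε (x : LatticeSpace L r) ∈ subspaceOn (r := r) (parityClass B i) := by
    have := Submodule.smul_mem _ (1 / 2 : ℂ) (Submodule.add_mem _ h₁ h₂)
    convert this using 1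
    module
  have hN : theta (compN ε (x : LatticeSpace L r)) ∈ subspaceOn (r := r) (parityClass B i) := by
    have := Submodule.sub_mem _ h₁ hP
    rwa [add_sub_cancel_left, one_smul] at this
  have hN' := theta_mem (fun _ => neg_mem_parityClass) hN
  rw [theta_theta] at hN'
  have := Submodule.add_mem _ hP hN'
  rwa [compP_add_compN] at this

/-- `V_{D(L)}` is a super vertex algebra: the maps `coneFold ε s`, `s = ±1`, are jointly injective
and intertwine the vertex operators, so that all axioms are inherited from `V_L`. -/
theorem isSuperVertexAlgebra_cone (hB : B.IsSymm) {e : Fin r → ℂ ⊗[ℤ] L}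
    (he : ∀ i j, B.baseChange ℂ (e i) (1 ⊗ₜ[ℤ] ε j) = if i = j then 1 else 0)
    (hb : ∀ lam mu, b lam mu + b mu lam = ((B lam mu + B lam lam * B mu mu : ℤ) : ZMod 2)) :
    IsSuperVertexAlgebra (conePar B ε) (coneY B b ε) (coneVac ε) where
  add_left a a' n x := coneFold_injective fun s hs => by
    simp only [map_add, coneFold_coneY hB he hs, LinearMap.add_apply]
  smul_left c a n x := coneFold_injective fun s hs => by
    simp only [map_smul, coneFold_coneY hB he hs, LinearMap.smul_apply]
  add_right a n x y := coneFold_injective fun s hs => by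
    simp only [map_add, coneFold_coneY hB he hs]
  smul_right c a n x := coneFold_injective fun s hs => by
    simp only [map_smul, coneFold_coneY hB he hs]
  field a x := by
    obtain ⟨N, hN⟩ := latticeMode_trunc (b := b) (ε := ε) hB (coneFold ε 1 a) (coneFold ε 1 x)
    obtain ⟨N', hN'⟩ :=
      latticeMode_trunc (b := b) (ε := ε) hB (coneFold ε (-1) a) (coneFold ε (-1) x)
    refine ⟨max N N', fun n hn => coneFold_injective fun s hs => ?_⟩
    rw [coneFold_coneY hB he hs, map_zero]
    rcases mul_self_eq_one_iff.1 hs with rfl | rfl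
    · exact hN n ((le_max_left _ _).trans hn)
    · exact hN' n ((le_max_right _ _).trans hn)
  super := by
    have h := @isInternal_of_forall (ConeSpace ε) _ _ (conePar B ε) eq_zero_of_mem_conePar
      exists_add_conePar
    exact h
  parity i j a x ha hx n := mem_conePar_of_coneFold fun s hs => by
    rw [coneFold_coneY hB he hs, latticeMode_apply]
    exact latticeY_mem B b ε (fun _ h _ h' => add_mem_parityClass hB h h') n (coneFold_mem ha s)
      (coneFold_mem hx s)
  vac_even := Finsupp.single_mem_supported ℂ _ (by simp)
  vacuum n x := coneFold_injective fun s hs => by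
    rw [coneFold_coneY hB he hs, coneFold_coneVac, latticeMode_vacuum_left,
      apply_ite (coneFold ε s), map_zero]
    split_ifs <;> rfl
  creation a := by
    refine ⟨coneFold_injective fun s hs => ?_, fun n hn => coneFold_injective fun s hs => ?_⟩
    · rw [coneFold_coneY hB he hs, coneFold_coneVac, (latticeMode_vacuum_right hB _).1]
    · rw [coneFold_coneY hB he hs, coneFold_coneVac, (latticeMode_vacuum_right hB _).2 n hn,
        map_zero]
  translation a n x := coneFold_injective fun s hs => by
    rw [map_sub, map_smul]
    simp only [coneFold_coneY hB he hs, coneFold_coneVac, latticeMode_neg_two_vacuum hB he]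
    exact translationOp_latticeMode hB he _ _ _
  locality i j a x ha hx := by
    have hl : ∀ s, ∃ N : ℕ, (zwMul _ ^ N) (fun m n => latticeMode B hB b ε m (coneFold ε s a)
        * latticeMode B hB b ε n (coneFold ε s x) - sgn (i * j)
          • (latticeMode B hB b ε n (coneFold ε s x) * latticeMode B hB b ε m (coneFold ε s a)))
        = 0 := fun s => isLocal_latticeMode hB he hb (coneFold_mem ha s) (coneFold_mem hx s)
    obtain ⟨N, hN⟩ := hl 1
    obtain ⟨N', hN'⟩ := hl (-1)
    refine ⟨max N N', fun m n c => coneFold_injective fun s hs => ?_⟩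
    have h : (zwMul _ ^ max N N') (fun m n => latticeMode B hB b ε m (coneFold ε s a)
        * latticeMode B hB b ε n (coneFold ε s x) - sgn (i * j)
          • (latticeMode B hB b ε n (coneFold ε s x) * latticeMode B hB b ε m (coneFold ε s a)))
        = 0 := by
      rcases mul_self_eq_one_iff.1 hs with rfl | rfl
      · exact zwMul_pow_eq_zero_of_le (le_max_left _ _) hN
      · exact zwMul_pow_eq_zero_of_le (le_max_right _ _) hN'
    have h' := LinearMap.congr_fun ((zwMul_pow_apply _ _ m n).symm.trans (congrFun₂ h m n))
      (coneFold ε s c)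
    rw [LinearMap.sum_apply] at h'
    rw [map_sum, map_zero]
    refine Eq.trans (Finset.sum_congr rfl fun k _ => ?_) h'
    rw [map_smul, map_sub, map_smul]
    simp only [coneFold_coneY hB he hs, ← sgn_mul]
    rfl

end Lattice

section Eigenspaces

variable {W : Type*} [AddCommGroup W] [Module ℂ W] {ι : Type*}

/-! ### The grading by conformal weights -/

theorem isInternal_eigenspace_half {H : Module.End ℂ W} {v : ι → W} {d : ι → ℤ}
    (hv : ∀ i, H (v i) = ((d i : ℂ) / 2) • v i) (hs : ∀ x, x ∈ Submodule.span ℂ (Set.range v)) :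
    DirectSum.IsInternal fun k : ℤ => H.eigenspace ((k : ℂ) / 2) := by
  refine DirectSum.isInternal_submodule_of_iSupIndep_of_iSup_eq_top ?_ ?_
  · refine (Module.End.eigenspaces_iSupIndep H).comp (f := fun k : ℤ => (k : ℂ) / 2) ?_
    intro k l h
    have h' : (k : ℂ) / 2 = (l : ℂ) / 2 := h
    have : (k : ℂ) = l := by linear_combination 2 * h'
    exact_mod_cast this
  · refine Submodule.eq_top_iff'.2 fun x => ?_
    refine (Submodule.span_le.2 ?_ : Submodule.span ℂ (Set.range v) ≤ _) (hs x)
    rintro - ⟨i, rfl⟩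
    exact Submodule.mem_iSup_of_mem (d i) (Module.End.mem_eigenspace_iff.2 (hv i))

/-- An operator which is diagonal in some coordinates acts on a coordinate of an eigenvector by the
corresponding eigenvalue. -/
theorem eq_of_mem_eigenspace_half {H : Module.End ℂ W} {c : W →ₗ[ℂ] (ι → ℂ)} {d : ι → ℤ}
    (hH : ∀ x i, c (H x) i = (d i : ℂ) / 2 * c x i) {k : ℤ} {x : W}
    (hx : x ∈ H.eigenspace ((k : ℂ) / 2)) {i : ι} (hi : c x i ≠ 0) : d i = k := by
  have h := hH x i
  rw [Module.End.mem_eigenspace_iff.1 hx, map_smul, Pi.smul_apply, smul_eq_mul] at h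
  have h' := mul_right_cancel₀ hi h
  have : (d i : ℂ) = k := by linear_combination -2 * h'
  exact_mod_cast this

theorem finiteDimensional_eigenspace_half {H : Module.End ℂ W} {c : W →ₗ[ℂ] (ι → ℂ)} {d : ι → ℤ}
    (hc : ∀ x, c x = 0 → x = 0) (hH : ∀ x i, c (H x) i = (d i : ℂ) / 2 * c x i) {k : ℤ}
    (hk : {i | d i = k}.Finite) : FiniteDimensional ℂ (H.eigenspace ((k : ℂ) / 2)) := by
  have := hk.to_subtype
  let f : H.eigenspace ((k : ℂ) / 2) →ₗ[ℂ] ({i | d i = k} → ℂ) :=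
    LinearMap.funLeft ℂ ℂ Subtype.val ∘ₗ c ∘ₗ Submodule.subtype _
  refine FiniteDimensional.of_injective f ((injective_iff_map_eq_zero f).2 fun x hx => ?_)
  refine Subtype.ext (hc _ (funext fun i => ?_))
  by_contra hi
  exact hi (congrFun hx ⟨i, eq_of_mem_eigenspace_half hH x.2 hi⟩)

end Eigenspaces

section Lattice

variable {L : Type*} [AddCommGroup L] {r : ℕ} {B : LinearMap.BilinForm ℤ L}
  {ε : Module.Basis (Fin r) ℤ L} {b : L →+ L →+ ZMod 2}

open MvPolynomial

/-- The degree of a monomial, where `εᵢ(-k-1)` has degree `k + 1`. -/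
def oscillatorDegree (s : Fin r × ℕ →₀ ℕ) : ℕ := s.sum fun x n => n * (x.2 + 1)

/-- Twice the conformal weight of a monomial `s` times `v_λ`. -/
def twiceWeight (B : LinearMap.BilinForm ℤ L) (ε : Module.Basis (Fin r) ℤ L)
    (i : latticePoints (coneD ε) × (Fin r × ℕ →₀ ℕ)) : ℤ :=
  2 * oscillatorDegree i.2 + B i.1 i.1

theorem half_twiceWeight (i : latticePoints (coneD ε) × (Fin r × ℕ →₀ ℕ)) :
    (twiceWeight B ε i : ℂ) / 2
      = ((i.2.sum fun x n => n * (x.2 + 1) : ℕ) : ℂ) + (B i.1 i.1 : ℂ) / 2 := by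
  rw [twiceWeight, oscillatorDegree]
  push_cast
  ring

/-- The monomials of `V_{D(L)}`. -/
def coneMonomial (ε : Module.Basis (Fin r) ℤ L)
    (i : latticePoints (coneD ε) × (Fin r × ℕ →₀ ℕ)) : ConeSpace ε :=
  ⟨Finsupp.single i.1 (monomial i.2 1), Finsupp.single_mem_supported ℂ _ i.1.2⟩

theorem mem_span_coneMonomial (x : ConeSpace ε) :
    x ∈ Submodule.span ℂ (Set.range (coneMonomial ε)) := by
  let S := Submodule.span ℂ (Set.range (coneMonomial ε))
  have h : (x : LatticeSpace L r) ∈ S.map (Submodule.subtype _) := by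
    refine induction_monomial (P := fun a => a ∈ S.map (Submodule.subtype _))
      (Submodule.zero_mem _) (fun _ _ => Submodule.add_mem _) (fun c _ => Submodule.smul_mem _ c)
      (fun lam hlam s => ?_) x.2
    exact Submodule.mem_map.2 ⟨coneMonomial ε (⟨lam, hlam⟩, s), Submodule.subset_span ⟨_, rfl⟩, rfl⟩
  obtain ⟨y, hy, hyx⟩ := Submodule.mem_map.1 h
  rwa [← Subtype.ext hyx]

/-- The coordinates on `V_{D(L)}` with respect to the monomials. -/
def coneCoord (ε : Module.Basis (Fin r) ℤ L) :
    ConeSpace ε →ₗ[ℂ] (latticePoints (coneD ε) × (Fin r × ℕ →₀ ℕ) → ℂ) where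
  toFun x i := coeff i.2 ((x : LatticeSpace L r) i.1)
  map_add' x y := by
    ext i
    simp
  map_smul' c x := by
    ext i
    simp

theorem coneCoord_injective (x : ConeSpace ε) (hx : coneCoord ε x = 0) : x = 0 := by
  refine Subtype.ext (Finsupp.ext fun lam => ?_)
  by_cases h : lam ∈ latticePoints (coneD ε)
  · ext s
    exact congrFun hx (⟨lam, h⟩, s)
  · by_contra h'
    exact h (x.2 (Finsupp.mem_support_iff.2 h'))

theorem coeff_virasoroOp_zero (hB : B.IsSymm) {e : Fin r → ℂ ⊗[ℤ] L}
    (he : ∀ i j, B.baseChange ℂ (e i) (1 ⊗ₜ[ℤ] ε j) = if i = j then 1 else 0)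
    (w : LatticeSpace L r) (lam : L) (s : Fin r × ℕ →₀ ℕ) :
    coeff s (virasoroOp B hB ε e 0 w lam)
      = (((s.sum fun x n => n * (x.2 + 1) : ℕ) : ℂ) + (B lam lam : ℂ) / 2) * coeff s (w lam) := by
  classical
  have hw : w ∈ subspaceOn (r := r) (Set.univ : Set L) := Set.subset_univ _
  refine induction_monomial (P := fun w => coeff s (virasoroOp B hB ε e 0 w lam)
    = (((s.sum fun x n => n * (x.2 + 1) : ℕ) : ℂ) + (B lam lam : ℂ) / 2) * coeff s (w lam))
    ?_ ?_ ?_ ?_ hw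
  · simp
  · intro v w hv hw
    rw [map_add, Finsupp.add_apply, coeff_add, hv, hw, Finsupp.add_apply, coeff_add, mul_add]
  · intro c v hv
    rw [map_smul, Finsupp.smul_apply, coeff_smul, hv, Finsupp.smul_apply, coeff_smul, smul_eq_mul,
      smul_eq_mul, mul_left_comm]
  · rintro mu - t
    rw [virasoroOp_zero_monomial hB he, Finsupp.smul_apply, coeff_smul, smul_eq_mul,
      Finsupp.single_apply]
    split_ifs with h
    · rw [coeff_monomial]
      split_ifs with h'
      · rw [h, h']
      · rw [mul_zero, mul_zero]
    · rw [coeff_zero, mul_zero, mul_zero]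

theorem coneMonomial_eigenvector (hB : B.IsSymm) {ε' : Fin r → ℚ ⊗[ℤ] L}
    (hε' : ∀ i j, B.baseChange ℚ (ε' i) (1 ⊗ₜ[ℤ] ε j) = if i = j then 1 else 0)
    (i : latticePoints (coneD ε) × (Fin r × ℕ →₀ ℕ)) :
    coneY B b ε (coneOmega B ε ε') 1 (coneMonomial ε i)
      = ((twiceWeight B ε i : ℂ) / 2) • coneMonomial ε i := by
  refine Subtype.ext ((coneY_coneOmega hB hε' 0 _).trans ?_)
  rw [half_twiceWeight]
  exact virasoroOp_zero_monomial hB (dual_complexify hε') _ _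

theorem coneCoord_coneOmega (hB : B.IsSymm) {ε' : Fin r → ℚ ⊗[ℤ] L}
    (hε' : ∀ i j, B.baseChange ℚ (ε' i) (1 ⊗ₜ[ℤ] ε j) = if i = j then 1 else 0)
    (x : ConeSpace ε) (i : latticePoints (coneD ε) × (Fin r × ℕ →₀ ℕ)) :
    coneCoord ε (coneY B b ε (coneOmega B ε ε') 1 x) i
      = (twiceWeight B ε i : ℂ) / 2 * coneCoord ε x i := by
  rw [half_twiceWeight]
  change coeff i.2 ((coneY B b ε (coneOmega B ε ε') (0 + 1) x : LatticeSpace L r) i.1) = _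
  rw [coneY_coneOmega hB hε' 0]
  exact coeff_virasoroOp_zero hB (dual_complexify hε') _ _ _

/-- `V_{D(L)}` is a conformal super vertex algebra: the conformal vector has lattice part `0`, so
that its modes are the restrictions of the Virasoro operators of `V_L`. -/
theorem isConformalSuperVertexAlgebra_cone (hB : B.IsSymm) {ε' : Fin r → ℚ ⊗[ℤ] L}
    (hε' : ∀ i j, B.baseChange ℚ (ε' i) (1 ⊗ₜ[ℤ] ε j) = if i = j then 1 else 0)
    (hb : ∀ lam mu, b lam mu + b mu lam = ((B lam mu + B lam lam * B mu mu : ℤ) : ZMod 2)) :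
    IsConformalSuperVertexAlgebra (conePar B ε) (coneY B b ε) (coneVac ε) (coneOmega B ε ε') r where
  isSuperVertexAlgebra := isSuperVertexAlgebra_cone hB (dual_complexify hε') hb
  conformal_even := coneOmega_mem_P ε' (by simp)
  virasoro m n v := by
    refine Subtype.ext ?_
    have h := virasoroOp_commutator (ε := ε) hB (dual_complexify hε') m n v
    simp only [Submodule.coe_sub, Submodule.coe_add, Submodule.coe_smul, coneY_coneOmega hB hε']
    exact h
  translation_eq v := coneFold_injective fun s hs => by
    have he := dual_complexify hε'
    rw [coneFold_coneY hB he hs, coneFold_coneY hB he hs, coneFold_coneVac,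
      latticeMode_neg_two_vacuum hB he, coneFold_coneOmega]
    have h := latticeMode_coneOmega (b := b) (ε := ε) hB hε' (-1) (coneFold ε s v)
    rw [neg_add_cancel] at h
    rw [h, virasoroOp_neg_one hB he]
  grading := isInternal_eigenspace_half (v := coneMonomial ε) (d := twiceWeight B ε)
    (coneMonomial_eigenvector hB hε') mem_span_coneMonomial

end Lattice

section Lattice

variable {L : Type*} [AddCommGroup L] {r : ℕ} {B : LinearMap.BilinForm ℤ L}
  {ε : Module.Basis (Fin r) ℤ L} {b : L →+ L →+ ZMod 2}

/-! ### Finiteness of the graded components -/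

theorem mem_coneP_iff {lam : L} : lam ∈ latticePoints (coneP ε) ↔ ∀ i, 0 ≤ ε.repr lam i := by
  have hb : ∀ i, (ε.baseChange ℚ) i = (1 : ℚ) ⊗ₜ[ℤ] ε i := fun i =>
    Module.Basis.baseChange_apply _ _ _
  constructor
  · rintro ⟨α, hα, h⟩ i
    have h₁ := congrArg (fun x => (ε.baseChange ℚ).repr x i) h
    simp only [← hb, map_sum, map_smul, Module.Basis.repr_self] at h₁
    rw [Module.Basis.baseChange_repr_tmul, Finset.sum_apply'] at h₁
    simp only [Finsupp.smul_apply, Finsupp.single_apply, smul_eq_mul, mul_ite, mul_one, mul_zero,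
      Finset.sum_ite_eq', Finset.mem_univ, if_true] at h₁
    have h₂ := hα i
    rw [← h₁] at h₂
    simpa using h₂
  · intro h
    refine ⟨fun i => ε.repr lam i, fun i => Int.cast_nonneg (h i), ?_⟩
    conv_lhs => rw [← ε.sum_repr lam, TensorProduct.tmul_sum]
    refine Finset.sum_congr rfl fun i _ => ?_
    rw [TensorProduct.tmul_smul, Int.cast_smul_eq_zsmul]

theorem tmul_ne_zero_of_ne_zero (ε : Module.Basis (Fin r) ℤ L) {lam : L} (h : lam ≠ 0) :
    (1 : ℚ) ⊗ₜ[ℤ] lam ≠ 0 := by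
  intro h0
  refine h (ε.repr.map_eq_zero_iff.1 (Finsupp.ext fun i => ?_))
  have h₁ := congrArg (fun x => (ε.baseChange ℚ).repr x i) h0
  simp only [Module.Basis.baseChange_repr_tmul, map_zero, Finsupp.zero_apply] at h₁
  simpa using h₁

theorem pos_of_coneD (h : ∀ x ∈ coneD ε, x ≠ 0 → 0 < B.baseChange ℚ x x) {lam : L}
    (hlam : lam ∈ latticePoints (coneD ε)) (h0 : lam ≠ 0) : 0 < B lam lam := by
  have := h _ hlam (tmul_ne_zero_of_ne_zero ε h0)
  rw [LinearMap.BilinForm.baseChange_tmul] at this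
  simpa using this

/-- If the form is positive on the non-zero lattice points of the cone `P`, then it takes bounded
values only finitely often there. Otherwise Dickson's lemma gives a strictly increasing sequence
`y` of lattice points of bounded norm. As the form is positive at `y j ± y i`, the products
`⟨y i, y j⟩` are bounded, so that infinitely many of the `y i` have the same products with the
elements of a finite generating set of the span of the sequence. The difference of two of them is
then isotropic, although it is a non-zero point of `P` up to sign. -/
theorem finite_coneP_le (hB : B.IsSymm)
    (hpos : ∀ lam ∈ latticePoints (coneP ε), lam ≠ 0 → 0 < B lam lam) (d : ℤ) :
    {lam | lam ∈ latticePoints (coneP ε) ∧ B lam lam ≤ d}.Finite := by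
  by_contra hinf
  let x : ℕ → L := fun n => (Set.Infinite.natEmbedding _ hinf n : L)
  have hx : Function.Injective x :=
    Subtype.val_injective.comp (Set.Infinite.natEmbedding _ hinf).injective
  have hxP : ∀ n, x n ∈ latticePoints (coneP ε) ∧ B (x n) (x n) ≤ d :=
    fun n => (Set.Infinite.natEmbedding _ hinf n).2
  -- Dickson's lemma for the coordinates.
  obtain ⟨g, hg⟩ := (wellQuasiOrdered_le (α := Fin r → ℕ)).exists_monotone_subseq
    (fun n i => (ε.repr (x n) i).toNat)
  let y : ℕ → L := fun n => x (g n)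
  have hy : Function.Injective y := hx.comp g.injective
  have hyP : ∀ n, y n ∈ latticePoints (coneP ε) ∧ B (y n) (y n) ≤ d := fun n => hxP _
  have hsub : ∀ i j, i ≤ j → y j - y i ∈ latticePoints (coneP ε) := fun i j hij => by
    refine mem_coneP_iff.2 fun k => ?_
    have h₁ := hg i j hij k
    have h₂ := mem_coneP_iff.1 (hyP i).1 k
    have h₃ := mem_coneP_iff.1 (hyP j).1 k
    rw [map_sub, Finsupp.sub_apply]
    simp only at h₁
    have h₄ : y i = x (g i) := rfl
    have h₅ : y j = x (g j) := rfl
    rw [h₄] at h₂ ⊢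
    rw [h₅] at h₃ ⊢
    omega
  have hnonneg : ∀ lam ∈ latticePoints (coneP ε), 0 ≤ B lam lam := fun lam h => by
    by_cases h0 : lam = 0
    · simp [h0]
    · exact (hpos lam h h0).le
  have hsymm : ∀ u v, B u v = B v u := fun u v => hB.eq u v
  have hbd' : ∀ i j, i ≤ j → B (y i) (y j) ∈ Set.Icc (-d) d := fun i j hij => by
    have h₁ := hnonneg _ (hsub i j hij)
    have h₂ := hnonneg _ (add_mem_coneP (hyP i).1 (hyP j).1)
    have h₃ := (hyP i).2
    have h₄ := (hyP j).2
    have h₅ := hsymm (y i) (y j)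
    simp only [map_sub, map_add, LinearMap.sub_apply, LinearMap.add_apply] at h₁ h₂
    constructor <;> omega
  have hbd : ∀ i j, B (y i) (y j) ∈ Set.Icc (-d) d := fun i j => by
    rcases le_total i j with h | h
    · exact hbd' i j h
    · rw [hsymm]
      exact hbd' j i h
  have : Module.Finite ℤ L := Module.Finite.of_basis ε
  obtain ⟨S, hS, hspan⟩ := (Submodule.fg_span_iff_fg_span_finset_subset (R := ℤ)
    (Set.range y)).1 (IsNoetherian.noetherian _)
  -- The products of `y n` with the finitely many generators take finitely many values.
  let f : ℕ → (S → Set.Icc (-d) d) := fun n z => ⟨B (y n) z, by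
    obtain ⟨m, hm⟩ := hS z.2
    rw [← hm]
    exact hbd n m⟩
  obtain ⟨i, j, hij, hf⟩ := Finite.exists_ne_map_eq_of_infinite f
  have horth : ∀ v ∈ Submodule.span ℤ (Set.range y), B (y i - y j) v = 0 := fun v hv => by
    rw [hspan] at hv
    induction hv using Submodule.span_induction with
    | mem z hz =>
      have := congrArg Subtype.val (congrFun hf ⟨z, hz⟩)
      rw [map_sub, LinearMap.sub_apply]
      exact sub_eq_zero.2 this
    | zero => exact map_zero _
    | add u v _ _ hu hv => rw [map_add, hu, hv, add_zero]
    | smul c v _ hv => rw [map_smul, hv, smul_zero]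
  have hz : B (y i - y j) (y i - y j) = 0 := horth _ (Submodule.sub_mem _
    (Submodule.subset_span ⟨i, rfl⟩) (Submodule.subset_span ⟨j, rfl⟩))
  rcases le_total i j with h | h
  · have := hpos _ (hsub i j h) (sub_ne_zero.2 fun h' => hij (hy h').symm)
    rw [← neg_sub (y i)] at this
    simp only [map_neg, LinearMap.neg_apply, neg_neg] at this
    exact this.ne' hz
  · exact (hpos _ (hsub j i h) (sub_ne_zero.2 fun h' => hij (hy h'))).ne' hz

theorem finite_coneD_le (hB : B.IsSymm)
    (hpos : ∀ lam ∈ latticePoints (coneD ε), lam ≠ 0 → 0 < B lam lam) (d : ℤ) :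
    {lam | lam ∈ latticePoints (coneD ε) ∧ B lam lam ≤ d}.Finite := by
  have h := finite_coneP_le (ε := ε) hB (fun lam h => hpos lam (Or.inl h)) d
  refine (h.union (h.image fun lam => -lam)).subset ?_
  rintro lam ⟨hP | hN, hd⟩
  · exact Or.inl ⟨hP, hd⟩
  · exact Or.inr ⟨-lam, ⟨neg_mem_coneP hN, by simpa using hd⟩, neg_neg lam⟩

theorem finite_oscillatorDegree_le (d : ℕ) :
    {s : Fin r × ℕ →₀ ℕ | oscillatorDegree s ≤ d}.Finite := by
  classical
  -- Only the variables `εᵢ(-k-1)` with `k < d` occur, and with exponents at most `d`.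
  let t : Fin r × ℕ →₀ ℕ := Finsupp.onFinset (Finset.univ ×ˢ Finset.range d)
    (fun x => if x ∈ Finset.univ ×ˢ Finset.range d then d else 0) fun x hx => by
      by_contra h
      exact hx (if_neg h)
  refine (Set.finite_Iic t).subset fun s hs => ?_
  intro x
  have h : s x * (x.2 + 1) ≤ d := by
    refine le_trans ?_ hs
    by_cases hx : x ∈ s.support
    · exact Finset.single_le_sum (f := fun x => s x * (x.2 + 1)) (fun _ _ => Nat.zero_le _) hx
    · rw [Finsupp.notMem_support_iff.1 hx, zero_mul]
      exact Nat.zero_le _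
  rcases Nat.eq_zero_or_pos (s x) with h0 | h0
  · rw [h0]
    exact Nat.zero_le _
  · have h₁ : s x ≤ d := (Nat.le_mul_of_pos_right _ (Nat.succ_pos _)).trans h
    have h₂ : x.2 + 1 ≤ d := (Nat.le_mul_of_pos_left _ h0).trans h
    have hx : x ∈ Finset.univ ×ˢ Finset.range d := by
      simp only [Finset.mem_product, Finset.mem_univ, Finset.mem_range, true_and]
      omega
    exact h₁.trans (if_pos hx).ge

theorem finite_twiceWeight_eq (hB : B.IsSymm)
    (hpos : ∀ lam ∈ latticePoints (coneD ε), lam ≠ 0 → 0 < B lam lam) (d : ℤ) :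
    {i | twiceWeight B ε i = d}.Finite := by
  refine Set.Finite.subset (((finite_coneD_le (ε := ε) hB hpos d).preimage
    Subtype.val_injective.injOn).prod (finite_oscillatorDegree_le d.toNat)) fun i hi => ?_
  have hi' : 2 * (oscillatorDegree i.2 : ℤ) + B i.1 i.1 = d := hi
  have h0 : 0 ≤ B i.1 i.1 := by
    by_cases h0 : (i.1 : L) = 0
    · simp [h0]
    · exact (hpos _ i.1.2 h0).le
  exact ⟨⟨i.1.2, by omega⟩, show oscillatorDegree i.2 ≤ d.toNat by omega⟩

/-- `V_{D(L)}` is a super vertex operator algebra if the form is positive on the cone: by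
`finite_twiceWeight_eq` there are finitely many monomials of each weight, all weights are
non-negative, and the parity of `v_λ` is that of twice its weight. -/
theorem isSuperVertexOperatorAlgebra_cone (hB : B.IsSymm) {ε' : Fin r → ℚ ⊗[ℤ] L}
    (hε' : ∀ i j, B.baseChange ℚ (ε' i) (1 ⊗ₜ[ℤ] ε j) = if i = j then 1 else 0)
    (hb : ∀ lam mu, b lam mu + b mu lam = ((B lam mu + B lam lam * B mu mu : ℤ) : ZMod 2))
    (hpos : ∀ lam ∈ latticePoints (coneD ε), lam ≠ 0 → 0 < B lam lam) :
    IsSuperVertexOperatorAlgebra (conePar B ε) (coneY B b ε) (coneVac ε) (coneOmega B ε ε') r where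
  conformal := isConformalSuperVertexAlgebra_cone hB hε' hb
  finite_dim d := finiteDimensional_eigenspace_half (c := coneCoord ε) (d := twiceWeight B ε)
    (coneCoord_injective (ε := ε)) (coneCoord_coneOmega hB hε') (finite_twiceWeight_eq hB hpos d)
  bounded_below := by
    refine ⟨0, fun d hd => (Submodule.eq_bot_iff _).2 ?_⟩
    intro x hx
    refine coneCoord_injective x (funext fun i => ?_)
    by_contra hi
    have h := eq_of_mem_eigenspace_half (c := coneCoord ε) (d := twiceWeight B ε)
      (coneCoord_coneOmega hB hε') hx hi
    have h' : 2 * (oscillatorDegree i.2 : ℤ) + B i.1 i.1 = d := h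
    have h0 : 0 ≤ B i.1 i.1 := by
      by_cases h0 : (i.1 : L) = 0
      · simp [h0]
      · exact (hpos _ i.1.2 h0).le
    omega
  spin_statistics := by
    intro d x hx lam hlam
    obtain ⟨s, hs⟩ := MvPolynomial.ne_zero_iff.1 (Finsupp.mem_support_iff.1 hlam)
    have h := eq_of_mem_eigenspace_half (c := coneCoord ε) (d := twiceWeight B ε)
      (coneCoord_coneOmega hB hε') hx (i := (⟨lam, x.2 hlam⟩, s)) hs
    have h' : 2 * (oscillatorDegree s : ℤ) + B lam lam = d := h
    change ((B lam lam : ℤ) : ZMod 2) = d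
    rw [← h', Int.cast_add, Int.cast_mul, show ((2 : ℤ) : ZMod 2) = 0 by decide, zero_mul, zero_add]

end Lattice

end ConeVA

end

theorem mainTheorem5 {L : Type*} [AddCommGroup L] {r : ℕ}
    (B : LinearMap.BilinForm ℤ L) (hB : B.IsSymm)
    (ε : Module.Basis (Fin r) ℤ L)
    (ε' : Fin r → ℚ ⊗[ℤ] L)
    (hε' : ∀ i j, B.baseChange ℚ (ε' i) (1 ⊗ₜ[ℤ] ε j) = if i = j then 1 else 0)
    (b : L →+ L →+ ZMod 2)
    (hb : ∀ lam mu, b lam mu + b mu lam = ((B lam mu + B lam lam * B mu mu : ℤ) : ZMod 2)) :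
    ConeVA.IsConformalSuperVertexAlgebra (ConeVA.conePar B ε) (ConeVA.coneY B b ε)
        (ConeVA.coneVac ε) (ConeVA.coneOmega B ε ε') r ∧
      ((∀ x ∈ ConeVA.coneD ε, x ≠ 0 → 0 < B.baseChange ℚ x x) →
        ConeVA.IsSuperVertexOperatorAlgebra (ConeVA.conePar B ε) (ConeVA.coneY B b ε)
          (ConeVA.coneVac ε) (ConeVA.coneOmega B ε ε') r) :=
  ⟨ConeVA.isConformalSuperVertexAlgebra_cone hB hε' hb, fun h =>
    ConeVA.isSuperVertexOperatorAlgebra_cone hB hε' hb fun _ hlam h0 =>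
      ConeVA.pos_of_coneD h hlam h0⟩
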